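/- Let $n\ge 2$, let $\Omega\subset\mathbb{R}^n$ be an arbitrary open set, and let $L=\sum_\alpha B_\alpha\partial^\alpha$ (a finite sum, with constant matrices $B_\alpha\in\mathbb{C}^{l\times m}$) be a differential operator with constant coefficients acting from $C^\infty(\Omega,\mathbb{C}^m)$ to $C^\infty(\Omega,\mathbb{C}^l)$. Put $H=L_2(\Omega,\mathbb{C}^m)$ and assume that the form $\int_\Omega|Lu(x)|^2\,dx$ with domain $\{u\in C^\infty(\Omega,\mathbb{C}^m)\cap H:\ Lu\in L_2(\Omega,\mathbb{C}^l)\}$ is closable in $H$. Let $\mathbf{a}$ be its closure, $H^1=\mathcal{D}(\mathbf{a})$ with the norm $(\mathbf{a}[u]+\|u\|^2)^{1/2}$, and let $H^1_0$ be the closure of $C_0^\infty(\Omega,\mathbb{C}^m)$ in $H^1$. Let $A_{\mathrm N}$ and $A_{\mathrm D}$ be the self-adjoint operators in $H$ generated by $\mathbf{a}$ and by its restriction to $H^1_0$, respectively (the Neumann and Dirichlet realizations of $L^*L$). For $\mathrm{B}\in\{\mathrm{N},\mathrm{D}\}$ let $\lambda_{\mathrm B,\infty}=\inf\sigma_{\mathrm{ess}}(A_{\mathrm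 B})\in(-\infty,+\infty]$ (with $\inf\varnothing=+\infty$), and let $\lambda_{\mathrm B,1}\le\lambda_{\mathrm B,2}\le\dots$ be the eigenvalues of $A_{\mathrm B}$ in $(-\infty,\lambda_{\mathrm B,\infty})$, counted with multiplicities. Then for every Dirichlet eigenvalue $\lambda_{\mathrm D,k}$ lying in $(0,\lambda_{\mathrm N,\infty})$ the eigenvalue $\lambda_{\mathrm N,k+1}$ exists and $$\lambda_{\mathrm N,k+1}\le\lambda_{\mathrm D,k}.$$ If, moreover, at least one eigenfunction of $A_{\mathrm D}$ corresponding to $\lambda_{\mathrm D,k}$ does not satisfy the Neumann boundary condition, that is, does not belong to $\mathcal{D}(A_{\mathrm N})$, then $\lambda_{\mathrm N,k+1}<\lambda_{\mathrm D,k}$. -/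

import Mathlib

open MeasureTheory Filter TopologicalSpace
open scoped Topology ContDiff

noncomputable section

namespace Payne

/-! ### Operators in a Hilbert space: spectrum, eigenvalues, operators generated by forms -/

section Abstract

variable {H K : Type*} [NormedAddCommGroup H] [InnerProductSpace ℂ H]
  [NormedAddCommGroup K] [InnerProductSpace ℂ K]

/-- The set of real `r` for which `A - r` has no bounded everywhere defined two-sided inverse.
For a self-adjoint operator `A` this is the whole spectrum. -/
def realSpectrum (A : H →ₗ.[ℂ] H) : Set ℝ :=
  {r | ¬ ∃ R : H →L[ℂ] H,
    (∀ f : H, ∃ h : R f ∈ A.domain, A ⟨R f, h⟩ - (r : ℂ) • R f = f) ∧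
    (∀ u : A.domain, R (A u - (r : ℂ) • (u : H)) = u)}

/-- `ker (A - r)`: all `u` in the domain of `A` with `A u = r u`. -/
def eigenspace (A : H →ₗ.[ℂ] H) (r : ℝ) : Submodule ℂ H :=
  A.graph.comap (LinearMap.prod LinearMap.id ((r : ℂ) • LinearMap.id))

/-- Isolated points of the spectrum which are eigenvalues of finite multiplicity. -/
def discreteSpectrum (A : H →ₗ.[ℂ] H) : Set ℝ :=
  {r | r ∈ realSpectrum A ∧ (∃ ε > 0, ∀ s ∈ realSpectrum A, |s - r| < ε → s = r) ∧
    eigenspace A r ≠ ⊥ ∧ FiniteDimensional ℂ (eigenspace A r)}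

/-- The essential spectrum of a self-adjoint operator. -/
def essSpectrum (A : H →ₗ.[ℂ] H) : Set ℝ :=
  realSpectrum A \ discreteSpectrum A

/-- `λ_∞ = inf σ_ess(A)`, equal to `+∞` if the essential spectrum is empty. -/
def essBottom (A : H →ₗ.[ℂ] H) : EReal :=
  ⨅ r ∈ essSpectrum A, (r : EReal)

/-- The number of eigenvalues of the self-adjoint operator `A` lying in `S`, counted with their
multiplicities, that is, the dimension of the linear span of the corresponding eigenvectors. -/
def eigenvalueCount (A : H →ₗ.[ℂ] H) (S : Set ℝ) : ℕ∞ :=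
  Cardinal.toENat (Module.rank ℂ ↥(⨆ r ∈ S, eigenspace A r))

/-- `r = λ_k`, where `λ_1 ≤ λ_2 ≤ …` are the eigenvalues of `A` below `inf σ_ess(A)` counted with
their multiplicities: fewer than `k` of them are `< r`, and at least `k` of them are `≤ r`.
(There is no such `r` for `k = 0`.) -/
def IsNthEigenvalue (A : H →ₗ.[ℂ] H) (k : ℕ) (r : ℝ) : Prop :=
  (r : EReal) < essBottom A ∧
    eigenvalueCount A (Set.Iio r) < k ∧ (k : ℕ∞) ≤ eigenvalueCount A (Set.Iic r)

theorem IsNthEigenvalue.unique {A : H →ₗ.[ℂ] H} {k : ℕ} {r s : ℝ}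
    (hr : IsNthEigenvalue A k r) (hs : IsNthEigenvalue A k s) : r = s := by
  have key : ∀ {r s : ℝ}, IsNthEigenvalue A k r → IsNthEigenvalue A k s → ¬ r < s := by
    intro r s hr hs h
    have hle : (⨆ t ∈ Set.Iic r, eigenspace A t) ≤ ⨆ t ∈ Set.Iio s, eigenspace A t :=
      biSup_mono fun t ht => lt_of_le_of_lt ht h
    have hc : eigenvalueCount A (Set.Iic r) ≤ eigenvalueCount A (Set.Iio s) :=
      OrderHomClass.mono Cardinal.toENat (Submodule.rank_mono hle)
    exact absurd (lt_of_le_of_lt (hr.2.2.trans hc) hs.2.1) (lt_irrefl _)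
  exact le_antisymm (not_lt.1 (key hs hr)) (not_lt.1 (key hr hs))

/-- The quadratic form `a[u] = ‖T u‖²` with domain `D(T)` is closable in `H`: if `u j → 0` in `H`
and `a[u i - u j] → 0`, then `a[u j] → 0`. -/
def FormClosable (T : H →ₗ.[ℂ] K) : Prop :=
  ∀ u : ℕ → T.domain, Tendsto (fun j => (u j : H)) atTop (𝓝 0) →
    (∀ ε > 0, ∃ N : ℕ, ∀ i ≥ N, ∀ j ≥ N, ‖T (u i - u j)‖ ^ 2 < ε) →
    Tendsto (fun j => ‖T (u j)‖ ^ 2) atTop (𝓝 0)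

/-- The graph of the operator generated by the form `a[u, v] = (T u, T v)`, `u, v ∈ D(T)`:
the pairs `(u, f)` with `u ∈ D(T)` and `a[u, v] = (f, v)` for all `v ∈ D(T)`.
(Mathlib's inner product is conjugate linear in the first argument.) -/
def formGraph (T : H →ₗ.[ℂ] K) : Submodule ℂ (H × H) where
  carrier := {p | ∃ hu : p.1 ∈ T.domain, ∀ v : T.domain,
    inner ℂ (v : H) p.2 = inner ℂ (T v) (T ⟨p.1, hu⟩)}
  zero_mem' := by
    refine ⟨T.domain.zero_mem, fun v => ?_⟩
    have h : T ⟨(0 : H × H).1, T.domain.zero_mem⟩ = 0 := T.map_zero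
    rw [h]; simp
  add_mem' := by
    rintro ⟨u, f⟩ ⟨u', f'⟩ ⟨hu, h⟩ ⟨hu', h'⟩
    refine ⟨T.domain.add_mem hu hu', fun v => ?_⟩
    have e : T ⟨((u, f) + (u', f')).1, T.domain.add_mem hu hu'⟩ = T ⟨u, hu⟩ + T ⟨u', hu'⟩ :=
      T.map_add ⟨u, hu⟩ ⟨u', hu'⟩
    rw [e, inner_add_right, ← h v, ← h' v, ← inner_add_right]
    rfl
  smul_mem' := by
    rintro c ⟨u, f⟩ ⟨hu, h⟩
    refine ⟨T.domain.smul_mem c hu, fun v => ?_⟩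
    have e : T ⟨(c • (u, f)).1, T.domain.smul_mem c hu⟩ = c • T ⟨u, hu⟩ :=
      T.map_smul c ⟨u, hu⟩
    rw [e, inner_smul_right, ← h v, ← inner_smul_right]
    rfl

/-- The operator generated by the form `a[u, v] = (T u, T v)` on `D(T)`. -/
def formOperator (T : H →ₗ.[ℂ] K) : H →ₗ.[ℂ] H :=
  (formGraph T).toLinearPMap

end Abstract

/-! ### Differential operators with constant coefficients -/

/-- `L₂(Ω, ℂ^d)`. -/
abbrev L2 {n : ℕ} (Ω : Opens (EuclideanSpace ℝ (Fin n))) (d : ℕ) : Type :=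
  Lp (EuclideanSpace ℂ (Fin d)) 2 (volume.restrict (Ω : Set (EuclideanSpace ℝ (Fin n))))

section Diff

variable {n : ℕ} {F : Type*} [NormedAddCommGroup F] [NormedSpace ℝ F]

/-- `∂f/∂x_i`. -/
def pderiv (i : Fin n) (f : EuclideanSpace ℝ (Fin n) → F) : EuclideanSpace ℝ (Fin n) → F :=
  fun x => fderiv ℝ f x (EuclideanSpace.single i 1)

/-- `∂^α f = ∂_1^{α_1} ⋯ ∂_n^{α_n} f`. -/
def multiDeriv (α : Fin n →₀ ℕ) (f : EuclideanSpace ℝ (Fin n) → F) :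
    EuclideanSpace ℝ (Fin n) → F :=
  (List.finRange n).foldr (fun i g => (pderiv i)^[α i] g) f

/-- The coefficients of a differential operator `L = ∑_α B_α ∂^α` (finite sum) with constant
complex `l × m` matrices `B_α`. -/
abbrev Coeffs (n m l : ℕ) : Type := (Fin n →₀ ℕ) →₀ Matrix (Fin l) (Fin m) ℂ

/-- `L f = ∑_α B_α ∂^α f`. -/
def applyOp {m l : ℕ} (B : Coeffs n m l)
    (f : EuclideanSpace ℝ (Fin n) → EuclideanSpace ℂ (Fin m)) :
    EuclideanSpace ℝ (Fin n) → EuclideanSpace ℂ (Fin l) :=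
  fun x => ∑ α ∈ B.support, (B α).toEuclideanLin (multiDeriv α f x)

end Diff

section Linearity

variable {n : ℕ} {F : Type*} [NormedAddCommGroup F] [NormedSpace ℝ F]
  {Ω : Opens (EuclideanSpace ℝ (Fin n))}

/-- `D` maps `C^∞(Ω)` to itself, is `ℂ`-linear there, and is local. -/
def GoodOn [NormedSpace ℂ F] (Ω : Opens (EuclideanSpace ℝ (Fin n)))
    (D : (EuclideanSpace ℝ (Fin n) → F) → (EuclideanSpace ℝ (Fin n) → F)) : Prop :=
  (∀ f, ContDiffOn ℝ ∞ f Ω → ContDiffOn ℝ ∞ (D f) Ω) ∧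
  (∀ f g, ContDiffOn ℝ ∞ f Ω → ContDiffOn ℝ ∞ g Ω → Set.EqOn (D (f + g)) (D f + D g) Ω) ∧
  (∀ (c : ℂ) (f), ContDiffOn ℝ ∞ f Ω → Set.EqOn (D (c • f)) (c • D f) Ω) ∧
  (∀ f g, Set.EqOn f g Ω → Set.EqOn (D f) (D g) Ω)

theorem GoodOn.id [NormedSpace ℂ F] : GoodOn (F := F) Ω (fun f => f) :=
  ⟨fun _ h => h, fun _ _ _ _ _ _ => rfl, fun _ _ _ _ _ => rfl, fun _ _ h => h⟩

theorem GoodOn.comp [NormedSpace ℂ F]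
    {D D' : (EuclideanSpace ℝ (Fin n) → F) → (EuclideanSpace ℝ (Fin n) → F)}
    (h : GoodOn Ω D) (h' : GoodOn Ω D') : GoodOn Ω (fun f => D (D' f)) := by
  refine ⟨fun f hf => h.1 _ (h'.1 f hf), fun f g hf hg => ?_, fun c f hf => ?_,
    fun f g e => h.2.2.2 _ _ (h'.2.2.2 f g e)⟩
  · exact (h.2.2.2 _ _ (h'.2.1 f g hf hg)).trans (h.2.1 _ _ (h'.1 f hf) (h'.1 g hg))
  · exact (h.2.2.2 _ _ (h'.2.2.1 c f hf)).trans (h.2.2.1 c _ (h'.1 f hf))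

theorem goodOn_pderiv [NormedSpace ℂ F] (i : Fin n) : GoodOn (F := F) Ω (pderiv i) := by
  have hd : ∀ f : EuclideanSpace ℝ (Fin n) → F, ContDiffOn ℝ ∞ f Ω → ∀ x ∈ Ω,
      DifferentiableAt ℝ f x := fun f hf x hx =>
    (hf.contDiffAt (Ω.isOpen.mem_nhds hx)).differentiableAt (by simp)
  refine ⟨fun f hf => ?_, fun f g hf hg x hx => ?_, fun c f hf x hx => ?_, fun f g e x hx => ?_⟩
  · exact (hf.fderiv_of_isOpen Ω.isOpen (by simp)).clm_apply contDiffOn_const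
  · simp [pderiv, fderiv_add (hd f hf x hx) (hd g hg x hx)]
  · simp [pderiv, fderiv_const_smul (hd f hf x hx)]
  · have : f =ᶠ[𝓝 x] g := Filter.eventuallyEq_of_mem (Ω.isOpen.mem_nhds hx) e
    simp [pderiv, this.fderiv_eq]

theorem goodOn_multiDeriv [NormedSpace ℂ F] (α : Fin n →₀ ℕ) :
    GoodOn (F := F) Ω (multiDeriv α) := by
  have it : ∀ (i : Fin n) (k : ℕ), GoodOn (F := F) Ω (pderiv i)^[k] := by
    intro i k
    induction k with
    | zero => exact GoodOn.id
    | succ k ih =>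
      have h := GoodOn.comp ih (goodOn_pderiv (F := F) (Ω := Ω) i)
      exact h
  unfold multiDeriv
  induction List.finRange n with
  | nil => exact GoodOn.id
  | cons i t ih => exact GoodOn.comp (it i (α i)) ih

variable {m l : ℕ} (B : Coeffs n m l)

theorem applyOp_add {f g : EuclideanSpace ℝ (Fin n) → EuclideanSpace ℂ (Fin m)}
    (hf : ContDiffOn ℝ ∞ f Ω) (hg : ContDiffOn ℝ ∞ g Ω) :
    Set.EqOn (applyOp B (f + g)) (applyOp B f + applyOp B g) Ω := by
  intro x hx
  simp only [applyOp, Pi.add_apply, ← Finset.sum_add_distrib]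
  refine Finset.sum_congr rfl fun α _ => ?_
  rw [(goodOn_multiDeriv α).2.1 f g hf hg hx, Pi.add_apply, map_add]

theorem applyOp_smul (c : ℂ) {f : EuclideanSpace ℝ (Fin n) → EuclideanSpace ℂ (Fin m)}
    (hf : ContDiffOn ℝ ∞ f Ω) :
    Set.EqOn (applyOp B (c • f)) (c • applyOp B f) Ω := by
  intro x hx
  simp only [applyOp, Pi.smul_apply, Finset.smul_sum]
  refine Finset.sum_congr rfl fun α _ => ?_
  rw [(goodOn_multiDeriv α).2.2.1 c f hf hx, Pi.smul_apply, map_smul]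

theorem applyOp_congr {f g : EuclideanSpace ℝ (Fin n) → EuclideanSpace ℂ (Fin m)}
    (h : Set.EqOn f g Ω) : Set.EqOn (applyOp B f) (applyOp B g) Ω := by
  intro x hx
  simp only [applyOp]
  refine Finset.sum_congr rfl fun α _ => ?_
  rw [(goodOn_multiDeriv α).2.2.2 f g h hx]

end Linearity

section Operators

variable {n m l : ℕ} (B : Coeffs n m l) (Ω : Opens (EuclideanSpace ℝ (Fin n)))

/-- The pairs `(f, L f)` with `f ∈ C^∞(Ω, ℂ^m) ∩ L₂(Ω, ℂ^m)` and `L f ∈ L₂(Ω, ℂ^l)`. -/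
def smoothGraph : Submodule ℂ (L2 Ω m × L2 Ω l) where
  carrier := {p | ∃ f : EuclideanSpace ℝ (Fin n) → EuclideanSpace ℂ (Fin m),
    ContDiffOn ℝ ∞ f Ω ∧
    p.1 =ᵐ[volume.restrict (Ω : Set (EuclideanSpace ℝ (Fin n)))] f ∧
    p.2 =ᵐ[volume.restrict (Ω : Set (EuclideanSpace ℝ (Fin n)))] applyOp B f}
  zero_mem' := by
    refine ⟨(0 : ℂ) • 0, contDiffOn_const.congr fun x _ => by simp; rfl, ?_, ?_⟩
    · filter_upwards [Lp.coeFn_zero (EuclideanSpace ℂ (Fin m)) 2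
        (volume.restrict (Ω : Set (EuclideanSpace ℝ (Fin n))))] with x hx
      simpa using hx
    · filter_upwards [Lp.coeFn_zero (EuclideanSpace ℂ (Fin l)) 2
        (volume.restrict (Ω : Set (EuclideanSpace ℝ (Fin n)))),
        ae_restrict_mem Ω.isOpen.measurableSet] with x hx hxΩ
      rw [applyOp_smul B 0 (f := 0) (contDiffOn_const (c := 0)) hxΩ]
      simpa using hx
  add_mem' := by
    rintro ⟨u, w⟩ ⟨u', w'⟩ ⟨f, hf, hu, hw⟩ ⟨f', hf', hu', hw'⟩
    refine ⟨f + f', hf.add hf', ?_, ?_⟩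
    · filter_upwards [Lp.coeFn_add u u', hu, hu'] with x h1 h2 h3
      exact h1.trans (congrArg₂ (· + ·) h2 h3)
    · filter_upwards [Lp.coeFn_add w w', hw, hw', ae_restrict_mem Ω.isOpen.measurableSet]
        with x h1 h2 h3 hx
      rw [applyOp_add B hf hf' hx]
      exact h1.trans (congrArg₂ (· + ·) h2 h3)
  smul_mem' := by
    rintro c ⟨u, w⟩ ⟨f, hf, hu, hw⟩
    refine ⟨c • f, hf.const_smul c, ?_, ?_⟩
    · filter_upwards [Lp.coeFn_smul c u, hu] with x h1 h2
      exact h1.trans (congrArg (c • ·) h2)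
    · filter_upwards [Lp.coeFn_smul c w, hw, ae_restrict_mem Ω.isOpen.measurableSet]
        with x h1 h2 hx
      rw [applyOp_smul B c hf hx]
      exact h1.trans (congrArg (c • ·) h2)

/-- `L f` depends only on the class of `f` in `L₂`, so `smoothGraph` is the graph of an
operator. -/
theorem smoothGraph_single_valued (p : L2 Ω m × L2 Ω l) (hp : p ∈ smoothGraph B Ω)
    (h0 : p.1 = 0) : p.2 = 0 := by
  obtain ⟨f, hf, hu, hw⟩ := hp
  have hz : f =ᵐ[volume.restrict (Ω : Set (EuclideanSpace ℝ (Fin n)))]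
      fun _ => (0 : EuclideanSpace ℂ (Fin m)) := by
    rw [h0] at hu
    exact hu.symm.trans (Lp.coeFn_zero _ _ _)
  have he : Set.EqOn f (fun _ => 0) Ω :=
    Measure.eqOn_open_of_ae_eq hz Ω.isOpen hf.continuousOn continuousOn_const
  have he' : Set.EqOn f ((0 : ℂ) • f) Ω := fun x hx => by simp [he hx]
  refine (Lp.eq_zero_iff_ae_eq_zero).2 ?_
  filter_upwards [hw, ae_restrict_mem Ω.isOpen.measurableSet] with x h1 hx
  rw [h1, applyOp_congr B he' hx, applyOp_smul B 0 hf hx]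
  simp

/-- The operator `L` in `L₂` with domain `{f ∈ C^∞(Ω, ℂ^m) ∩ L₂(Ω, ℂ^m) : L f ∈ L₂(Ω, ℂ^l)}`;
the form `∫_Ω |L f|² dx` is `‖smoothOp B Ω f‖²`. -/
def smoothOp : L2 Ω m →ₗ.[ℂ] L2 Ω l :=
  (smoothGraph B Ω).toLinearPMap

/-- `C_0^∞(Ω, ℂ^m)` as a subspace of `L₂(Ω, ℂ^m)`. -/
def testFunctions (m : ℕ) : Submodule ℂ (L2 Ω m) where
  carrier := {u | ∃ f : EuclideanSpace ℝ (Fin n) → EuclideanSpace ℂ (Fin m),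
    ContDiff ℝ ∞ f ∧ HasCompactSupport f ∧ tsupport f ⊆ Ω ∧
    u =ᵐ[volume.restrict (Ω : Set (EuclideanSpace ℝ (Fin n)))] f}
  zero_mem' := ⟨0, contDiff_const, HasCompactSupport.zero, by simp [tsupport],
    Lp.coeFn_zero _ _ _⟩
  add_mem' := by
    rintro u u' ⟨f, hf, hc, hs, hu⟩ ⟨f', hf', hc', hs', hu'⟩
    refine ⟨f + f', hf.add hf', hc.add hc', ?_, ?_⟩
    · exact (tsupport_add f f').trans (Set.union_subset hs hs')
    · filter_upwards [Lp.coeFn_add u u', hu, hu'] with x h1 h2 h3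
      exact h1.trans (congrArg₂ (· + ·) h2 h3)
  smul_mem' := by
    rintro c u ⟨f, hf, hc, hs, hu⟩
    refine ⟨c • f, hf.const_smul c, hc.smul_left (f := fun _ => c), ?_, ?_⟩
    · exact (closure_mono (Function.support_const_smul_subset c f)).trans hs
    · filter_upwards [Lp.coeFn_smul c u, hu] with x h1 h2
      exact h1.trans (congrArg (c • ·) h2)

/-- `A_N`: the operator generated by the closure `a` of the form `∫_Ω |L f|² dx`. The domain
`H¹ = D(a)` is the domain of the closure of `smoothOp B Ω`, and `a[u] = ‖(closure) u‖²`. -/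
def neumannOp : L2 Ω m →ₗ.[ℂ] L2 Ω m :=
  formOperator (smoothOp B Ω).closure

/-- `A_D`: the operator generated by the restriction of `a` to the `H¹`-closure `H¹_0` of
`C_0^∞(Ω, ℂ^m)`, where `H¹` carries the norm `(a[u] + ‖u‖²)^{1/2}`. -/
def dirichletOp : L2 Ω m →ₗ.[ℂ] L2 Ω m :=
  formOperator ((smoothOp B Ω).domRestrict (testFunctions Ω m)).closure

end Operators

end Payne

end

open MeasureTheory Filter TopologicalSpace
open scoped Topology ContDiff FourierTransform

noncomputable section

namespace Payne

section FormOperators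

variable {H K : Type*} [NormedAddCommGroup H] [InnerProductSpace ℂ H]
  [NormedAddCommGroup K] [InnerProductSpace ℂ K]

/-! Write `b` for the Dirichlet eigenvalue and `L(ξ)` for the symbol of `L`. On the span of the
Dirichlet eigenvectors with eigenvalues `≤ b`, of dimension at least `k`, the form is at most `b
‖u‖²`. If `L(ξ)* L(ξ) c = b c`, the plane wave `v = exp(2πi⟨x, ξ⟩) c` lies in the Neumann form
domain when `Ω` has finite volume, and `a[v] = b ‖v‖²`. Moreover `a[u, v] = b (u, v)` for `u ∈ H¹₀`,
since integration by parts against `u` leaves no boundary term. So adding `v` to a `k`-dimensional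
space `F` of such Dirichlet vectors keeps the form below `b` (`norm_sq_add_smul_le`).

A variational count (`finrank_le_of_form_le`) turns this into `k + 1` Neumann eigenvalues strictly
below `b`, provided that `F + ℂv` has dimension `k + 1` and meets `ker (A_N - b)` only in `0`. Both
hold once `v ∉ F + ker (A_N - b)`, because `H¹₀` contains no nonzero Neumann eigenvector for `b`:
its extension by zero would solve `L*L u = b u` on the whole space, so its Fourier transform would
live on the zero set of `det (L(ξ)* L(ξ) - b)`, which contains no open set
(`eq_zero_of_dirichlet_of_neumann`). The space to be avoided is finite dimensional and plane waves
of distinct frequencies are linearly independent, so infinitely many admissible `ξ` suffice.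

These are found on the set where the lowest eigenvalue of `L(ξ)* L(ξ)` equals `b`. The set `lowSet`
where it is `≤ b` is closed. It is bounded, since plane waves with `ξ → ∞` would otherwise form a
Weyl sequence (`isBounded_lowSet`). By Plancherel it has positive measure, because a Dirichlet form
value `≤ b ‖u‖²` exists with `u ≠ 0` (`volume_lowSet_ne_zero`). If the lowest eigenvalue is nowhere
`< b`, all of `lowSet` is admissible; otherwise the frontier of the open set where it is `< b` is
admissible, and it is infinite because removing finitely many points from `ℝⁿ`, `n ≥ 2`, leaves a
connected set (`infinite_lowSet_diff`).

Infinite volume cannot occur: slowly truncated plane waves would be a Weyl sequence at any point of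
`lowSet`, forcing it to be empty (`lowSet_eq_empty_of_volume_eq_top`). -/

theorem inner_self_eq_ofReal (u : H) : inner ℂ u u = ((‖u‖ ^ 2 : ℝ) : ℂ) := by
  rw [inner_self_eq_norm_sq_to_K]
  push_cast
  rfl

/-! ### Operators generated by closed forms -/

/-- Describing the form by pairs in the graph of `T` removes the dependence on membership proofs;
all later arguments carry `w = T u` along with `u`. -/
theorem mem_formGraph_iff {T : H →ₗ.[ℂ] K} {u f : H} :
    (u, f) ∈ formGraph T ↔ ∃ w, (u, w) ∈ T.graph ∧
      ∀ v z, (v, z) ∈ T.graph → inner ℂ v f = inner ℂ z w := by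
  constructor
  · rintro ⟨hu, h⟩
    refine ⟨T ⟨u, hu⟩, LinearPMap.mem_graph T ⟨u, hu⟩, fun v z hvz => ?_⟩
    obtain ⟨y, rfl, rfl⟩ := (LinearPMap.mem_graph_iff T).1 hvz
    exact h y
  · rintro ⟨w, huw, h⟩
    obtain ⟨y, hy, rfl⟩ := (LinearPMap.mem_graph_iff T).1 huw
    obtain rfl : (y : H) = u := hy
    exact ⟨y.2, fun v => h v (T v) (LinearPMap.mem_graph T v)⟩

/-- Density of the form domain makes `formGraph T` single-valued: `u = 0` forces `T u = 0`, so `f`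
is orthogonal to a dense set. -/
theorem graph_formOperator {T : H →ₗ.[ℂ] K} (hT : Dense (T.domain : Set H)) :
    (formOperator T).graph = formGraph T := by
  refine Submodule.toLinearPMap_graph_eq _ ?_
  rintro ⟨u, f⟩ hx (rfl : u = 0)
  obtain ⟨w, hw, h⟩ := mem_formGraph_iff.1 hx
  obtain rfl : w = 0 := T.graph_fst_eq_zero_snd hw rfl
  refine hT.eq_zero_of_inner_left ℂ fun v hv => ?_
  rw [← inner_conj_symm, h v (T ⟨v, hv⟩) (LinearPMap.mem_graph T ⟨v, hv⟩)]
  simp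

theorem mem_eigenspace_formOperator {T : H →ₗ.[ℂ] K} (hT : Dense (T.domain : Set H)) {r : ℝ}
    {u : H} : u ∈ eigenspace (formOperator T) r ↔ (u, (r : ℂ) • u) ∈ formGraph T := by
  rw [← graph_formOperator hT]
  rfl

theorem formGraph_symm {T : H →ₗ.[ℂ] K} {u f v g : H} (hu : (u, f) ∈ formGraph T)
    (hv : (v, g) ∈ formGraph T) : inner ℂ v f = inner ℂ g u := by
  obtain ⟨w, hw, h⟩ := mem_formGraph_iff.1 hu
  obtain ⟨z, hz, h'⟩ := mem_formGraph_iff.1 hv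
  rw [h v z hz, ← inner_conj_symm, ← h' u w hw, inner_conj_symm]

theorem inner_eq_zero_of_mem_eigenspace {T : H →ₗ.[ℂ] K} (hT : Dense (T.domain : Set H))
    {r s : ℝ} (hrs : r ≠ s) {u v : H} (hu : u ∈ eigenspace (formOperator T) r)
    (hv : v ∈ eigenspace (formOperator T) s) : inner ℂ u v = 0 := by
  have h := formGraph_symm ((mem_eigenspace_formOperator hT).1 hv)
    ((mem_eigenspace_formOperator hT).1 hu)
  rw [inner_smul_left, inner_smul_right, Complex.conj_ofReal, ← sub_eq_zero, ← sub_mul] at h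
  refine (mul_eq_zero.1 h).resolve_left ?_
  exact_mod_cast sub_ne_zero.2 hrs.symm

/-- The span of eigenvectors is contained in the domain and invariant, and the form is bounded
by `b ‖u‖²` on it if the eigenvalues are bounded by `b`. -/
theorem exists_formGraph_of_mem_iSup_eigenspace {T : H →ₗ.[ℂ] K}
    (hT : Dense (T.domain : Set H)) {S : Set ℝ} {b : ℝ} (hb : ∀ r ∈ S, r ≤ b) {u : H}
    (hu : u ∈ ⨆ r ∈ S, eigenspace (formOperator T) r) :
    ∃ f ∈ ⨆ r ∈ S, eigenspace (formOperator T) r, (u, f) ∈ formGraph T ∧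
      (inner ℂ u f).re ≤ b * ‖u‖ ^ 2 := by
  classical
  rw [iSup_subtype'] at hu ⊢
  obtain ⟨c, hc, rfl⟩ := (Submodule.mem_iSup_iff_exists_finsupp _ u).1 hu
  refine ⟨∑ r ∈ c.support, ((r : ℝ) : ℂ) • c r, ?_, ?_, ?_⟩
  · exact Submodule.sum_mem _ fun r _ =>
      Submodule.smul_mem _ _ (Submodule.mem_iSup_of_mem (p := fun r : S =>
        eigenspace (formOperator T) (r : ℝ)) r (hc r))
  · have : ∀ s : Finset S,
        (∑ r ∈ s, c r, ∑ r ∈ s, ((r : ℝ) : ℂ) • c r) ∈ formGraph T := by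
      intro s
      have := Submodule.sum_mem (formGraph T) (t := s)
        (fun r _ => (mem_eigenspace_formOperator hT).1 (hc r))
      convert this using 1
      ext <;> simp [Prod.fst_sum, Prod.snd_sum]
    exact this _
  · have orth : ∀ r s : S, r ≠ s → inner ℂ (c r) (c s) = 0 := fun r s hrs =>
      inner_eq_zero_of_mem_eigenspace hT (fun h => hrs (Subtype.ext h)) (hc r) (hc s)
    have e1 : inner ℂ (∑ r ∈ c.support, c r) (∑ r ∈ c.support, ((r : ℝ) : ℂ) • c r)
        = ∑ r ∈ c.support, (((r : ℝ) * ‖c r‖ ^ 2 : ℝ) : ℂ) := by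
      rw [sum_inner]
      refine Finset.sum_congr rfl fun r hr => ?_
      rw [inner_sum, Finset.sum_eq_single_of_mem r hr]
      · rw [inner_smul_right, inner_self_eq_norm_sq_to_K]; push_cast; rfl
      · intro s _ hs
        rw [inner_smul_right, orth r s hs.symm, mul_zero]
    have e2 : ‖∑ r ∈ c.support, c r‖ ^ 2 = ∑ r ∈ c.support, ‖c r‖ ^ 2 := by
      have : inner ℂ (∑ r ∈ c.support, c r) (∑ r ∈ c.support, c r)
          = ∑ r ∈ c.support, ((‖c r‖ ^ 2 : ℝ) : ℂ) := by
        rw [sum_inner]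
        refine Finset.sum_congr rfl fun r hr => ?_
        rw [inner_sum, Finset.sum_eq_single_of_mem r hr]
        · rw [inner_self_eq_norm_sq_to_K]; push_cast; rfl
        · intro s _ hs
          exact orth r s hs.symm
      rw [inner_self_eq_norm_sq_to_K, ← Complex.ofReal_sum] at this
      exact Complex.ofReal_injective (by rw [← this]; push_cast; rfl)
    simp only [Finsupp.sum] at *
    rw [e1, e2, ← Complex.ofReal_sum, Complex.ofReal_re, Finset.mul_sum]
    exact Finset.sum_le_sum fun r _ => mul_le_mul_of_nonneg_right (hb r r.2) (by positivity)

theorem nonneg_of_mem_eigenspace {T : H →ₗ.[ℂ] K} (hT : Dense (T.domain : Set H)) {r : ℝ} {u : H}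
    (hu : u ∈ eigenspace (formOperator T) r) (h0 : u ≠ 0) : 0 ≤ r := by
  obtain ⟨w, hw, h⟩ := mem_formGraph_iff.1 ((mem_eigenspace_formOperator hT).1 hu)
  have h1 := h u w hw
  rw [inner_smul_right, inner_self_eq_ofReal, inner_self_eq_ofReal, ← Complex.ofReal_mul] at h1
  have h2 : r * ‖u‖ ^ 2 = ‖w‖ ^ 2 := Complex.ofReal_injective h1
  have : 0 < ‖u‖ ^ 2 := by positivity
  by_contra! hr
  nlinarith [sq_nonneg ‖w‖]

theorem mem_realSpectrum_of_eigenspace_ne_bot {A : H →ₗ.[ℂ] H} {r : ℝ}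
    (h : eigenspace A r ≠ ⊥) : r ∈ realSpectrum A := by
  rintro ⟨R, -, hR⟩
  obtain ⟨u, hu, h0⟩ := (Submodule.ne_bot_iff _).1 h
  obtain ⟨y, hy1, hy2⟩ := (LinearPMap.mem_graph_iff _).1 (show (u, (r : ℂ) • u) ∈ A.graph from hu)
  have := hR y
  simp only at hy1 hy2
  rw [hy2, hy1, sub_self, map_zero] at this
  exact h0 this.symm

theorem mem_discreteSpectrum_of_lt_essBottom {A : H →ₗ.[ℂ] H} {r b : ℝ}
    (hb : (b : EReal) < essBottom A) (hrb : r ≤ b) (hr : r ∈ realSpectrum A) :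
    r ∈ discreteSpectrum A := by
  by_contra h
  have : essBottom A ≤ r := iInf₂_le r (show r ∈ essSpectrum A from ⟨hr, h⟩)
  exact absurd (hb.trans_le this) (not_lt.2 (by exact_mod_cast hrb))

theorem iSup_eigenspace_eq_iSup_eigenvalues (A : H →ₗ.[ℂ] H) (S : Set ℝ) :
    ⨆ r ∈ S, eigenspace A r = ⨆ r ∈ {r ∈ S | eigenspace A r ≠ ⊥}, eigenspace A r := by
  refine le_antisymm (iSup₂_le fun r hr => ?_) (biSup_mono fun r hr => hr.1)
  by_cases hbot : eigenspace A r = ⊥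
  · rw [hbot]; exact bot_le
  · exact le_iSup₂_of_le r ⟨hr, hbot⟩ le_rfl

/-- As `p` lies in the operator domain, `a[u - p, p] = (u - p, f)`. Orthogonality to `f` in `H` is
therefore orthogonality of `u - p` and `p` for the form, and Pythagoras applies. -/
theorem norm_sq_graph_sub {T : H →ₗ.[ℂ] K} {u p f : H} {w : K} (huw : (u, w) ∈ T.graph)
    (hp : (p, f) ∈ formGraph T) (horth : inner ℂ (u - p) f = 0) :
    ∃ y, (u - p, w - y) ∈ T.graph ∧ ‖w‖ ^ 2 = ‖w - y‖ ^ 2 + ‖y‖ ^ 2 ∧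
      ‖y‖ ^ 2 = (inner ℂ p f).re := by
  obtain ⟨y, hy, h⟩ := mem_formGraph_iff.1 hp
  have hd : (u - p, w - y) ∈ T.graph := T.graph.sub_mem huw hy
  refine ⟨y, hd, ?_, ?_⟩
  · have h0 : inner ℂ (w - y) y = 0 := by rw [← h _ _ hd, horth]
    have := norm_add_sq_eq_norm_sq_add_norm_sq_of_inner_eq_zero (𝕜 := ℂ) (w - y) y h0
    rw [sub_add_cancel] at this
    rw [sq, sq, sq, this]
  · rw [h _ _ hy, inner_self_eq_ofReal, Complex.ofReal_re]

theorem iSup_Iic_eigenspace (A : H →ₗ.[ℂ] H) (b : ℝ) :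
    ⨆ r ∈ Set.Iic b, eigenspace A r = (⨆ r ∈ Set.Iio b, eigenspace A r) ⊔ eigenspace A b := by
  rw [← Set.Iio_insert, iSup_insert, sup_comm]

theorem eigenvalueCount_congr {A : H →ₗ.[ℂ] H} {S S' : Set ℝ}
    (h : ∀ r, eigenspace A r ≠ ⊥ → (r ∈ S ↔ r ∈ S')) :
    eigenvalueCount A S = eigenvalueCount A S' := by
  unfold eigenvalueCount
  rw [iSup_eigenspace_eq_iSup_eigenvalues A S, iSup_eigenspace_eq_iSup_eigenvalues A S',
    show {r ∈ S | eigenspace A r ≠ ⊥} = {r ∈ S' | eigenspace A r ≠ ⊥} from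
      Set.ext fun r => and_congr_left (h r)]

/-- Among the finitely many eigenvalues below `b` whose closed count reaches `k + 1`, the least one
is the eigenvalue sought. -/
theorem exists_isNthEigenvalue {A : H →ₗ.[ℂ] H} {b : ℝ} (hb : (b : EReal) < essBottom A)
    (hfin : {r : ℝ | r ≤ b ∧ eigenspace A r ≠ ⊥}.Finite) {k : ℕ}
    (hk : ((k + 1 : ℕ) : ℕ∞) ≤ eigenvalueCount A (Set.Iio b)) :
    ∃ r < b, IsNthEigenvalue A (k + 1) r := by
  -- If the count below `x` is positive, the largest eigenvalue `s < x` has the same count on `(-∞,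
  -- s]`.
  have step : ∀ x ≤ b, ((k + 1 : ℕ) : ℕ∞) ≤ eigenvalueCount A (Set.Iio x) →
      ∃ s < x, eigenspace A s ≠ ⊥ ∧ ((k + 1 : ℕ) : ℕ∞) ≤ eigenvalueCount A (Set.Iic s) := by
    intro x hx hkx
    have hfin' : {r : ℝ | r < x ∧ eigenspace A r ≠ ⊥}.Finite :=
      hfin.subset fun r hr => ⟨hr.1.le.trans hx, hr.2⟩
    have hne : {r : ℝ | r < x ∧ eigenspace A r ≠ ⊥}.Nonempty := by
      by_contra hemp
      rw [Set.not_nonempty_iff_eq_empty] at hemp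
      rw [eigenvalueCount_congr (S := Set.Iio x) (S' := ∅) fun r hr =>
        ⟨fun h : r < x => hemp.subset (show r ∈ {r : ℝ | r < x ∧ eigenspace A r ≠ ⊥} from ⟨h, hr⟩),
          fun h => h.elim⟩] at hkx
      have h0 : eigenvalueCount A ∅ = 0 := by
        unfold eigenvalueCount
        rw [iSup_emptyset, rank_bot, map_zero]
      rw [h0] at hkx
      simp at hkx
    obtain ⟨s, hs, hmax⟩ := Set.exists_max_image _ id hfin' hne
    refine ⟨s, hs.1, hs.2, hkx.trans_eq (eigenvalueCount_congr fun r hr => ?_)⟩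
    exact ⟨fun h => hmax r ⟨h, hr⟩, fun h => lt_of_le_of_lt h hs.1⟩
  let S : Set ℝ := {r | r < b ∧ eigenspace A r ≠ ⊥ ∧
    ((k + 1 : ℕ) : ℕ∞) ≤ eigenvalueCount A (Set.Iic r)}
  have hS : S.Finite := hfin.subset fun r hr => ⟨hr.1.le, hr.2.1⟩
  obtain ⟨r, hr, hmin⟩ := Set.exists_min_image S id hS (step b le_rfl hk)
  refine ⟨r, hr.1, lt_trans (by exact_mod_cast hr.1) hb, ?_, hr.2.2⟩
  by_contra! hlt
  obtain ⟨s, hsr, hs, hks⟩ := step r hr.1.le hlt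
  exact absurd (hmin s ⟨hsr.trans hr.1, hs, hks⟩) (not_le.2 hsr)

variable [CompleteSpace H] [CompleteSpace K]

/-- The resolvent `(A + 1)⁻¹` of the operator generated by a closed form. -/
theorem exists_resolvent {T : H →ₗ.[ℂ] K} (hT : T.IsClosed) :
    ∃ R : H →L[ℂ] H, IsSelfAdjoint R ∧ ∀ f, ∃ w, (R f, w) ∈ T.graph ∧
      ∀ v z, (v, z) ∈ T.graph → inner ℂ v f = inner ℂ v (R f) + inner ℂ z w := by
  -- The graph with the Hilbert norm is the form domain with norm `(a[u] + ‖u‖²)^{1/2}`, complete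
  -- because `T` is closed. If `J` is its embedding into `H`, then `J* f` is the Riesz
  -- representative of `v ↦ (f, v)`, the weak solution of `(A + 1) u = f`; so `J J*` is the
  -- resolvent.
  let Γ : Submodule ℂ (WithLp 2 (H × K)) :=
    T.graph.comap (WithLp.linearEquiv 2 ℂ (H × K)).toLinearMap
  have hΓ : IsClosed (Γ : Set (WithLp 2 (H × K))) :=
    IsClosed.preimage (WithLp.prod_continuous_ofLp 2 H K) hT
  have : CompleteSpace Γ := hΓ.completeSpace_coe
  let J : Γ →L[ℂ] H := (WithLp.fstL 2 ℂ H K).comp Γ.subtypeL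
  refine ⟨J ∘L J.adjoint, ?_, fun f => ⟨(J.adjoint f : WithLp 2 (H × K)).snd, ?_, ?_⟩⟩
  · rw [ContinuousLinearMap.isSelfAdjoint_iff', ContinuousLinearMap.adjoint_comp,
      ContinuousLinearMap.adjoint_adjoint]
  · exact (J.adjoint f).2
  · intro v z hvz
    have h := ContinuousLinearMap.adjoint_inner_right J ⟨WithLp.toLp 2 (v, z), hvz⟩ f
    rw [Submodule.coe_inner, WithLp.prod_inner_apply] at h
    exact h.symm

end FormOperators

section SpectralBounds

variable {H K : Type*} [NormedAddCommGroup H] [InnerProductSpace ℂ H] [CompleteSpace H]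
  [NormedAddCommGroup K] [InnerProductSpace ℂ K]

/-! ### The spectrum below the essential spectrum -/

/-- An infinite subset of this compact set would accumulate at one of its points, contrary to
isolation. -/
theorem finite_spectrum_inter_Ici {R : H →L[ℂ] H} {δ : ℝ}
    (hiso : ∀ ρ ∈ spectrum ℝ R, δ ≤ ρ → ∃ ε > 0, ∀ σ ∈ spectrum ℝ R, |σ - ρ| < ε → σ = ρ) :
    (spectrum ℝ R ∩ Set.Ici δ).Finite := by
  by_contra hinf
  have hc : IsCompact (spectrum ℝ R ∩ Set.Ici δ) :=
    (ContinuousFunctionalCalculus.isCompact_spectrum R).inter_right isClosed_Ici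
  obtain ⟨ρ, hρ, hacc⟩ := Set.Infinite.exists_accPt_of_subset_isCompact hinf hc subset_rfl
  obtain ⟨ε, hε, h⟩ := hiso ρ hρ.1 hρ.2
  obtain ⟨σ, ⟨hne, hσ⟩, hd⟩ :=
    ((accPt_iff_frequently.1 hacc).and_eventually (Metric.ball_mem_nhds ρ hε)).exists
  exact hne (h σ hσ.1 hd)

/-- If the spectrum of a bounded self-adjoint operator is discrete in `[δ, ∞)`, then its quadratic
form is bounded by `δ` on the orthogonal complement of the eigenvectors with eigenvalues
in `[δ, ∞)`. -/
theorem re_inner_le_of_isolated {R : H →L[ℂ] H} (hR : IsSelfAdjoint R) {δ : ℝ}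
    (hiso : ∀ ρ ∈ spectrum ℝ R, δ ≤ ρ → ∃ ε > 0, ∀ σ ∈ spectrum ℝ R, |σ - ρ| < ε → σ = ρ)
    {u : H} (hu : ∀ ρ ∈ spectrum ℝ R, δ ≤ ρ → ∀ v, R v = (ρ : ℂ) • v → inner ℂ v u = 0) :
    (inner ℂ (R u) u).re ≤ δ * ‖u‖ ^ 2 := by
  classical
  have hfin := finite_spectrum_inter_Ici hiso
  set Z := hfin.toFinset with hZ
  have memZ : ∀ {ρ}, ρ ∈ Z ↔ ρ ∈ spectrum ℝ R ∧ δ ≤ ρ := by simp [hZ]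
  -- The indicator of an isolated point is continuous on the spectrum, so the continuous functional
  -- calculus already supplies the spectral projections `E ρ`.
  let χ : ℝ → ℝ → ℝ := fun ρ x => if x = ρ then 1 else 0
  have hχ : ∀ ρ ∈ Z, ContinuousOn (χ ρ) (spectrum ℝ R) := by
    intro ρ hρ x hx
    obtain ⟨ε, hε, h⟩ := hiso ρ (memZ.1 hρ).1 (memZ.1 hρ).2
    by_cases hxρ : x = ρ
    · subst hxρ
      refine (continuousWithinAt_const (b := (1 : ℝ))).congr_of_eventuallyEq ?_ (by simp [χ])
      filter_upwards [self_mem_nhdsWithin, mem_nhdsWithin_of_mem_nhds (Metric.ball_mem_nhds x hε)]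
        with y hy hyb
      simp [χ, h y hy hyb]
    · refine (continuousWithinAt_const (b := (0 : ℝ))).congr_of_eventuallyEq ?_ (by simp [χ, hxρ])
      filter_upwards [mem_nhdsWithin_of_mem_nhds (isOpen_ne.mem_nhds hxρ)] with y hy
      simp only [χ, if_neg hy]
  let E : ℝ → H →L[ℂ] H := fun ρ => cfc (χ ρ) R
  -- `R (E ρ u) = ρ E ρ u`, so `E ρ u` is one of the vectors orthogonal to `u`; since `E ρ` is a
  -- self-adjoint idempotent, `‖E ρ u‖² = (E ρ u, u) = 0`.
  have hE0 : ∀ ρ ∈ Z, E ρ u = 0 := by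
    intro ρ hρ
    have hsa : IsSelfAdjoint (E ρ) := cfc_predicate (χ ρ) R
    have hidem : E ρ * E ρ = E ρ := by
      rw [← cfc_mul _ _ R (hχ ρ hρ) (hχ ρ hρ)]
      refine cfc_congr fun x _ => ?_
      simp [χ]
    have heig : R * E ρ = ρ • E ρ := by
      conv_lhs => rw [← cfc_id' ℝ R]
      rw [← cfc_mul (fun x => x) (χ ρ) R continuousOn_id (hχ ρ hρ), ← cfc_const_mul _ _ R (hχ ρ hρ)]
      refine cfc_congr fun x _ => ?_
      by_cases hx : x = ρ <;> simp [χ, hx]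
    have h0 := hu ρ (memZ.1 hρ).1 (memZ.1 hρ).2 (E ρ u) (by
      have := DFunLike.congr_fun heig u
      simpa using this)
    have : inner ℂ (E ρ u) (E ρ u) = 0 := by
      have hs := ContinuousLinearMap.isSelfAdjoint_iff_isSymmetric.1 hsa (E ρ u) u
      have h1 : E ρ (E ρ u) = E ρ u := DFunLike.congr_fun hidem u
      simp only [ContinuousLinearMap.coe_coe] at hs
      rw [← hs, h1, h0]
    exact inner_self_eq_zero.1 this
  have hmin : ContinuousOn (fun x : ℝ => min x δ) (spectrum ℝ R) := by fun_prop
  have hsum : ContinuousOn (∑ ρ ∈ Z, fun x => (ρ - δ) * χ ρ x) (spectrum ℝ R) := by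
    rw [Finset.sum_fn]
    exact continuousOn_finsetSum _ fun ρ hρ => continuousOn_const.mul (hχ ρ hρ)
  -- On the spectrum `x = min x δ + ∑ (ρ - δ) χ_ρ(x)`, because each spectral point `≥ δ` belongs to
  -- `Z`. The sum annihilates `u`, and `min x δ ≤ δ`.
  have hdec : R = cfc (fun x : ℝ => min x δ) R + ∑ ρ ∈ Z, (ρ - δ) • E ρ := by
    conv_lhs => rw [← cfc_id' ℝ R]
    have e : ∑ ρ ∈ Z, (ρ - δ) • E ρ = cfc (∑ ρ ∈ Z, fun x => (ρ - δ) * χ ρ x) R := by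
      rw [cfc_sum (fun ρ x => (ρ - δ) * χ ρ x) R Z fun ρ hρ => continuousOn_const.mul (hχ ρ hρ)]
      exact Finset.sum_congr rfl fun ρ hρ => (cfc_const_mul _ _ R (hχ ρ hρ)).symm
    rw [e, ← cfc_add R _ _ hmin hsum]
    refine cfc_congr fun x hx => ?_
    simp only [Finset.sum_apply, χ, mul_ite, mul_one, mul_zero, Finset.sum_ite_eq]
    by_cases hxδ : δ ≤ x
    · rw [if_pos (memZ.2 ⟨hx, hxδ⟩), min_eq_right hxδ]; ring
    · rw [if_neg fun h => hxδ (memZ.1 h).2, min_eq_left (not_le.1 hxδ).le, add_zero]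
  have hRu : R u = cfc (fun x : ℝ => min x δ) R u := by
    have := DFunLike.congr_fun hdec u
    rw [this, _root_.add_apply, _root_.sum_apply,
      Finset.sum_eq_zero fun ρ hρ => ?_, add_zero]
    rw [_root_.smul_apply, hE0 ρ hρ, smul_zero]
  have hle : cfc (fun x : ℝ => min x δ) R ≤ algebraMap ℝ (H →L[ℂ] H) δ :=
    cfc_le_algebraMap _ _ R (fun x _ => min_le_right _ _) hmin hR
  have hpos := ((ContinuousLinearMap.le_def _ _).1 hle).2 u
  rw [hRu]
  rw [ContinuousLinearMap.reApplyInnerSelf_apply, _root_.sub_apply, inner_sub_left,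
    map_sub, sub_nonneg] at hpos
  refine hpos.trans (le_of_eq ?_)
  rw [Algebra.algebraMap_eq_smul_one, _root_.smul_apply,
    one_apply_eq_self, ← Complex.coe_smul, inner_smul_left,
    inner_self_eq_norm_sq_to_K]
  simp [← Complex.ofReal_pow]

/-- `R = (A + 1)⁻¹`, where `A` is generated by the form `(T u, T v)`. -/
structure IsResolvent (T : H →ₗ.[ℂ] K) (R : H →L[ℂ] H) : Prop where
  selfAdjoint : IsSelfAdjoint R
  exists_graph : ∀ f, ∃ w, (R f, w) ∈ T.graph ∧
    ∀ v z, (v, z) ∈ T.graph → inner ℂ v f = inner ℂ v (R f) + inner ℂ z w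

namespace IsResolvent

variable {T : H →ₗ.[ℂ] K} {R : H →L[ℂ] H}

theorem mem_formGraph (hR : IsResolvent T R) (f : H) : (R f, f - R f) ∈ formGraph T := by
  obtain ⟨w, hw, h⟩ := hR.exists_graph f
  refine mem_formGraph_iff.2 ⟨w, hw, fun v z hvz => ?_⟩
  rw [inner_sub_right, h v z hvz]
  ring

/-- Uniqueness of the weak solution: the difference `d` of two solutions, tested against itself,
gives `‖d‖² + ‖T d‖² = 0`. -/
theorem apply_of_mem (hR : IsResolvent T R) {u h : H} (hu : (u, h) ∈ formGraph T) :
    R (h + u) = u := by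
  obtain ⟨w', hw', h'⟩ := mem_formGraph_iff.1 hu
  obtain ⟨w, hw, hf⟩ := hR.exists_graph (h + u)
  have hd : (u - R (h + u), w' - w) ∈ T.graph := T.graph.sub_mem hw' hw
  have h1 := h' _ _ hd
  have h2 := hf _ _ hd
  rw [inner_add_right, h1] at h2
  have h3 : inner ℂ (u - R (h + u)) (u - R (h + u)) + inner ℂ (w' - w) (w' - w) = 0 := by
    rw [inner_sub_right, inner_sub_right (w' - w)]
    linear_combination h2
  rw [inner_self_eq_ofReal, inner_self_eq_ofReal] at h3
  have h4 : ‖u - R (h + u)‖ ^ 2 + ‖w' - w‖ ^ 2 = 0 := by exact_mod_cast h3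
  have h5 : ‖u - R (h + u)‖ = 0 := by nlinarith [sq_nonneg ‖w' - w‖, norm_nonneg (u - R (h + u))]
  exact (sub_eq_zero.1 (norm_eq_zero.1 h5)).symm

theorem mem_eigenspace_of_apply_eq (hR : IsResolvent T R) (hT : Dense (T.domain : Set H))
    {ρ : ℝ} (hρ : ρ ≠ 0) {v : H} (hv : R v = (ρ : ℂ) • v) :
    v ∈ eigenspace (formOperator T) (ρ⁻¹ - 1) := by
  have h := (formGraph T).smul_mem ((ρ : ℂ)⁻¹) (hR.mem_formGraph v)
  rw [mem_eigenspace_formOperator hT]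
  have hρ' : (ρ : ℂ) ≠ 0 := by exact_mod_cast hρ
  convert h using 1
  rw [hv, Prod.smul_mk, inv_smul_smul₀ hρ', smul_sub, inv_smul_smul₀ hρ']
  push_cast
  rw [sub_smul, one_smul]

theorem apply_eigenvector (hR : IsResolvent T R) (hT : Dense (T.domain : Set H)) {r : ℝ}
    (hr : 0 ≤ r) {v : H} (hv : v ∈ eigenspace (formOperator T) r) :
    R v = (((r + 1)⁻¹ : ℝ) : ℂ) • v := by
  have h := hR.apply_of_mem ((mem_eigenspace_formOperator hT).1 hv)
  have hr' : ((r : ℂ) + 1) ≠ 0 := by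
    have : (r + 1 : ℝ) ≠ 0 := by positivity
    exact_mod_cast this
  have h2 : ((r : ℂ) + 1) • R v = v := by
    rw [← map_smul, add_smul, one_smul, h]
  push_cast
  rw [eq_inv_smul_iff₀ hr', h2]

/-- By contraposition: with `q = ρ⁻¹` and `S = (A - (q - 1))⁻¹`, the inverse of `ρ - R` is `q (1 + q
S)`. -/
theorem mem_realSpectrum_of_mem_spectrum (hR : IsResolvent T R) (hT : Dense (T.domain : Set H))
    {ρ : ℝ} (hρ : ρ ≠ 0) (h : ρ ∈ spectrum ℝ R) : ρ⁻¹ - 1 ∈ realSpectrum (formOperator T) := by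
  rintro ⟨S, hS1, hS2⟩
  refine spectrum.mem_iff.1 h ?_
  have hρ' : (ρ : ℂ) ≠ 0 := by exact_mod_cast hρ
  set q : ℂ := (ρ : ℂ)⁻¹ with hq
  have hqr : (((ρ⁻¹ - 1 : ℝ)) : ℂ) = q - 1 := by rw [hq]; push_cast; rfl
  have hqρ : q * ρ = 1 := inv_mul_cancel₀ hρ'
  rw [hqr] at hS1 hS2
  -- The resolvent identities `R (1 + q S) = S` and `S (1 - q R) = R` are all that is needed for the
  -- two-sided inverse.
  have hRS : ∀ f, R (f + q • S f) = S f := by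
    intro f
    obtain ⟨hmem, he⟩ := hS1 f
    have hg : (S f, formOperator T ⟨S f, hmem⟩) ∈ (formOperator T).graph :=
      LinearPMap.mem_graph _ ⟨S f, hmem⟩
    rw [graph_formOperator hT] at hg
    have := hR.apply_of_mem hg
    rw [sub_eq_iff_eq_add] at he
    rw [he] at this
    convert this using 2
    module
  have hSR : ∀ f, S (f - q • R f) = R f := by
    intro f
    have hg := hR.mem_formGraph f
    rw [← graph_formOperator hT] at hg
    obtain ⟨y, hy1, hy2⟩ := (LinearPMap.mem_graph_iff _).1 hg
    have := hS2 y
    simp only at hy1 hy2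
    rw [hy2, hy1] at this
    convert this using 2
    module
  have hal : ∀ f : H, (algebraMap ℝ (H →L[ℂ] H) ρ) f = (ρ : ℂ) • f := by
    intro f
    rw [Algebra.algebraMap_eq_smul_one]
    simp
  refine ⟨⟨_, q • ((1 : H →L[ℂ] H) + q • S), ?_, ?_⟩, rfl⟩
  · ext f
    simp only [mul_apply_eq_comp, _root_.sub_apply, _root_.smul_apply,
      _root_.add_apply, one_apply_eq_self, hal, map_smul, hRS]
    match_scalars
    · linear_combination hqρ
    · linear_combination q * hqρ
  · ext f
    have h1 : S ((ρ : ℂ) • f - R f) = (ρ : ℂ) • R f := by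
      have : (ρ : ℂ) • f - R f = (ρ : ℂ) • (f - q • R f) := by
        rw [smul_sub, smul_smul, mul_comm, hqρ, one_smul]
      rw [this, map_smul, hSR]
    simp only [mul_apply_eq_comp, _root_.sub_apply, _root_.smul_apply,
      _root_.add_apply, one_apply_eq_self, hal, h1]
    match_scalars
    · linear_combination hqρ
    · linear_combination q * hqρ

/-- Cauchy–Schwarz in the form norm `‖·‖₁`: `‖u‖² = (u, R u)₁ ≤ ‖u‖₁ ‖R u‖₁`, while `‖R u‖₁² = (R u,
u) ≤ δ ‖u‖²`. The argument concerns a single vector and needs no invariant subspace. -/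
theorem norm_sq_le (hR : IsResolvent T R) {δ : ℝ} {u : H} {w : K} (huw : (u, w) ∈ T.graph)
    (h : (inner ℂ (R u) u).re ≤ δ * ‖u‖ ^ 2) : ‖u‖ ^ 2 ≤ δ * (‖u‖ ^ 2 + ‖w‖ ^ 2) := by
  obtain ⟨y, hy, hf⟩ := hR.exists_graph u
  have h1 : ‖R u‖ ^ 2 + ‖y‖ ^ 2 = (inner ℂ (R u) u).re := by
    rw [hf _ _ hy, inner_self_eq_ofReal, inner_self_eq_ofReal, ← Complex.ofReal_add,
      Complex.ofReal_re]
  have h2 : ‖u‖ ^ 2 ≤ ‖u‖ * ‖R u‖ + ‖w‖ * ‖y‖ := by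
    have := congrArg Complex.re (hf _ _ huw)
    rw [inner_self_eq_ofReal, Complex.ofReal_re, Complex.add_re] at this
    rw [this]
    exact add_le_add (re_inner_le_norm (𝕜 := ℂ) u (R u)) (re_inner_le_norm (𝕜 := ℂ) w y)
  rcases eq_or_ne u 0 with rfl | hu
  · have : w = 0 := T.graph_fst_eq_zero_snd huw rfl
    simp [this]
  have hu0 : 0 < ‖u‖ ^ 2 := by positivity
  have h3 : (‖u‖ ^ 2) ^ 2 ≤ (‖u‖ ^ 2 + ‖w‖ ^ 2) * (‖R u‖ ^ 2 + ‖y‖ ^ 2) := by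
    have : (‖u‖ ^ 2) ^ 2 ≤ (‖u‖ * ‖R u‖ + ‖w‖ * ‖y‖) ^ 2 := by gcongr
    nlinarith [sq_nonneg (‖u‖ * ‖y‖ - ‖w‖ * ‖R u‖)]
  have h4 : (‖u‖ ^ 2) ^ 2 ≤ (‖u‖ ^ 2 + ‖w‖ ^ 2) * (δ * ‖u‖ ^ 2) :=
    h3.trans (mul_le_mul_of_nonneg_left (h1.le.trans h) (by positivity))
  nlinarith

end IsResolvent

/-- The map `r ↦ (r + 1)⁻¹` takes eigenvalues `≤ b` of `A` to points of the spectrum of `R` in `[δ,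
∞)`, `δ = (b + 1)⁻¹`. Below the essential spectrum these points are isolated, so
`re_inner_le_of_isolated` bounds `R` by `δ` on the complement, and `norm_sq_le` converts this into a
lower bound for the form. -/
theorem finite_eigenvalues_and_lower_bound [CompleteSpace K] {T : H →ₗ.[ℂ] K} (hTc : T.IsClosed)
    (hT : Dense (T.domain : Set H)) {b : ℝ} (hb0 : 0 ≤ b)
    (hb : (b : EReal) < essBottom (formOperator T)) :
    {r : ℝ | r ≤ b ∧ eigenspace (formOperator T) r ≠ ⊥}.Finite ∧
    ∀ u w, (u, w) ∈ T.graph →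
      (∀ v ∈ ⨆ r ∈ Set.Iic b, eigenspace (formOperator T) r, inner ℂ v u = 0) →
      b * ‖u‖ ^ 2 ≤ ‖w‖ ^ 2 := by
  obtain ⟨R, hsa, hex⟩ := exists_resolvent hTc
  have hR : IsResolvent T R := ⟨hsa, hex⟩
  set δ : ℝ := (b + 1)⁻¹ with hδ
  have hδ0 : 0 < δ := by positivity
  have hle : ∀ ρ, δ ≤ ρ → ρ⁻¹ - 1 ≤ b := by
    intro ρ hρ
    have := inv_anti₀ hδ0 hρ
    rw [hδ, inv_inv] at this
    linarith
  have hiso : ∀ ρ ∈ spectrum ℝ R, δ ≤ ρ → ∃ ε > 0, ∀ σ ∈ spectrum ℝ R, |σ - ρ| < ε → σ = ρ := by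
    intro ρ hρ hδρ
    have hρ0 : 0 < ρ := hδ0.trans_le hδρ
    obtain ⟨-, ⟨ε, hε, h⟩, -⟩ := mem_discreteSpectrum_of_lt_essBottom hb (hle ρ hδρ)
      (hR.mem_realSpectrum_of_mem_spectrum hT hρ0.ne' hρ)
    have hcont : ContinuousAt (fun σ : ℝ => σ⁻¹ - 1) ρ :=
      (continuousAt_inv₀ hρ0.ne').sub continuousAt_const
    obtain ⟨η, hη, hball⟩ := Metric.continuousAt_iff.1 hcont ε hε
    -- The radius `ρ` keeps `σ` positive, away from the singularity of `σ⁻¹ - 1`.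
    refine ⟨min η ρ, lt_min hη hρ0, fun σ hσ hd => ?_⟩
    have hσ0 : 0 < σ := by
      have := (abs_lt.1 (hd.trans_le (min_le_right _ _))).1
      linarith
    have := h _ (hR.mem_realSpectrum_of_mem_spectrum hT hσ0.ne' hσ)
      (hball (hd.trans_le (min_le_left _ _)))
    exact inv_injective (sub_left_injective this)
  constructor
  · refine Set.Finite.of_finite_image ((finite_spectrum_inter_Ici hiso).subset ?_)
      (f := fun r => (r + 1)⁻¹) fun r _ s _ hrs => ?_
    · rintro _ ⟨r, ⟨hrb, hr⟩, rfl⟩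
      obtain ⟨u, hu, h0⟩ := (Submodule.ne_bot_iff _).1 hr
      have hr0 := nonneg_of_mem_eigenspace hT hu h0
      refine ⟨fun hunit => h0 ?_, ?_⟩
      swap
      · exact inv_anti₀ (by positivity) (by linarith : r + 1 ≤ b + 1)
      obtain ⟨N, hN⟩ := hunit.exists_left_inv
      have h1 := DFunLike.congr_fun hN u
      rw [mul_apply_eq_comp, _root_.sub_apply, hR.apply_eigenvector hT hr0 hu,
        Algebra.algebraMap_eq_smul_one, _root_.smul_apply, one_apply_eq_self, ← Complex.coe_smul,
        sub_self, map_zero] at h1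
      exact h1.symm
    · exact add_right_cancel (inv_injective hrs)
  · intro u w huw hu
    have h1 := re_inner_le_of_isolated hsa hiso (u := u) fun ρ _ hδρ v hv =>
      hu v (Submodule.mem_iSup_of_mem (ρ⁻¹ - 1) (Submodule.mem_iSup_of_mem (hle ρ hδρ)
        (hR.mem_eigenspace_of_apply_eq hT (hδ0.trans_le hδρ).ne' hv)))
    have h2 := hR.norm_sq_le huw h1
    rw [hδ, inv_mul_eq_div, le_div_iff₀ (by positivity)] at h2
    linarith

/-- Below the essential spectrum there are finitely many eigenvalues of finite multiplicity, and
the form is strictly larger than `b` on the orthogonal complement of the eigenvectors with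
eigenvalues `≤ b`. -/
theorem exists_gap [CompleteSpace K] {T : H →ₗ.[ℂ] K} (hTc : T.IsClosed)
    (hT : Dense (T.domain : Set H)) {b : ℝ}
    (hb0 : 0 ≤ b) (hb : (b : EReal) < essBottom (formOperator T)) :
    ∃ b' > b, ∀ u w, (u, w) ∈ T.graph →
      (∀ v ∈ ⨆ r ∈ Set.Iic b, eigenspace (formOperator T) r, inner ℂ v u = 0) →
      b' * ‖u‖ ^ 2 ≤ ‖w‖ ^ 2 := by
  obtain ⟨c, hbc, hc⟩ := EReal.lt_iff_exists_real_btwn.1 hb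
  have hbc' : b < c := by exact_mod_cast hbc
  have hfin := (finite_eigenvalues_and_lower_bound hTc hT (hb0.trans hbc'.le) hc).1
  -- Only finitely many eigenvalues lie in `(b, c]`, so some `b' > b` lies below all of them; then
  -- `(-∞, b']` and `(-∞, b]` carry the same eigenvectors.
  have hev : ∀ᶠ b' in 𝓝[>] b, ∀ r ∈ {r : ℝ | r ≤ c ∧ eigenspace (formOperator T) r ≠ ⊥},
      b < r → b' < r := by
    rw [Filter.eventually_all_finite hfin]
    intro r _
    by_cases h : b < r
    · filter_upwards [mem_nhdsWithin_of_mem_nhds (Iio_mem_nhds h)] with b' hb' _ using hb'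
    · exact Eventually.of_forall fun _ h' => absurd h' h
  obtain ⟨b', h, hb', hbc''⟩ := (hev.and (Ioo_mem_nhdsGT hbc')).exists
  refine ⟨b', hb', fun u w huw hu =>
    (finite_eigenvalues_and_lower_bound hTc hT (hb0.trans hb'.le)
      (lt_trans (by exact_mod_cast hbc'') hc)).2 u w huw fun v hv => hu v ?_⟩
  refine (iSup₂_le fun r hr => ?_ : (⨆ r ∈ Set.Iic b', eigenspace (formOperator T) r) ≤ _) hv
  by_cases hbot : eigenspace (formOperator T) r = ⊥
  · rw [hbot]; exact bot_le
  · refine le_iSup₂_of_le r (Set.mem_Iic.2 (not_lt.1 fun hbr => ?_)) le_rfl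
    exact absurd (h r ⟨le_trans hr hbc''.le, hbot⟩ hbr) (not_lt.2 hr)

theorem finiteDimensional_iSup_eigenspace [CompleteSpace K] {T : H →ₗ.[ℂ] K} (hTc : T.IsClosed)
    (hT : Dense (T.domain : Set H)) {b : ℝ} (hb0 : 0 ≤ b)
    (hb : (b : EReal) < essBottom (formOperator T)) :
    FiniteDimensional ℂ ↥(⨆ r ∈ Set.Iic b, eigenspace (formOperator T) r) := by
  rw [iSup_eigenspace_eq_iSup_eigenvalues, iSup_subtype']
  have hfin := (finite_eigenvalues_and_lower_bound hTc hT hb0 hb).1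
  have : Finite {r ∈ Set.Iic b | eigenspace (formOperator T) r ≠ ⊥} := hfin
  have : ∀ r : {r ∈ Set.Iic b | eigenspace (formOperator T) r ≠ ⊥},
      FiniteDimensional ℂ (eigenspace (formOperator T) r) := fun r =>
    (mem_discreteSpectrum_of_lt_essBottom hb r.2.1
      (mem_realSpectrum_of_eigenspace_ne_bot r.2.2)).2.2.2
  exact Submodule.finiteDimensional_iSup _

end SpectralBounds

section Variational

variable {H K : Type*} [NormedAddCommGroup H] [InnerProductSpace ℂ H] [CompleteSpace H]
  [NormedAddCommGroup K] [InnerProductSpace ℂ K] [CompleteSpace K]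

/-! ### Variational principles -/

/-- Weyl's criterion. A weakly null sequence loses its component in the finite-dimensional space `V`
of eigenvectors with eigenvalues `≤ b`, and on the complement the form is at least `b' ‖·‖²` with
`b' > b`. The upper bound is required only infinitely often, which is all that the infinite-volume
case provides. -/
theorem not_tendsto_of_lt_essBottom {T : H →ₗ.[ℂ] K} (hTc : T.IsClosed)
    (hT : Dense (T.domain : Set H)) {b : ℝ} (hb0 : 0 ≤ b)
    (hb : (b : EReal) < essBottom (formOperator T)) {u : ℕ → H} {w : ℕ → K}
    (huw : ∀ j, (u j, w j) ∈ T.graph) (hnorm : ∀ j, ‖u j‖ = 1)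
    (hweak : ∀ g, Tendsto (fun j => inner ℂ g (u j)) atTop (𝓝 0))
    (hle : ∀ ε > 0, ∃ᶠ j in atTop, ‖w j‖ ^ 2 ≤ b + ε) : False := by
  obtain ⟨b', hb', hgap⟩ := exists_gap hTc hT hb0 hb
  have := finiteDimensional_iSup_eigenspace hTc hT hb0 hb
  set V := ⨆ r ∈ Set.Iic b, eigenspace (formOperator T) r with hV
  have key : ∀ j, b' * (1 - ‖V.orthogonalProjectionOnto (u j)‖ ^ 2) ≤ ‖w j‖ ^ 2 := by
    intro j
    have hpV : ((V.orthogonalProjectionOnto (u j) : V) : H) ∈ V :=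
      (V.orthogonalProjectionOnto (u j)).2
    obtain ⟨f, hf, hpf, -⟩ := exists_formGraph_of_mem_iSup_eigenspace hT (S := Set.Iic b) (b := b)
      (fun r hr => hr) hpV
    have hperp : ∀ v ∈ V, inner ℂ v (u j - V.orthogonalProjectionOnto (u j)) = 0 := fun v hv =>
      (Submodule.mem_orthogonal V _).1 (Submodule.sub_starProjection_mem_orthogonal (u j)) v hv
    obtain ⟨y, hy, hwy, -⟩ := norm_sq_graph_sub (huw j) hpf
      (by rw [← inner_conj_symm, hperp f hf, map_zero])
    have h1 := hgap _ _ hy hperp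
    have h3 : ‖u j - V.orthogonalProjectionOnto (u j)‖ ^ 2
        = 1 - ‖V.orthogonalProjectionOnto (u j)‖ ^ 2 := by
      have := norm_add_sq_eq_norm_sq_add_norm_sq_of_inner_eq_zero (𝕜 := ℂ)
        ((V.orthogonalProjectionOnto (u j) : V) : H) (u j - V.orthogonalProjectionOnto (u j))
        (hperp _ hpV)
      rw [add_sub_cancel, hnorm j] at this
      rw [Submodule.coe_norm]
      nlinarith
    rw [← h3, hwy]
    nlinarith [sq_nonneg ‖y‖]
  have hlim : Tendsto (fun j => ‖V.orthogonalProjectionOnto (u j)‖ ^ 2) atTop (𝓝 0) := by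
    let e := stdOrthonormalBasis ℂ V
    have : ∀ j, ‖V.orthogonalProjectionOnto (u j)‖ ^ 2 = ∑ i, ‖inner ℂ (e i : H) (u j)‖ ^ 2 := by
      intro j
      rw [← e.sum_sq_norm_inner_right]
      refine Finset.sum_congr rfl fun i _ => ?_
      rw [Submodule.inner_orthogonalProjectionOnto_eq_of_mem_left]
    simp_rw [this]
    rw [show (0 : ℝ) = ∑ i : Fin (Module.finrank ℂ V), ‖(0 : ℂ)‖ ^ 2 by simp]
    exact tendsto_finsetSum _ fun i _ => ((hweak _).norm.pow 2)
  have hlim' : Tendsto (fun j => b' * (1 - ‖V.orthogonalProjectionOnto (u j)‖ ^ 2)) atTop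
      (𝓝 b') := by
    simpa using (hlim.const_sub 1).const_mul b'
  obtain ⟨j, h1, h2⟩ := ((hle ((b' - b) / 2) (by linarith)).and_eventually
    (hlim'.eventually (lt_mem_nhds (show (b + b') / 2 < b' by linarith)))).exists
  linarith [key j]

/-- Projecting `W` onto the span `V'` of eigenvectors below `b` is injective. A vector `x` in the
kernel splits as an eigenvector `κ` for `b` plus a rest orthogonal to all eigenvectors with
eigenvalues `≤ b`. On the rest the form exceeds `b ‖·‖²` strictly, so `a[x] ≤ b ‖x‖²` gives `x = κ`,
and `hker` gives `x = 0`. -/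
theorem finrank_le_of_form_le {T : H →ₗ.[ℂ] K} (hTc : T.IsClosed)
    (hT : Dense (T.domain : Set H)) {b : ℝ} (hb0 : 0 ≤ b)
    (hb : (b : EReal) < essBottom (formOperator T)) {W : Submodule ℂ H} [FiniteDimensional ℂ W]
    (hW : ∀ x ∈ W, ∃ y, (x, y) ∈ T.graph ∧ ‖y‖ ^ 2 ≤ b * ‖x‖ ^ 2)
    (hker : ∀ x ∈ W, x ∈ eigenspace (formOperator T) b → x = 0) :
    (Module.finrank ℂ W : ℕ∞) ≤ eigenvalueCount (formOperator T) (Set.Iio b) := by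
  obtain ⟨b', hb', hgap⟩ := exists_gap hTc hT hb0 hb
  have := finiteDimensional_iSup_eigenspace hTc hT hb0 hb
  have hsplit := iSup_Iic_eigenspace (formOperator T) b
  unfold eigenvalueCount
  set V := ⨆ r ∈ Set.Iic b, eigenspace (formOperator T) r with hV
  set V' := ⨆ r ∈ Set.Iio b, eigenspace (formOperator T) r with hV'
  have hle : V' ≤ V := by rw [hsplit]; exact le_sup_left
  have : FiniteDimensional ℂ V' := Submodule.finiteDimensional_of_le hle
  rw [← Module.finrank_eq_rank, map_natCast, Nat.cast_le]
  let f : W →ₗ[ℂ] V' := V'.orthogonalProjectionOnto.toLinearMap ∘ₗ W.subtype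
  refine LinearMap.finrank_le_finrank_of_injective (f := f) ?_
  rw [injective_iff_map_eq_zero]
  rintro ⟨x, hx⟩ hfx
  have hx' : x ∈ V'ᗮ := Submodule.orthogonalProjectionOnto_eq_zero_iff.1 hfx
  obtain ⟨y, hxy, hyx⟩ := hW x hx
  set p : H := V.subtype (V.orthogonalProjectionOnto x) with hp
  have hpV : p ∈ V := (V.orthogonalProjectionOnto x).2
  have hperp : x - p ∈ Vᗮ := Submodule.sub_starProjection_mem_orthogonal x
  -- The part `a ∈ V'` of the projection vanishes: `x`, `x - p` and `κ` are all orthogonal to `V'`,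
  -- hence so is `a`.
  obtain ⟨a, ha, κ, hκ, hsum⟩ := Submodule.mem_sup.1 (hsplit ▸ hpV)
  have hκ' : κ ∈ V'ᗮ := by
    refine (Submodule.mem_orthogonal' V' κ).2 fun v hv => ?_
    refine (iSup₂_le fun r hr v hv => ?_ : V' ≤ (ℂ ∙ κ)ᗮ) hv κ (Submodule.mem_span_singleton_self κ)
    rw [Submodule.mem_orthogonal_singleton_iff_inner_right]
    exact inner_eq_zero_of_mem_eigenspace hT (ne_of_gt hr) hκ hv
  have ha' : a ∈ V'ᗮ := by
    have : a = x - (x - p) - κ := by rw [← hsum]; abel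
    rw [this]
    exact V'ᗮ.sub_mem (V'ᗮ.sub_mem hx' (Submodule.orthogonal_le hle hperp)) hκ'
  have ha0 : a = 0 := by
    have := (Submodule.mem_orthogonal V' a).1 ha' a ha
    exact inner_self_eq_zero.1 this
  rw [ha0, zero_add] at hsum
  rw [← hsum] at hperp
  have hκV : κ ∈ V := hsum ▸ hpV
  have hor := (Submodule.mem_orthogonal V _).1 hperp
  have h0 : inner ℂ κ (x - κ) = 0 := hor κ hκV
  obtain ⟨z, hz, hyz, hzr⟩ := norm_sq_graph_sub hxy ((mem_eigenspace_formOperator hT).1 hκ)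
    (by rw [inner_smul_right, ← inner_conj_symm, h0, map_zero, mul_zero])
  rw [inner_smul_right, inner_self_eq_ofReal, ← Complex.ofReal_mul, Complex.ofReal_re] at hzr
  have h1 := hgap _ _ hz hor
  have h2 := norm_add_sq_eq_norm_sq_add_norm_sq_of_inner_eq_zero (𝕜 := ℂ) κ (x - κ) h0
  rw [add_sub_cancel] at h2
  have h3 : ‖x - κ‖ = 0 := by
    have : (b' - b) * ‖x - κ‖ ^ 2 ≤ 0 := by nlinarith
    have : ‖x - κ‖ ^ 2 ≤ 0 := by
      by_contra! hc
      nlinarith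
    nlinarith [norm_nonneg (x - κ)]
  have hxκ : x = κ := sub_eq_zero.1 (norm_eq_zero.1 h3)
  exact Subtype.ext (hker x hx (hxκ ▸ hκ))

end Variational

section Symbol

variable {n m l : ℕ} {F : Type*} [NormedAddCommGroup F] [NormedSpace ℂ F]

/-! ### The symbol, plane waves and test functions -/

/-- The scalar by which `∂_i` acts on `exp (2πi⟨x, ξ⟩)`. -/
def freq (ξ : EuclideanSpace ℝ (Fin n)) (i : Fin n) : ℂ := 2 * Real.pi * Complex.I * (ξ i : ℂ)

theorem innerSL_single (ξ : EuclideanSpace ℝ (Fin n)) (i : Fin n) :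
    innerSL ℝ ξ (EuclideanSpace.single i 1) = ξ i := by
  simp [innerSL_apply_apply ℝ, EuclideanSpace.inner_single_right]

/-- The symbol `L(ξ) = ∑_α B_α (2πiξ)^α`. -/
def symbol (B : Coeffs n m l) (ξ : EuclideanSpace ℝ (Fin n)) :
    EuclideanSpace ℂ (Fin m) →L[ℂ] EuclideanSpace ℂ (Fin l) :=
  ∑ α ∈ B.support, (∏ i, freq ξ i ^ α i) • (B α).toEuclideanLin.toContinuousLinearMap

theorem symbol_apply (B : Coeffs n m l) (ξ : EuclideanSpace ℝ (Fin n))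
    (c : EuclideanSpace ℂ (Fin m)) :
    symbol B ξ c = ∑ α ∈ B.support, (B α).toEuclideanLin ((∏ i, freq ξ i ^ α i) • c) := by
  simp [symbol, sum_apply]

theorem continuous_symbol (B : Coeffs n m l) : Continuous (symbol B) := by
  unfold symbol freq
  fun_prop

/-- `D` is the outer part of the composition built so far and `z` the scalar it corresponds to. New
derivatives enter on the inner side, so applications let `P` quantify over the functions to which
`D` is applied. -/
theorem multiDeriv_induction {q : Fin n → ℂ}
    {P : ((EuclideanSpace ℝ (Fin n) → F) → (EuclideanSpace ℝ (Fin n) → F)) → ℂ → Prop}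
    (h0 : P id 1) (hs : ∀ i D z, P D z → P (fun f => D (pderiv i f)) (z * q i))
    (α : Fin n →₀ ℕ) : P (multiDeriv α) (∏ i, q i ^ α i) := by
  have hiter : ∀ i k D z, P D z → P (fun f => D ((pderiv i)^[k] f)) (z * q i ^ k) := by
    intro i k
    induction k with
    | zero => intro D z h; simpa using h
    | succ k ih =>
      intro D z h
      have := ih _ _ (hs i D z h)
      simp only [Function.iterate_succ_apply']
      rwa [pow_succ', ← mul_assoc]
  have hlist : ∀ (t : List (Fin n)) D z, P D z →
      P (fun f => D (t.foldr (fun i g => (pderiv i)^[α i] g) f))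
        (z * (t.map fun i => q i ^ α i).prod) := by
    intro t
    induction t with
    | nil => intro D z h; simpa using h
    | cons i t ih =>
      intro D z h
      have := ih _ _ (hiter i (α i) D z h)
      simpa [mul_assoc] using this
  have := hlist (List.finRange n) _ _ h0
  rw [one_mul, ← Fin.prod_univ_def] at this
  exact this

/-- The plane wave `exp (2πi⟨x, ξ⟩) c`. -/
def planeWave (ξ : EuclideanSpace ℝ (Fin n)) (c : F) : EuclideanSpace ℝ (Fin n) → F :=
  fun x => Complex.exp (2 * Real.pi * Complex.I * (inner ℝ x ξ : ℝ)) • c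

theorem norm_planeWave (ξ : EuclideanSpace ℝ (Fin n)) (c : F) (x : EuclideanSpace ℝ (Fin n)) :
    ‖planeWave ξ c x‖ = ‖c‖ := by
  rw [planeWave, norm_smul, show 2 * (Real.pi : ℂ) * Complex.I * (inner ℝ x ξ : ℝ)
    = ((2 * Real.pi * inner ℝ x ξ : ℝ) : ℂ) * Complex.I by push_cast; ring,
    Complex.norm_exp_ofReal_mul_I, one_mul]

theorem hasFDerivAt_wave (ξ x : EuclideanSpace ℝ (Fin n)) :
    HasFDerivAt (fun x : EuclideanSpace ℝ (Fin n) =>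
      Complex.exp (2 * Real.pi * Complex.I * (inner ℝ x ξ : ℝ)))
      (Complex.exp (2 * Real.pi * Complex.I * (inner ℝ x ξ : ℝ)) •
        ((2 * Real.pi * Complex.I : ℂ) • Complex.ofRealCLM.comp ((innerSL ℝ).flip ξ))) x := by
  refine HasFDerivAt.cexp ?_
  refine HasFDerivAt.const_mul ?_ _
  exact (Complex.ofRealCLM.comp ((innerSL ℝ).flip ξ)).hasFDerivAt

theorem contDiff_wave (ξ : EuclideanSpace ℝ (Fin n)) :
    ContDiff ℝ ∞ (fun x : EuclideanSpace ℝ (Fin n) =>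
      Complex.exp (2 * Real.pi * Complex.I * (inner ℝ x ξ : ℝ))) := by
  refine ContDiff.cexp (contDiff_const.mul ?_)
  exact (Complex.ofRealCLM.comp ((innerSL ℝ).flip ξ)).contDiff

theorem contDiff_planeWave (ξ : EuclideanSpace ℝ (Fin n)) (c : F) :
    ContDiff ℝ ∞ (planeWave ξ c) :=
  (contDiff_wave ξ).smul contDiff_const

theorem pderiv_planeWave (ξ : EuclideanSpace ℝ (Fin n)) (c : F) (i : Fin n) :
    pderiv i (planeWave ξ c) = planeWave ξ (freq ξ i • c) := by
  funext x
  unfold pderiv planeWave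
  rw [((hasFDerivAt_wave ξ x).smul_const c).fderiv]
  simp only [freq, ContinuousLinearMap.smulRight_apply, _root_.smul_apply, smul_eq_mul, smul_smul,
    mul_assoc (Complex.exp _)]
  exact congrArg (fun t : ℝ => (Complex.exp (2 * Real.pi * Complex.I * (inner ℝ x ξ : ℝ)) *
    (2 * Real.pi * Complex.I * (t : ℂ))) • c)
    (show inner ℝ (EuclideanSpace.single i 1) ξ = ξ i from
      (real_inner_comm _ _).trans (innerSL_single ξ i))

theorem applyOp_planeWave (B : Coeffs n m l) (ξ : EuclideanSpace ℝ (Fin n))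
    (c : EuclideanSpace ℂ (Fin m)) :
    applyOp B (planeWave ξ c) = planeWave ξ (symbol B ξ c) := by
  have h : ∀ α : Fin n →₀ ℕ, ∀ c : EuclideanSpace ℂ (Fin m),
      multiDeriv α (planeWave ξ c) = planeWave ξ ((∏ i, freq ξ i ^ α i) • c) := by
    intro α
    refine multiDeriv_induction (q := freq ξ)
      (P := fun D z => ∀ c : EuclideanSpace ℂ (Fin m),
        D (planeWave ξ c) = planeWave ξ (z • c)) (fun c => by simp) (fun i D z h c => ?_) α
    simp only [pderiv_planeWave, h, smul_smul]
  funext x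
  rw [applyOp, symbol_apply]
  simp only [h, planeWave, map_smul, Finset.smul_sum]

/-- Smooth functions with compact support. -/
def IsTest (f : EuclideanSpace ℝ (Fin n) → F) : Prop := ContDiff ℝ ∞ f ∧ HasCompactSupport f

theorem IsTest.integrable {f : EuclideanSpace ℝ (Fin n) → F} (hf : IsTest f) : Integrable f :=
  hf.1.continuous.integrable_of_hasCompactSupport hf.2

theorem IsTest.memLp {f : EuclideanSpace ℝ (Fin n) → F} (hf : IsTest f) : MemLp f 2 :=
  hf.1.continuous.memLp_of_hasCompactSupport hf.2

theorem tsupport_pderiv_subset (f : EuclideanSpace ℝ (Fin n) → F) (i : Fin n) :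
    tsupport (pderiv i f) ⊆ tsupport f := by
  refine closure_minimal (fun x hx => ?_) (isClosed_tsupport f)
  refine support_fderiv_subset ℝ (f := f) fun h => hx ?_
  simp [pderiv, h]

theorem IsTest.pderiv {f : EuclideanSpace ℝ (Fin n) → F} (hf : IsTest f) (i : Fin n) :
    IsTest (pderiv i f) :=
  ⟨(hf.1.fderiv_right (m := ∞) (by simp)).clm_apply contDiff_const,
    hf.2.mono' ((subset_tsupport _).trans (tsupport_pderiv_subset f i))⟩

theorem fourier_pderiv [CompleteSpace F] {f : EuclideanSpace ℝ (Fin n) → F} (hf : IsTest f)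
    (i : Fin n) (ξ : EuclideanSpace ℝ (Fin n)) : 𝓕 (pderiv i f) ξ = freq ξ i • 𝓕 f ξ := by
  have hint : Integrable (fderiv ℝ f) :=
    (hf.1.continuous_fderiv (by simp)).integrable_of_hasCompactSupport (hf.2.fderiv ℝ)
  have h := Real.fourier_fderiv hf.integrable (hf.1.differentiable (by simp)) hint
  have h2 : 𝓕 (pderiv i f) ξ = 𝓕 (fderiv ℝ f) ξ (EuclideanSpace.single i 1) := by
    rw [Real.fourier_eq, Real.fourier_eq, ContinuousLinearMap.integral_apply]
    · rfl
    · exact (Real.fourierIntegral_convergent_iff ξ).2 hint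
  rw [h2, h]
  simp only [VectorFourier.fourierSMulRight_apply, _root_.neg_apply, neg_smul, smul_neg, freq,
    ← Complex.coe_smul, smul_smul]
  rw [← neg_smul, neg_mul, neg_neg]
  exact congrArg (fun t : ℝ => (2 * Real.pi * Complex.I * (t : ℂ)) • 𝓕 f ξ) (innerSL_single ξ i)

theorem multiDeriv_test [CompleteSpace F] (α : Fin n →₀ ℕ) (ξ : EuclideanSpace ℝ (Fin n))
    {f : EuclideanSpace ℝ (Fin n) → F} (hf : IsTest f) :
    IsTest (multiDeriv α f) ∧ tsupport (multiDeriv α f) ⊆ tsupport f ∧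
      𝓕 (multiDeriv α f) ξ = (∏ i, freq ξ i ^ α i) • 𝓕 f ξ := by
  have := multiDeriv_induction (F := F) (q := freq ξ)
    (P := fun D z => ∀ f, IsTest f → IsTest (D f) ∧ tsupport (D f) ⊆ tsupport f ∧
      𝓕 (D f) ξ = z • 𝓕 f ξ) (fun f hf => ⟨hf, subset_rfl, by simp⟩) (fun i D z h f hf => ?_) α
  · exact this f hf
  · obtain ⟨h1, h2, h3⟩ := h _ (hf.pderiv i)
    exact ⟨h1, h2.trans (tsupport_pderiv_subset f i), by rw [h3, fourier_pderiv hf, smul_smul]⟩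

theorem applyOp_test (B : Coeffs n m l)
    {f : EuclideanSpace ℝ (Fin n) → EuclideanSpace ℂ (Fin m)} (hf : IsTest f) :
    IsTest (applyOp B f) ∧ tsupport (applyOp B f) ⊆ tsupport f ∧
      ∀ ξ, 𝓕 (applyOp B f) ξ = symbol B ξ (𝓕 f ξ) := by
  have hsupp : ∀ x ∉ tsupport f, applyOp B f x = 0 := by
    intro x hx
    refine Finset.sum_eq_zero fun α _ => ?_
    rw [image_eq_zero_of_notMem_tsupport fun h => hx ((multiDeriv_test α 0 hf).2.1 h), map_zero]
  refine ⟨⟨?_, ?_⟩, ?_, fun ξ => ?_⟩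
  · exact ContDiff.sum fun α _ =>
      (((B α).toEuclideanLin.toContinuousLinearMap).restrictScalars ℝ).contDiff.comp
        (multiDeriv_test α 0 hf).1.1
  · exact HasCompactSupport.intro hf.2 hsupp
  · exact closure_minimal (fun x hx => by_contra fun h => hx (hsupp x h)) (isClosed_tsupport f)
  · have hcomp : ∀ α, Integrable (fun x => Real.fourierChar (-inner ℝ x ξ) • multiDeriv α f x) :=
      fun α => (Real.fourierIntegral_convergent_iff ξ).2 (multiDeriv_test α ξ hf).1.integrable
    have hmap : ∀ α x, Real.fourierChar (-inner ℝ x ξ) • (B α).toEuclideanLin (multiDeriv α f x)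
        = (B α).toEuclideanLin.toContinuousLinearMap
          (Real.fourierChar (-inner ℝ x ξ) • multiDeriv α f x) := by
      intro α x
      simp [Circle.smul_def]
    rw [symbol_apply, Real.fourier_eq]
    simp only [applyOp, Finset.smul_sum, hmap]
    rw [integral_finsetSum _ fun α _ => ContinuousLinearMap.integrable_comp _ (hcomp α)]
    refine Finset.sum_congr rfl fun α _ => ?_
    rw [ContinuousLinearMap.integral_comp_comm _ (hcomp α), ← (multiDeriv_test α ξ hf).2.2]
    rfl

end Symbol

/-- If `(u j, T u j) → (0, z)`, then `T u j` is Cauchy, so the form hypothesis yields `‖T u j‖ → 0`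
and `z = 0`. -/
theorem FormClosable.isClosable {H K : Type*} [NormedAddCommGroup H] [InnerProductSpace ℂ H]
    [NormedAddCommGroup K] [InnerProductSpace ℂ K] {T : H →ₗ.[ℂ] K} (hT : FormClosable T) :
    T.IsClosable := by
  refine ⟨T.graph.topologicalClosure.toLinearPMap, (Submodule.toLinearPMap_graph_eq _ ?_).symm⟩
  rintro ⟨x, z⟩ hx (rfl : x = 0)
  obtain ⟨p, hp, hlim⟩ := mem_closure_iff_seq_limit.1
    (show ((0 : H), z) ∈ closure (T.graph : Set (H × K)) from hx)
  choose u hu using fun j => (LinearPMap.mem_graph_iff T).1 (hp j)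
  have h1 : Tendsto (fun j => (u j : H)) atTop (𝓝 0) := by
    simp only [(hu _).1]
    exact (continuous_fst.tendsto _).comp hlim
  have h2 : Tendsto (fun j => T (u j)) atTop (𝓝 z) := by
    simp only [(hu _).2]
    exact (continuous_snd.tendsto _).comp hlim
  have h3 := hT u h1 fun ε hε => by
    obtain ⟨N, hN⟩ := Metric.cauchySeq_iff.1 h2.cauchySeq (Real.sqrt ε) (Real.sqrt_pos.2 hε)
    refine ⟨N, fun i hi j hj => ?_⟩
    rw [LinearPMap.map_sub, ← dist_eq_norm]
    exact (Real.lt_sqrt dist_nonneg).1 (hN i hi j hj)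
  have h4 : ‖z‖ ^ 2 = 0 := tendsto_nhds_unique (h2.norm.pow 2) h3
  exact norm_eq_zero.1 (pow_eq_zero_iff two_ne_zero |>.1 h4)

theorem mem_domain_of_mem_graph {H K : Type*} [AddCommGroup H] [Module ℂ H] [AddCommGroup K]
    [Module ℂ K] {T : H →ₗ.[ℂ] K} {u : H} {w : K} (h : (u, w) ∈ T.graph) : u ∈ T.domain := by
  obtain ⟨y, rfl, -⟩ := (LinearPMap.mem_graph_iff T).1 h
  exact y.2

theorem mem_closure_domain {H K : Type*} [NormedAddCommGroup H] [InnerProductSpace ℂ H]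
    [NormedAddCommGroup K] [InnerProductSpace ℂ K] {T : H →ₗ.[ℂ] K} {S : Submodule ℂ H} {u : H}
    (hS : u ∈ S) (hu : u ∈ T.domain) : u ∈ (T.domRestrict S).closure.domain :=
  (LinearPMap.le_closure (T.domRestrict S)).1 ⟨hS, hu⟩

section Domains

variable {n m l : ℕ} (B : Coeffs n m l) (Ω : Opens (EuclideanSpace ℝ (Fin n)))

/-! ### The form domains -/

theorem graph_smoothOp : (smoothOp B Ω).graph = smoothGraph B Ω :=
  Submodule.toLinearPMap_graph_eq _ (smoothGraph_single_valued B Ω)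

variable {B Ω}

theorem mem_testFunctions {u : L2 Ω m} : u ∈ testFunctions Ω m ↔
    ∃ f : EuclideanSpace ℝ (Fin n) → EuclideanSpace ℂ (Fin m),
      ContDiff ℝ ∞ f ∧ HasCompactSupport f ∧ tsupport f ⊆ Ω ∧
      u =ᵐ[volume.restrict (Ω : Set (EuclideanSpace ℝ (Fin n)))] f := Iff.rfl

theorem mem_smoothGraph {u : L2 Ω m} {w : L2 Ω l} : (u, w) ∈ smoothGraph B Ω ↔
    ∃ f : EuclideanSpace ℝ (Fin n) → EuclideanSpace ℂ (Fin m), ContDiffOn ℝ ∞ f Ω ∧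
      u =ᵐ[volume.restrict (Ω : Set (EuclideanSpace ℝ (Fin n)))] f ∧
      w =ᵐ[volume.restrict (Ω : Set (EuclideanSpace ℝ (Fin n)))] applyOp B f := Iff.rfl

theorem toLp_mem_graph_smoothOp {f : EuclideanSpace ℝ (Fin n) → EuclideanSpace ℂ (Fin m)}
    (hc : ContDiff ℝ ∞ f) (hf : MemLp f 2 (volume.restrict (Ω : Set (EuclideanSpace ℝ (Fin n)))))
    (hLf : MemLp (applyOp B f) 2 (volume.restrict (Ω : Set (EuclideanSpace ℝ (Fin n))))) :
    (hf.toLp f, hLf.toLp (applyOp B f)) ∈ (smoothOp B Ω).graph := by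
  rw [graph_smoothOp]
  exact mem_smoothGraph.2 ⟨f, hc.contDiffOn, hf.coeFn_toLp, hLf.coeFn_toLp⟩

/-- Closed conditions on `(u, T_D u)` need to be verified for test functions only. -/
theorem dirichlet_graph_subset (hB : FormClosable (smoothOp B Ω)) {C : Set (L2 Ω m × L2 Ω l)}
    (hC : IsClosed C)
    (h : ∀ f : EuclideanSpace ℝ (Fin n) → EuclideanSpace ℂ (Fin m), ∀ hf : IsTest f,
      tsupport f ⊆ Ω →
      ((hf.memLp.restrict Ω).toLp f, ((applyOp_test B hf).1.memLp.restrict Ω).toLp (applyOp B f))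
        ∈ C) :
    (((smoothOp B Ω).domRestrict (testFunctions Ω m)).closure.graph : Set _) ⊆ C := by
  have hcl : ((smoothOp B Ω).domRestrict (testFunctions Ω m)).IsClosable :=
    hB.isClosable.leIsClosable LinearPMap.domRestrict_le
  rw [← hcl.graph_closure_eq_closure_graph]
  refine closure_minimal ?_ hC
  rintro ⟨u, w⟩ huw
  have hg : (u, w) ∈ (smoothOp B Ω).graph := LinearPMap.le_graph_of_le LinearPMap.domRestrict_le huw
  obtain ⟨y, hy, -⟩ := (LinearPMap.mem_graph_iff _).1 huw
  have hu : u ∈ testFunctions Ω m := by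
    have hle : ((smoothOp B Ω).domRestrict (testFunctions Ω m)).domain ≤ testFunctions Ω m := by
      rw [LinearPMap.domRestrict_domain]
      exact inf_le_left
    exact (show (y : L2 Ω m) = u from hy) ▸ hle y.2
  obtain ⟨f, hf1, hf2, hf3, hf4⟩ := hu
  have hf : IsTest f := ⟨hf1, hf2⟩
  have hu' : u = (hf.memLp.restrict Ω).toLp f :=
    Lp.ext (hf4.trans (hf.memLp.restrict _).coeFn_toLp.symm)
  have hg' := toLp_mem_graph_smoothOp (B := B) (Ω := Ω) hf1 (hf.memLp.restrict Ω)
    ((applyOp_test B hf).1.memLp.restrict Ω)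
  rw [← hu'] at hg'
  have hw : w = ((applyOp_test B hf).1.memLp.restrict Ω).toLp (applyOp B f) :=
    LinearPMap.mem_graph_snd_inj _ hg hg' rfl
  rw [hu', hw]
  exact h f hf hf3

theorem toLp_mem_testFunctions {f : EuclideanSpace ℝ (Fin n) → EuclideanSpace ℂ (Fin m)}
    (hf : IsTest f) (hs : tsupport f ⊆ Ω) :
    (hf.memLp.restrict Ω).toLp f ∈ testFunctions Ω m := by
  rw [mem_testFunctions]
  have := (hf.memLp.restrict (Ω : Set (EuclideanSpace ℝ (Fin n)))).coeFn_toLp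
  exact ⟨f, hf.1, hf.2, hs, this⟩

theorem toLp_mem_dirichlet_domain {f : EuclideanSpace ℝ (Fin n) → EuclideanSpace ℂ (Fin m)}
    (hf : IsTest f) (hs : tsupport f ⊆ Ω) :
    (hf.memLp.restrict Ω).toLp f ∈
      ((smoothOp B Ω).domRestrict (testFunctions Ω m)).closure.domain := by
  have h1 := mem_domain_of_mem_graph (toLp_mem_graph_smoothOp (B := B) (Ω := Ω)
    hf.1 (hf.memLp.restrict Ω) ((applyOp_test B hf).1.memLp.restrict Ω))
  exact mem_closure_domain (toLp_mem_testFunctions hf hs) h1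

/-- If `u` is orthogonal to all test functions and `I = ∫ g u` for a scalar test function `g`,
testing with `g I` gives `‖I‖² = 0`; the fundamental lemma of the calculus of variations then gives
`u = 0`. -/
theorem dense_testFunctions : Dense (testFunctions Ω m : Set (L2 Ω m)) := by
  rw [Submodule.dense_iff_topologicalClosure_eq_top, Submodule.topologicalClosure_eq_top_iff,
    Submodule.eq_bot_iff]
  intro u hu
  have hloc : LocallyIntegrable u (volume.restrict (Ω : Set (EuclideanSpace ℝ (Fin n)))) :=
    (Lp.memLp u).locallyIntegrable (by norm_num)
  have key := IsOpen.ae_eq_zero_of_integral_contDiff_smul_eq_zero Ω.isOpen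
    (locallyIntegrableOn_of_locallyIntegrable_restrict hloc) ?_
  · refine (Lp.eq_zero_iff_ae_eq_zero).2 ?_
    exact (ae_restrict_iff' Ω.isOpen.measurableSet).2 key
  intro g hg hgc hgs
  have hgt : ∀ c : EuclideanSpace ℂ (Fin m), IsTest fun x => g x • c := fun c =>
    ⟨hg.smul contDiff_const, hgc.smul_right⟩
  rw [← setIntegral_eq_integral_of_forall_compl_eq_zero (s := (Ω : Set (EuclideanSpace ℝ (Fin n))))
    fun x hx => by rw [image_eq_zero_of_notMem_tsupport fun h => hx (hgs h), zero_smul]]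
  refine inner_self_eq_zero (𝕜 := ℂ).1 ?_
  set I := ∫ x in (Ω : Set (EuclideanSpace ℝ (Fin n))), g x • u x with hI
  have hmem : ((hgt I).memLp.restrict Ω).toLp (fun x => g x • I) ∈ testFunctions Ω m :=
    toLp_mem_testFunctions (hgt I)
      ((closure_mono (Function.support_smul_subset_left g _)).trans hgs)
  have h0 := (Submodule.mem_orthogonal _ _).1 hu _ hmem
  rw [L2.inner_def] at h0
  conv_lhs => rw [hI]
  rw [← integral_inner (hloc.integrable_smul_left_of_hasCompactSupport hg.continuous hgc), ← h0]
  refine integral_congr_ae ?_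
  filter_upwards [((hgt I).memLp.restrict Ω).coeFn_toLp] with x hx
  rw [hx, ← Complex.coe_smul, ← Complex.coe_smul, inner_smul_left, inner_smul_right,
    Complex.conj_ofReal]

variable (B Ω)

theorem dense_dirichlet_domain :
    Dense (((smoothOp B Ω).domRestrict (testFunctions Ω m)).closure.domain : Set (L2 Ω m)) := by
  refine dense_testFunctions.mono ?_
  rintro u ⟨f, hf1, hf2, hf3, hf4⟩
  have hf : IsTest f := ⟨hf1, hf2⟩
  have hu' : u = (hf.memLp.restrict Ω).toLp f :=
    Lp.ext (hf4.trans (hf.memLp.restrict _).coeFn_toLp.symm)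
  rw [hu']
  exact toLp_mem_dirichlet_domain hf hf3

variable {B Ω}

theorem dirichlet_le_neumann (hB : FormClosable (smoothOp B Ω)) :
    ((smoothOp B Ω).domRestrict (testFunctions Ω m)).closure ≤ (smoothOp B Ω).closure :=
  hB.isClosable.closure_mono LinearPMap.domRestrict_le

theorem dense_neumann_domain (hB : FormClosable (smoothOp B Ω)) :
    Dense ((smoothOp B Ω).closure.domain : Set (L2 Ω m)) :=
  (dense_dirichlet_domain B Ω).mono (dirichlet_le_neumann hB).1

end Domains

section Plancherel

variable {n m l : ℕ} {B : Coeffs n m l} {Ω : Opens (EuclideanSpace ℝ (Fin n))}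

/-! ### The Dirichlet form domain and the Fourier transform -/

/-- `L₂(ℝⁿ, ℂ^d)`. -/
abbrev WholeL2 (n d : ℕ) : Type :=
  Lp (EuclideanSpace ℂ (Fin d)) 2 (volume : Measure (EuclideanSpace ℝ (Fin n)))

theorem memLp_indicator {d : ℕ} (u : L2 Ω d) :
    MemLp ((Ω : Set (EuclideanSpace ℝ (Fin n))).indicator u) 2 volume :=
  (memLp_indicator_iff_restrict Ω.isOpen.measurableSet).2 (Lp.memLp u)

/-- Extension by zero from `Ω` to the whole space. -/
def zeroExt {d : ℕ} (u : L2 Ω d) : WholeL2 n d :=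
  (memLp_indicator u).toLp _

theorem norm_zeroExt {d : ℕ} (u : L2 Ω d) : ‖zeroExt u‖ = ‖u‖ := by
  rw [zeroExt, Lp.norm_toLp, eLpNorm_indicator_eq_eLpNorm_restrict Ω.isOpen.measurableSet,
    Lp.norm_def]

theorem zeroExt_toLp {d : ℕ} {f : EuclideanSpace ℝ (Fin n) → EuclideanSpace ℂ (Fin d)}
    (hf : MemLp f 2) (hs : tsupport f ⊆ Ω) :
    zeroExt ((hf.restrict Ω).toLp f) = hf.toLp f := by
  refine (MemLp.toLp_eq_toLp_iff _ _).2 ?_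
  have h := (ae_restrict_iff' Ω.isOpen.measurableSet).1
    (hf.restrict (Ω : Set (EuclideanSpace ℝ (Fin n)))).coeFn_toLp
  filter_upwards [h] with x hx
  by_cases hxΩ : x ∈ (Ω : Set (EuclideanSpace ℝ (Fin n)))
  · rw [Set.indicator_of_mem hxΩ, hx hxΩ]
  · rw [Set.indicator_of_notMem hxΩ, image_eq_zero_of_notMem_tsupport fun h => hxΩ (hs h)]

theorem isometry_zeroExt {d : ℕ} : Isometry (zeroExt (Ω := Ω) (d := d)) := by
  refine Isometry.of_dist_eq fun u v => ?_
  rw [dist_eq_norm, dist_eq_norm, ← norm_zeroExt (u - v)]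
  congr 1
  rw [zeroExt, zeroExt, zeroExt, ← MemLp.toLp_sub]
  refine (MemLp.toLp_eq_toLp_iff _ _).2 ?_
  have h := (ae_restrict_iff' Ω.isOpen.measurableSet).1 (Lp.coeFn_sub u v)
  filter_upwards [h] with x hx
  by_cases hxΩ : x ∈ (Ω : Set (EuclideanSpace ℝ (Fin n)))
  · rw [Pi.sub_apply, Set.indicator_of_mem hxΩ, Set.indicator_of_mem hxΩ,
      Set.indicator_of_mem hxΩ, hx hxΩ, Pi.sub_apply]
  · simp [Set.indicator_of_notMem hxΩ]

theorem norm_sq_eq_integral {E F : Type*} [MeasurableSpace E] {μ : Measure E}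
    [NormedAddCommGroup F] [InnerProductSpace ℂ F] (V : Lp F 2 μ) :
    Integrable (fun x => ‖V x‖ ^ 2) μ ∧ ‖V‖ ^ 2 = ∫ x, ‖V x‖ ^ 2 ∂μ := by
  refine ⟨(memLp_two_iff_integrable_sq_norm (Lp.aestronglyMeasurable V)).1 (Lp.memLp V), ?_⟩
  have h := inner_self_eq_ofReal V
  rw [L2.inner_def] at h
  simp_rw [inner_self_eq_ofReal] at h
  rw [integral_complex_ofReal] at h
  exact (Complex.ofReal_injective h).symm

/-- Multiplication by `S` may be unbounded on `L₂`, but its graph is closed: along a subsequence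
both components converge almost everywhere, and each `S x` is continuous. -/
theorem isClosed_mul_graph {E F G : Type*} [MeasurableSpace E] {μ : Measure E}
    [NormedAddCommGroup F] [NormedSpace ℂ F] [NormedAddCommGroup G] [NormedSpace ℂ G]
    (S : E → F →L[ℂ] G) :
    IsClosed {p : Lp F 2 μ × Lp G 2 μ | p.2 =ᵐ[μ] fun x => S x (p.1 x)} := by
  refine IsSeqClosed.isClosed fun p q hp hq => ?_
  obtain ⟨σ, hσ, h1⟩ := (tendstoInMeasure_of_tendsto_Lp
    ((continuous_fst.tendsto q).comp hq)).exists_seq_tendsto_ae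
  have hq' : Tendsto (fun j => (p (σ j)).2) atTop (𝓝 q.2) :=
    ((continuous_snd.tendsto q).comp hq).comp hσ.tendsto_atTop
  obtain ⟨τ, hτ, h2⟩ := (tendstoInMeasure_of_tendsto_Lp hq').exists_seq_tendsto_ae
  have hall : ∀ᵐ x ∂μ, ∀ j, (p j).2 x = S x ((p j).1 x) := ae_all_iff.2 hp
  filter_upwards [h1, h2, hall] with x hx1 hx2 hx
  refine tendsto_nhds_unique hx2 ?_
  have : Tendsto (fun j => S x ((p (σ (τ j))).1 x)) atTop (𝓝 (S x (q.1 x))) :=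
    ((S x).continuous.tendsto _).comp (hx1.comp hτ.tendsto_atTop)
  exact this.congr fun j => (hx _).symm

theorem fourier_toLp_test {d : ℕ} {f : EuclideanSpace ℝ (Fin n) → EuclideanSpace ℂ (Fin d)}
    (hf : IsTest f) : (𝓕 (hf.memLp.toLp f) : WholeL2 n d) =ᵐ[volume] 𝓕 f := by
  let φ := hf.2.toSchwartzMap hf.1
  have h1 : hf.memLp.toLp f = φ.toLp 2 := Lp.ext (by
    filter_upwards [hf.memLp.coeFn_toLp, φ.coeFn_toLp 2] with x hx hx'
    rw [hx, hx']
    rfl)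
  rw [h1, SchwartzMap.toLp_fourier_eq]
  exact (𝓕 φ).coeFn_toLp 2

/-- On test functions extension by zero commutes with `L`, which becomes multiplication by the
symbol. This relation is closed, so it passes to all of `H¹₀`. -/
theorem fourier_dirichlet (hB : FormClosable (smoothOp B Ω)) {u : L2 Ω m} {w : L2 Ω l}
    (huw : (u, w) ∈ ((smoothOp B Ω).domRestrict (testFunctions Ω m)).closure.graph) :
    (𝓕 (zeroExt w) : WholeL2 n l) =ᵐ[volume]
      fun ξ => symbol B ξ ((𝓕 (zeroExt u) : WholeL2 n m) ξ) := by
  have hcont : Continuous fun p : L2 Ω m × L2 Ω l =>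
      ((𝓕 (zeroExt p.1) : WholeL2 n m), (𝓕 (zeroExt p.2) : WholeL2 n l)) :=
    ((Lp.fourierTransformₗᵢ _ _).continuous.comp (isometry_zeroExt.continuous.comp
      continuous_fst)).prodMk ((Lp.fourierTransformₗᵢ _ _).continuous.comp
        (isometry_zeroExt.continuous.comp continuous_snd))
  refine dirichlet_graph_subset hB ((isClosed_mul_graph (symbol B)).preimage hcont)
    (fun f hf hs => ?_) huw
  have hLf := applyOp_test B hf
  simp only [Set.mem_preimage, Set.mem_ofPred_eq]
  rw [zeroExt_toLp hf.memLp hs, zeroExt_toLp hLf.1.memLp (hLf.2.1.trans hs)]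
  filter_upwards [fourier_toLp_test hf, fourier_toLp_test hLf.1] with ξ h1 h2
  rw [h1, h2, hLf.2.2]

/-- If the symbol satisfies `|L(ξ) c|² > b |c|²` for almost all `ξ` and all `c ≠ 0`, then the
Dirichlet form is strictly larger than `b`. -/
theorem eq_zero_of_dirichlet_form_le (hB : FormClosable (smoothOp B Ω)) {b : ℝ}
    (hb : ∀ᵐ ξ, ∀ c ≠ 0, b * ‖c‖ ^ 2 < ‖symbol B ξ c‖ ^ 2) {u : L2 Ω m} {w : L2 Ω l}
    (huw : (u, w) ∈ ((smoothOp B Ω).domRestrict (testFunctions Ω m)).closure.graph)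
    (hle : ‖w‖ ^ 2 ≤ b * ‖u‖ ^ 2) : u = 0 := by
  have hF := fourier_dirichlet hB huw
  set U : WholeL2 n m := 𝓕 (zeroExt u) with hU
  set W : WholeL2 n l := 𝓕 (zeroExt w) with hW
  have hnU : ‖U‖ = ‖u‖ := by rw [hU, Lp.norm_fourier_eq, norm_zeroExt]
  have hnW : ‖W‖ = ‖w‖ := by rw [hW, Lp.norm_fourier_eq, norm_zeroExt]
  have hint : Integrable fun ξ => ‖W ξ‖ ^ 2 - b * ‖U ξ‖ ^ 2 :=
    (norm_sq_eq_integral W).1.sub ((norm_sq_eq_integral U).1.const_mul b)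
  have hnn : 0 ≤ᵐ[volume] fun ξ => ‖W ξ‖ ^ 2 - b * ‖U ξ‖ ^ 2 := by
    filter_upwards [hb, hF] with ξ h1 h2
    rw [h2]
    by_cases hc : U ξ = 0
    · simp [hc]
    · exact sub_nonneg.2 (h1 _ hc).le
  -- By Plancherel the integral equals `‖w‖² - b ‖u‖² ≤ 0`, while the integrand is nonnegative and
  -- positive wherever `U ≠ 0`.
  have hzero : ∫ ξ, (‖W ξ‖ ^ 2 - b * ‖U ξ‖ ^ 2) = 0 := by
    refine le_antisymm ?_ (integral_nonneg_of_ae hnn)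
    rw [integral_sub (norm_sq_eq_integral W).1 ((norm_sq_eq_integral U).1.const_mul b),
      integral_const_mul, ← (norm_sq_eq_integral W).2,
      ← (norm_sq_eq_integral U).2, hnU, hnW]
    linarith
  have hae := (integral_eq_zero_iff_of_nonneg_ae hnn hint).1 hzero
  have hU0 : U = 0 := by
    refine (Lp.eq_zero_iff_ae_eq_zero).2 ?_
    filter_upwards [hae, hb, hF] with ξ h1 h2 h3
    by_contra hc
    have := h2 _ hc
    rw [h3] at h1
    simp only [Pi.zero_apply] at h1
    linarith
  rw [← norm_eq_zero, ← hnU, hU0, norm_zero]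

end Plancherel

/-- Duality: a test function `φ` is the Fourier transform of the Schwartz function `𝓕⁻ φ`, so `∫ φ g
= ∫ (𝓕⁻ φ) (𝓕 g) = 0`. -/
theorem eq_zero_of_fourier_eq_zero {n d : ℕ}
    {g : EuclideanSpace ℝ (Fin n) → EuclideanSpace ℂ (Fin d)}
    (hg : Integrable g) (h : ∀ ξ, 𝓕 g ξ = 0) : g =ᵐ[volume] 0 := by
  refine ae_eq_zero_of_integral_contDiff_smul_eq_zero hg.locallyIntegrable fun φ hφ hφc => ?_
  have hψ : HasCompactSupport fun x => (φ x : ℂ) := hφc.comp_left (g := Complex.ofReal) (by simp)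
  have hψ' : ContDiff ℝ ∞ fun x => (φ x : ℂ) := Complex.ofRealCLM.contDiff.comp hφ
  let ψ := hψ.toSchwartzMap hψ'
  have h1 := VectorFourier.integral_fourierIntegral_smul_eq_flip (μ := volume) (ν := volume)
    (L := innerₗ (EuclideanSpace ℝ (Fin n))) Real.continuous_fourierChar
    continuous_inner (𝓕⁻ ψ).integrable hg
  have h2 : ∀ ξ, VectorFourier.fourierIntegral Real.fourierChar volume
      (innerₗ (EuclideanSpace ℝ (Fin n)))
      ((𝓕⁻ ψ : SchwartzMap (EuclideanSpace ℝ (Fin n)) ℂ) : EuclideanSpace ℝ (Fin n) → ℂ) ξ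
        = (φ ξ : ℂ) := by
    intro ξ
    have : 𝓕 (𝓕⁻ ψ) = ψ := FourierTransform.fourier_fourierInv_eq ψ
    exact DFunLike.congr_fun this ξ
  have h3 : ∀ x, VectorFourier.fourierIntegral Real.fourierChar volume
      (innerₗ (EuclideanSpace ℝ (Fin n))).flip g x = 0 := by
    intro x
    rw [flip_innerₗ]
    exact h x
  simp only [h2, h3, smul_zero, integral_zero, Complex.coe_smul] at h1
  exact h1

section FiniteVolume

variable {n m l : ℕ} {B : Coeffs n m l} {Ω : Opens (EuclideanSpace ℝ (Fin n))}

/-! ### Plane waves in a domain of finite volume -/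

/-- The Fourier transform of an element of `L₂(Ω)`, extended by zero. -/
def ft {d : ℕ} (u : L2 Ω d) (ξ : EuclideanSpace ℝ (Fin n)) : EuclideanSpace ℂ (Fin d) :=
  𝓕 ((Ω : Set (EuclideanSpace ℝ (Fin n))).indicator u) ξ

theorem ft_toLp {d : ℕ} {f : EuclideanSpace ℝ (Fin n) → EuclideanSpace ℂ (Fin d)}
    (hf : MemLp f 2) (hs : tsupport f ⊆ Ω) (ξ : EuclideanSpace ℝ (Fin n)) :
    ft ((hf.restrict Ω).toLp f) ξ = 𝓕 f ξ := by
  rw [ft, Real.fourier_eq, Real.fourier_eq]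
  refine integral_congr_ae ?_
  have h := (ae_restrict_iff' Ω.isOpen.measurableSet).1
    (hf.restrict (Ω : Set (EuclideanSpace ℝ (Fin n)))).coeFn_toLp
  filter_upwards [h] with x hx
  by_cases hxΩ : x ∈ (Ω : Set (EuclideanSpace ℝ (Fin n)))
  · rw [Set.indicator_of_mem hxΩ, hx hxΩ]
  · rw [Set.indicator_of_notMem hxΩ, image_eq_zero_of_notMem_tsupport fun h => hxΩ (hs h)]

variable [IsFiniteMeasure (volume.restrict (Ω : Set (EuclideanSpace ℝ (Fin n))))]

theorem memLp_planeWave {d : ℕ} (ξ : EuclideanSpace ℝ (Fin n)) (c : EuclideanSpace ℂ (Fin d)) :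
    MemLp (planeWave ξ c) 2 (volume.restrict (Ω : Set (EuclideanSpace ℝ (Fin n)))) :=
  MemLp.of_bound (contDiff_planeWave ξ c).continuous.aestronglyMeasurable ‖c‖
    (Eventually.of_forall fun x => (norm_planeWave ξ c x).le)

variable (Ω) in
/-- The plane wave as an element of `L₂(Ω)`. -/
def waveLp {d : ℕ} (ξ : EuclideanSpace ℝ (Fin n)) (c : EuclideanSpace ℂ (Fin d)) : L2 Ω d :=
  (memLp_planeWave ξ c).toLp _

theorem coeFn_waveLp {d : ℕ} (ξ : EuclideanSpace ℝ (Fin n)) (c : EuclideanSpace ℂ (Fin d)) :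
    waveLp Ω ξ c =ᵐ[volume.restrict (Ω : Set (EuclideanSpace ℝ (Fin n)))] planeWave ξ c :=
  (memLp_planeWave ξ c).coeFn_toLp

theorem waveLp_mem_graph (ξ : EuclideanSpace ℝ (Fin n)) (c : EuclideanSpace ℂ (Fin m)) :
    (waveLp Ω ξ c, waveLp Ω ξ (symbol B ξ c)) ∈ (smoothOp B Ω).closure.graph := by
  refine LinearPMap.le_graph_of_le (LinearPMap.le_closure _) ?_
  rw [graph_smoothOp, mem_smoothGraph]
  refine ⟨planeWave ξ c, (contDiff_planeWave ξ c).contDiffOn, coeFn_waveLp ξ c, ?_⟩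
  rw [applyOp_planeWave]
  exact coeFn_waveLp ξ _

theorem norm_waveLp_sq {d : ℕ} (ξ : EuclideanSpace ℝ (Fin n)) (c : EuclideanSpace ℂ (Fin d)) :
    ‖waveLp Ω ξ c‖ ^ 2 = volume.real (Ω : Set (EuclideanSpace ℝ (Fin n))) * ‖c‖ ^ 2 := by
  rw [(norm_sq_eq_integral _).2]
  have : (fun x => ‖waveLp Ω ξ c x‖ ^ 2)
      =ᵐ[volume.restrict (Ω : Set (EuclideanSpace ℝ (Fin n)))] fun _ => ‖c‖ ^ 2 := by
    filter_upwards [coeFn_waveLp ξ c] with x hx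
    rw [hx, norm_planeWave]
  rw [integral_congr_ae this]
  simp

theorem integrable_L2 {d : ℕ} (u : L2 Ω d) :
    Integrable u (volume.restrict (Ω : Set (EuclideanSpace ℝ (Fin n)))) :=
  (Lp.memLp u).integrable (by norm_num)

theorem integrable_indicator_L2 {d : ℕ} (u : L2 Ω d) :
    Integrable ((Ω : Set (EuclideanSpace ℝ (Fin n))).indicator u) :=
  (integrable_indicator_iff Ω.isOpen.measurableSet).2 (integrable_L2 u)

theorem continuous_ft {d : ℕ} (u : L2 Ω d) : Continuous (ft u) :=
  VectorFourier.fourierIntegral_continuous Real.continuous_fourierChar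
    (L := innerₗ (EuclideanSpace ℝ (Fin n))) continuous_inner (integrable_indicator_L2 u)

theorem eq_zero_of_ft_eq_zero {d : ℕ} {u : L2 Ω d} (h : ∀ ξ, ft u ξ = 0) : u = 0 := by
  have h0 := eq_zero_of_fourier_eq_zero (integrable_indicator_L2 u) h
  refine (Lp.eq_zero_iff_ae_eq_zero).2 ?_
  filter_upwards [ae_restrict_of_ae h0, ae_restrict_mem Ω.isOpen.measurableSet] with x hx hxΩ
  rwa [Set.indicator_of_mem hxΩ] at hx

theorem inner_waveLp {d : ℕ} (ξ : EuclideanSpace ℝ (Fin n)) (c : EuclideanSpace ℂ (Fin d))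
    (u : L2 Ω d) : inner ℂ (waveLp Ω ξ c) u = inner ℂ c (ft u ξ) := by
  have h1 : ft u ξ = ∫ x in (Ω : Set (EuclideanSpace ℝ (Fin n))),
      Real.fourierChar (-inner ℝ x ξ) • u x := by
    rw [ft, Real.fourier_eq, ← integral_indicator Ω.isOpen.measurableSet]
    refine integral_congr_ae (Eventually.of_forall fun x => ?_)
    by_cases hx : x ∈ (Ω : Set (EuclideanSpace ℝ (Fin n))) <;> simp [hx]
  rw [h1, ← integral_inner ((Real.fourierIntegral_convergent_iff ξ).2 (integrable_L2 u)),
    L2.inner_def]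
  refine integral_congr_ae ?_
  filter_upwards [coeFn_waveLp ξ c] with x hx
  rw [hx, planeWave, inner_smul_left, Circle.smul_def, inner_smul_right, Real.fourierChar_apply,
    ← Complex.exp_conj]
  congr 2
  simp only [map_mul, Complex.conj_I, Complex.conj_ofReal, Complex.conj_ofNat]
  push_cast
  ring

/-- Integration by parts without boundary terms. It holds for test functions by the Fourier
transform of `L f`, and both sides are continuous in `(u, w)`. The plane wave itself need not
satisfy any boundary condition. -/
theorem inner_waveLp_dirichlet (hB : FormClosable (smoothOp B Ω)) {u : L2 Ω m} {w : L2 Ω l}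
    (huw : (u, w) ∈ ((smoothOp B Ω).domRestrict (testFunctions Ω m)).closure.graph)
    (ξ : EuclideanSpace ℝ (Fin n)) (c : EuclideanSpace ℂ (Fin l)) :
    inner ℂ (waveLp Ω ξ c) w = inner ℂ c (symbol B ξ (ft u ξ)) := by
  rw [← ContinuousLinearMap.adjoint_inner_left, ← inner_waveLp]
  have hC : IsClosed {p : L2 Ω m × L2 Ω l | inner ℂ (waveLp Ω ξ c) p.2
      = inner ℂ (waveLp Ω ξ ((symbol B ξ).adjoint c)) p.1} :=
    isClosed_eq (by fun_prop) (by fun_prop)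
  refine dirichlet_graph_subset hB hC (fun f hf hs => ?_) huw
  have hLf := applyOp_test B hf
  simp only [Set.mem_ofPred_eq]
  rw [inner_waveLp, inner_waveLp, ContinuousLinearMap.adjoint_inner_left, ft_toLp hf.memLp hs,
    ft_toLp hLf.1.memLp (hLf.2.1.trans hs), hLf.2.2]

/-- The inner product is controlled by the Fourier transform of `g` at `ξ j`, so this is the
Riemann–Lebesgue lemma. -/
theorem tendsto_inner_waveLp {d : ℕ} {ξ : ℕ → EuclideanSpace ℝ (Fin n)}
    (hξ : Tendsto ξ atTop (cocompact _)) {c : ℕ → EuclideanSpace ℂ (Fin d)} {C : ℝ}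
    (hc : ∀ j, ‖c j‖ ≤ C) (g : L2 Ω d) :
    Tendsto (fun j => inner ℂ g (waveLp Ω (ξ j) (c j))) atTop (𝓝 0) := by
  have h1 : Tendsto (fun j => ft g (ξ j)) atTop (𝓝 0) :=
    (tendsto_integral_exp_inner_smul_cocompact _).comp hξ
  rw [tendsto_zero_iff_norm_tendsto_zero] at h1 ⊢
  have h2 : Tendsto (fun j => C * ‖ft g (ξ j)‖) atTop (𝓝 0) := by simpa using h1.const_mul C
  refine squeeze_zero (fun _ => norm_nonneg _) (fun j => ?_) h2
  rw [← inner_conj_symm, RCLike.norm_conj, inner_waveLp]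
  exact (norm_inner_le_norm _ _).trans (mul_le_mul_of_nonneg_right (hc j) (norm_nonneg _))

end FiniteVolume

section LowSets

variable {n m l : ℕ} (B : Coeffs n m l) (b : ℝ)

/-! ### Frequencies at which the symbol is small -/

/-- The frequencies at which `L(ξ)^* L(ξ)` has an eigenvalue `≤ b`. -/
def lowSet : Set (EuclideanSpace ℝ (Fin n)) :=
  {ξ | ∃ c ≠ 0, ‖symbol B ξ c‖ ^ 2 ≤ b * ‖c‖ ^ 2}

/-- The frequencies at which `L(ξ)^* L(ξ)` has an eigenvalue `< b`. -/
def strictLowSet : Set (EuclideanSpace ℝ (Fin n)) :=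
  {ξ | ∃ c, ‖symbol B ξ c‖ ^ 2 < b * ‖c‖ ^ 2}

theorem strictLowSet_subset_lowSet : strictLowSet B b ⊆ lowSet B b := by
  rintro ξ ⟨c, hc⟩
  refine ⟨c, ?_, hc.le⟩
  rintro rfl
  simp at hc

theorem isOpen_strictLowSet : IsOpen (strictLowSet B b) := by
  have : strictLowSet B b = ⋃ c, {ξ | ‖symbol B ξ c‖ ^ 2 < b * ‖c‖ ^ 2} := by
    ext ξ
    simp [strictLowSet]
  rw [this]
  refine isOpen_iUnion fun c => isOpen_lt ?_ continuous_const
  exact (((continuous_symbol B).clm_apply continuous_const).norm).pow 2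

theorem mem_lowSet_iff_unit {ξ : EuclideanSpace ℝ (Fin n)} :
    ξ ∈ lowSet B b ↔ ∃ c, ‖c‖ = 1 ∧ ‖symbol B ξ c‖ ^ 2 ≤ b := by
  constructor
  · rintro ⟨c, hc, h⟩
    have hc' : 0 < ‖c‖ := norm_pos_iff.2 hc
    refine ⟨((‖c‖⁻¹ : ℝ) : ℂ) • c, ?_, ?_⟩
    · rw [norm_smul, Complex.norm_real, norm_inv, norm_norm, inv_mul_cancel₀ hc'.ne']
    · rw [map_smul, norm_smul, Complex.norm_real, norm_inv, norm_norm, mul_pow, inv_pow,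
        inv_mul_le_iff₀ (by positivity)]
      linarith
  · rintro ⟨c, hc, h⟩
    refine ⟨c, ?_, by rw [hc]; linarith⟩
    rintro rfl
    simp at hc

/-- It is the projection of a closed set along the compact unit sphere of `ℂᵐ`. -/
theorem isClosed_lowSet : IsClosed (lowSet B b) := by
  let C : Set (EuclideanSpace ℝ (Fin n) × Metric.sphere (0 : EuclideanSpace ℂ (Fin m)) 1) :=
    {p | ‖symbol B p.1 (p.2 : EuclideanSpace ℂ (Fin m))‖ ^ 2 ≤ b}
  have hC : IsClosed C := by
    refine isClosed_le ?_ continuous_const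
    exact ((((continuous_symbol B).comp continuous_fst).clm_apply
      (continuous_subtype_val.comp continuous_snd)).norm).pow 2
  have : lowSet B b = Prod.fst '' C := by
    ext ξ
    rw [mem_lowSet_iff_unit]
    constructor
    · rintro ⟨c, hc, h⟩
      exact ⟨(ξ, ⟨c, by simpa using hc⟩), h, rfl⟩
    · rintro ⟨⟨ξ', c⟩, h, rfl⟩
      exact ⟨c, by simp, h⟩
  rw [this]
  exact isClosedMap_fst_of_compactSpace C hC

variable {B b}

/-- Off `strictLowSet` the quadratic form `‖L(ξ) x‖² - b ‖x‖²` is nonnegative and vanishes at `c`,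
so `c` is a minimum and the gradient `h` there is zero. -/
theorem exists_eigenvector_of_mem_diff {ξ : EuclideanSpace ℝ (Fin n)}
    (hξ : ξ ∈ lowSet B b \ strictLowSet B b) :
    ∃ c ≠ 0, (symbol B ξ).adjoint (symbol B ξ c) = (b : ℂ) • c := by
  obtain ⟨⟨c, hc, hle⟩, hnot⟩ := hξ
  have hge : ∀ x, b * ‖x‖ ^ 2 ≤ ‖symbol B ξ x‖ ^ 2 := fun x =>
    not_lt.1 fun h => hnot ⟨x, h⟩
  refine ⟨c, hc, sub_eq_zero.1 ?_⟩
  set h := (symbol B ξ).adjoint (symbol B ξ c) - (b : ℂ) • c with hh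
  have hin : (inner ℂ (symbol B ξ c) (symbol B ξ h)).re - b * (inner ℂ c h).re = ‖h‖ ^ 2 := by
    have : inner ℂ h h = inner ℂ (symbol B ξ c) (symbol B ξ h) - b * inner ℂ c h := by
      conv_lhs => rw [hh, inner_sub_left, ContinuousLinearMap.adjoint_inner_left, inner_smul_left,
        Complex.conj_ofReal]
    rw [inner_self_eq_ofReal] at this
    have := congrArg Complex.re this
    simp only [Complex.ofReal_re, Complex.sub_re, Complex.re_ofReal_mul] at this
    exact this.symm
  have hquad : ∀ t : ℝ, 0 ≤ (‖symbol B ξ h‖ ^ 2 - b * ‖h‖ ^ 2) * (t * t)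
      + (2 * ‖h‖ ^ 2) * t + 0 := by
    intro t
    have h1 := hge (c + (t : ℂ) • h)
    rw [map_add, map_smul, norm_add_sq (𝕜 := ℂ), norm_add_sq (𝕜 := ℂ), inner_smul_right,
      inner_smul_right, norm_smul, norm_smul, Complex.norm_real, mul_pow, mul_pow,
      Real.norm_eq_abs, sq_abs] at h1
    have e1 : RCLike.re ((t : ℂ) * inner ℂ (symbol B ξ c) (symbol B ξ h))
        = t * (inner ℂ (symbol B ξ c) (symbol B ξ h)).re := Complex.re_ofReal_mul _ _
    have e2 : RCLike.re ((t : ℂ) * inner ℂ c h) = t * (inner ℂ c h).re :=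
      Complex.re_ofReal_mul _ _
    rw [e1, e2] at h1
    have e3 : 2 * ‖h‖ ^ 2 * t = 2 * (t * (inner ℂ (symbol B ξ c) (symbol B ξ h)).re)
        - 2 * (b * (t * (inner ℂ c h).re)) := by
      rw [← hin]
      ring
    rw [e3]
    linarith
  have hd := discrim_le_zero hquad
  unfold discrim at hd
  have : ‖h‖ ^ 2 = 0 := by nlinarith [sq_nonneg (‖h‖ ^ 2)]
  exact norm_eq_zero.1 (pow_eq_zero_iff two_ne_zero |>.1 this)

/-- The frontier of the open set `strictLowSet` lies in the difference. Were it finite, its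
complement would be connected as `n ≥ 2`, hence contained in `strictLowSet`, and the whole space
would be bounded. -/
theorem infinite_lowSet_diff (hn : 2 ≤ n) (hbd : Bornology.IsBounded (lowSet B b))
    (hne : (strictLowSet B b).Nonempty) : (lowSet B b \ strictLowSet B b).Infinite := by
  intro hfin
  have hU := isOpen_strictLowSet B b
  have hfr : frontier (strictLowSet B b) ⊆ lowSet B b \ strictLowSet B b := by
    rw [hU.frontier_eq]
    exact Set.sdiff_subset_sdiff_left
      (closure_minimal (strictLowSet_subset_lowSet B b) (isClosed_lowSet B b))
  have hF : (frontier (strictLowSet B b)).Finite := hfin.subset hfr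
  have hrank : 1 < Module.rank ℝ (EuclideanSpace ℝ (Fin n)) := by
    rw [← Module.finrank_eq_rank, finrank_euclideanSpace_fin]
    exact_mod_cast hn
  have hconn := hF.countable.isConnected_compl_of_one_lt_rank hrank
  have hsub : (frontier (strictLowSet B b))ᶜ ⊆ strictLowSet B b := by
    refine hconn.isPreconnected.subset_left_of_subset_union hU
      (isClosed_closure (s := strictLowSet B b)).isOpen_compl ?_ ?_ ?_
    · exact Set.disjoint_compl_right_iff_subset.2 subset_closure
    · intro x hx
      by_cases hxc : x ∈ closure (strictLowSet B b)
      · left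
        by_contra hxU
        exact hx (by rw [hU.frontier_eq]; exact ⟨hxc, hxU⟩)
      · exact Or.inr hxc
    · obtain ⟨x, hx⟩ := hne
      exact ⟨x, fun h => (hU.frontier_eq ▸ h).2 hx, hx⟩
  have huniv : Bornology.IsBounded (Set.univ : Set (EuclideanSpace ℝ (Fin n))) := by
    rw [← Set.union_compl_self (frontier (strictLowSet B b))]
    exact hF.isBounded.union (hbd.subset (hsub.trans (strictLowSet_subset_lowSet B b)))
  have : Nontrivial (EuclideanSpace ℝ (Fin n)) :=
    Module.nontrivial_of_finrank_pos (R := ℝ) (by rw [finrank_euclideanSpace_fin]; omega)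
  exact NormedSpace.unbounded_univ ℝ _ huniv

/-- The Gram matrix of `L(ξ)^* L(ξ) - b`. -/
def gramMatrix (B : Coeffs n m l) (b : ℝ) (ξ : EuclideanSpace ℝ (Fin n)) :
    Matrix (Fin m) (Fin m) ℂ :=
  Matrix.of fun i j => inner ℂ (symbol B ξ (EuclideanSpace.single i 1))
    (symbol B ξ (EuclideanSpace.single j 1)) - if i = j then (b : ℂ) else 0

theorem gramMatrix_mulVec (ξ : EuclideanSpace ℝ (Fin n)) (c : EuclideanSpace ℂ (Fin m)) :
    (gramMatrix B b ξ).mulVec c =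
      ((symbol B ξ).adjoint (symbol B ξ c) - (b : ℂ) • c : EuclideanSpace ℂ (Fin m)) := by
  funext i
  have hc : c = ∑ j, c j • EuclideanSpace.single j (1 : ℂ) := by
    ext k
    simp [Pi.single_apply]
  have h1 : ((symbol B ξ).adjoint (symbol B ξ c)) i
      = inner ℂ (symbol B ξ (EuclideanSpace.single i 1)) (symbol B ξ c) := by
    rw [← ContinuousLinearMap.adjoint_inner_right]
    simp [EuclideanSpace.inner_single_left]
  rw [PiLp.sub_apply, h1]
  conv_rhs => rw [hc]
  simp only [map_sum, map_smul, inner_sum, inner_smul_right, Matrix.mulVec, dotProduct, gramMatrix,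
    Matrix.of_apply, sub_mul, Finset.sum_sub_distrib]
  congr 1
  · exact Finset.sum_congr rfl fun j _ => mul_comm _ _
  · simp [Pi.single_apply]

theorem det_gramMatrix_eq_zero_iff {ξ : EuclideanSpace ℝ (Fin n)} :
    (gramMatrix B b ξ).det = 0 ↔
      ∃ c ≠ 0, (symbol B ξ).adjoint (symbol B ξ c) = (b : ℂ) • c := by
  rw [← Matrix.exists_mulVec_eq_zero_iff]
  constructor
  · rintro ⟨v, hv, h⟩
    refine ⟨WithLp.toLp 2 v, fun h0 => hv ?_, sub_eq_zero.1 ?_⟩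
    · simpa using congrArg WithLp.ofLp h0
    · have := gramMatrix_mulVec (B := B) (b := b) ξ (WithLp.toLp 2 v)
      rw [show (gramMatrix B b ξ).mulVec (WithLp.toLp 2 v).ofLp = 0 from h] at this
      ext i
      exact (congrFun this i).symm
  · rintro ⟨c, hc, h⟩
    refine ⟨c, fun h0 => hc ?_, ?_⟩
    · ext i
      exact congrFun h0 i
    · rw [gramMatrix_mulVec, h, sub_self]
      rfl

/-- The entries involve complex conjugates of the symbol, so analyticity is over `ℝ`; lines in
frequency space suffice for the identity theorem. -/
theorem analyticAt_det_gramMatrix (ξ θ : EuclideanSpace ℝ (Fin n)) (t₀ : ℝ) :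
    AnalyticAt ℝ (fun t : ℝ => (gramMatrix B b (ξ + t • θ)).det) t₀ := by
  have hof : AnalyticAt ℝ (fun t : ℝ => (t : ℂ)) t₀ := Complex.ofRealCLM.analyticAt t₀
  have hfreq : ∀ i, AnalyticAt ℝ (fun t : ℝ => freq (ξ + t • θ) i) t₀ := by
    intro i
    simp only [freq, PiLp.add_apply, PiLp.smul_apply, smul_eq_mul, Complex.ofReal_add,
      Complex.ofReal_mul]
    fun_prop
  have hcoord : ∀ j k, AnalyticAt ℝ
      (fun t : ℝ => symbol B (ξ + t • θ) (EuclideanSpace.single j 1) k) t₀ := by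
    intro j k
    have : ∀ t : ℝ, symbol B (ξ + t • θ) (EuclideanSpace.single j 1) k
        = ∑ α ∈ B.support, (∏ i, freq (ξ + t • θ) i ^ α i) *
          ((B α).toEuclideanLin (EuclideanSpace.single j 1)) k := by
      intro t
      rw [symbol_apply]
      simp [Finset.sum_apply]
    simp only [this]
    fun_prop
  have hentry : ∀ i j, AnalyticAt ℝ (fun t : ℝ => gramMatrix B b (ξ + t • θ) i j) t₀ := by
    intro i j
    have hconj : ∀ k, AnalyticAt ℝ (fun t : ℝ => (starRingEnd ℂ)
        (symbol B (ξ + t • θ) (EuclideanSpace.single i 1) k)) t₀ := fun k =>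
      (Complex.conjCLE.toContinuousLinearMap.analyticAt _).comp (hcoord i k)
    have : ∀ t : ℝ, gramMatrix B b (ξ + t • θ) i j =
        (∑ k, symbol B (ξ + t • θ) (EuclideanSpace.single j 1) k *
          (starRingEnd ℂ) (symbol B (ξ + t • θ) (EuclideanSpace.single i 1) k))
          - if i = j then (b : ℂ) else 0 := by
      intro t
      simp [gramMatrix, PiLp.inner_apply]
    simp only [this]
    have := fun k => hcoord j k
    fun_prop
  simp only [Matrix.det_apply']
  fun_prop

/-- Where `v ≠ 0` the determinant of `L(ξ)* L(ξ) - b` vanishes, by continuity on an interval of a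
line, hence on the whole line. But each zero of the determinant lies in the bounded set `lowSet`. -/
theorem eq_zero_of_symbol_eigenvector (hn : 1 ≤ n) (hbd : Bornology.IsBounded (lowSet B b))
    {v : EuclideanSpace ℝ (Fin n) → EuclideanSpace ℂ (Fin m)} (hv : Continuous v)
    (h : ∀ ξ, (symbol B ξ).adjoint (symbol B ξ (v ξ)) = (b : ℂ) • v ξ)
    (ξ : EuclideanSpace ℝ (Fin n)) : v ξ = 0 := by
  by_contra hne
  let θ : EuclideanSpace ℝ (Fin n) := EuclideanSpace.single ⟨0, hn⟩ 1
  have hθ : ‖θ‖ = 1 := by simp [θ]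
  have hev : (fun t : ℝ => (gramMatrix B b (ξ + t • θ)).det) =ᶠ[𝓝 0] 0 := by
    have hc : ContinuousAt (fun t : ℝ => v (ξ + t • θ)) 0 := by fun_prop
    have : ∀ᶠ t : ℝ in 𝓝 0, v (ξ + t • θ) ≠ 0 := hc.eventually_ne (by simpa using hne)
    filter_upwards [this] with t ht
    exact det_gramMatrix_eq_zero_iff.2 ⟨_, ht, h _⟩
  have hall := AnalyticOnNhd.eqOn_zero_of_preconnected_of_eventuallyEq_zero
    (fun t _ => analyticAt_det_gramMatrix (B := B) (b := b) ξ θ t) isPreconnected_univ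
    (Set.mem_univ (0 : ℝ)) hev
  obtain ⟨R, hR⟩ := hbd.exists_norm_le
  -- At this distance from `ξ` the norm of the point is at least `|R| + 1`, outside the bound for
  -- `lowSet`.
  obtain ⟨c, hc, hcb⟩ := det_gramMatrix_eq_zero_iff.1 (hall (Set.mem_univ (|R| + ‖ξ‖ + 1)))
  have hmem : ξ + (|R| + ‖ξ‖ + 1) • θ ∈ lowSet B b := by
    refine ⟨c, hc, le_of_eq ?_⟩
    have h1 := congrArg (inner ℂ c) hcb
    rw [ContinuousLinearMap.adjoint_inner_right, inner_smul_right, inner_self_eq_ofReal,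
      inner_self_eq_ofReal, ← Complex.ofReal_mul] at h1
    exact Complex.ofReal_injective h1
  have h1 := hR _ hmem
  have h2 : ‖(|R| + ‖ξ‖ + 1) • θ‖ = |R| + ‖ξ‖ + 1 := by
    rw [norm_smul, hθ, mul_one, Real.norm_eq_abs, abs_of_nonneg (by positivity)]
  have h3 := norm_sub_le (ξ + (|R| + ‖ξ‖ + 1) • θ) ξ
  rw [add_sub_cancel_left, h2] at h3
  linarith [le_abs_self R]

end LowSets

section WaveIndependence

variable {n : ℕ}

/-! ### Linear independence of plane waves -/

/-- The character `x ↦ exp (2πi⟨x, ξ⟩)`. -/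
def waveChar (ξ : EuclideanSpace ℝ (Fin n)) : Multiplicative (EuclideanSpace ℝ (Fin n)) →* ℂ where
  toFun x := Complex.exp (2 * Real.pi * Complex.I * (inner ℝ x.toAdd ξ : ℝ))
  map_one' := by simp
  map_mul' x y := by
    rw [← Complex.exp_add, toAdd_mul, inner_add_left]
    push_cast
    ring_nf

theorem waveChar_injective : Function.Injective (waveChar (n := n)) := by
  intro ξ η h
  by_contra hne
  have hδ : ‖ξ - η‖ ^ 2 ≠ 0 := by
    have : ξ - η ≠ 0 := sub_ne_zero.2 hne
    positivity
  -- Chosen so that `⟨x, ξ⟩` and `⟨x, η⟩` differ by `1/2`, which makes the two exponentials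
  -- opposite.
  set x : EuclideanSpace ℝ (Fin n) := (2 * ‖ξ - η‖ ^ 2)⁻¹ • (ξ - η) with hx
  have h1 : Complex.exp (2 * Real.pi * Complex.I * (inner ℝ x ξ : ℝ))
      = Complex.exp (2 * Real.pi * Complex.I * (inner ℝ x η : ℝ)) :=
    DFunLike.congr_fun h (Multiplicative.ofAdd x)
  have h2 : inner ℝ x ξ = inner ℝ x η + 1 / 2 := by
    have : inner ℝ x (ξ - η) = 1 / 2 := by
      rw [hx, real_inner_smul_left, real_inner_self_eq_norm_sq]
      rw [mul_inv, mul_assoc, inv_mul_cancel₀ hδ]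
      norm_num
    rw [inner_sub_right] at this
    linarith
  rw [h2] at h1
  push_cast at h1
  rw [mul_add, Complex.exp_add, show 2 * (Real.pi : ℂ) * Complex.I * (1 / 2)
    = Real.pi * Complex.I by ring, Complex.exp_pi_mul_I, mul_neg_one] at h1
  exact Complex.exp_ne_zero _ (self_eq_neg.1 h1.symm)

theorem analyticOnNhd_wave (ξ : EuclideanSpace ℝ (Fin n)) :
    AnalyticOnNhd ℝ (fun x : EuclideanSpace ℝ (Fin n) =>
      Complex.exp (2 * Real.pi * Complex.I * (inner ℝ x ξ : ℝ))) Set.univ := by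
  intro x _
  have h : AnalyticAt ℝ (fun x : EuclideanSpace ℝ (Fin n) => ((inner ℝ x ξ : ℝ) : ℂ)) x :=
    (Complex.ofRealCLM.comp ((innerSL ℝ).flip ξ)).analyticAt x
  have h' : AnalyticAt ℝ (fun x : EuclideanSpace ℝ (Fin n) =>
      2 * (Real.pi : ℂ) * Complex.I * ((inner ℝ x ξ : ℝ) : ℂ)) x := analyticAt_const.mul h
  exact (analyticAt_cexp.restrictScalars (𝕜 := ℝ)).comp h'

variable {d : ℕ} {Ω : Opens (EuclideanSpace ℝ (Fin n))}
  [IsFiniteMeasure (volume.restrict (Ω : Set (EuclideanSpace ℝ (Fin n))))]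

/-- A combination that is zero in `L₂(Ω)` vanishes on `Ω` by continuity and on `ℝⁿ` by analyticity.
In a coordinate `k` with `c ξ₀ k ≠ 0`, independence of distinct characters kills the coefficient of
`ξ₀`. -/
theorem linearIndependent_waveLp (hΩ : (Ω : Set (EuclideanSpace ℝ (Fin n))).Nonempty)
    {S : Set (EuclideanSpace ℝ (Fin n))} {c : S → EuclideanSpace ℂ (Fin d)} (hc : ∀ ξ, c ξ ≠ 0) :
    LinearIndependent ℂ fun ξ : S => waveLp Ω (ξ : EuclideanSpace ℝ (Fin n)) (c ξ) := by
  rw [linearIndependent_iff']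
  intro s g hg ξ₀ hξ₀
  have hae : (fun x => ∑ ξ ∈ s, g ξ • planeWave (ξ : EuclideanSpace ℝ (Fin n)) (c ξ) x)
      =ᵐ[volume.restrict (Ω : Set (EuclideanSpace ℝ (Fin n)))] fun _ => 0 := by
    have h1 : ∀ᵐ x ∂volume.restrict (Ω : Set (EuclideanSpace ℝ (Fin n))), ∀ ξ ∈ s,
        (g ξ • waveLp Ω (ξ : EuclideanSpace ℝ (Fin n)) (c ξ)) x
          = g ξ • planeWave (ξ : EuclideanSpace ℝ (Fin n)) (c ξ) x := by
      rw [Filter.eventually_all_finset]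
      intro ξ _
      filter_upwards [Lp.coeFn_smul (g ξ) (waveLp Ω (ξ : EuclideanSpace ℝ (Fin n)) (c ξ)),
        coeFn_waveLp (Ω := Ω) (ξ : EuclideanSpace ℝ (Fin n)) (c ξ)] with x h1 h2
      rw [h1, Pi.smul_apply, h2]
    have h2 := Lp.coeFn_finsetSum (p := 2)
      (μ := volume.restrict (Ω : Set (EuclideanSpace ℝ (Fin n)))) s
      (fun ξ => g ξ • waveLp Ω (ξ : EuclideanSpace ℝ (Fin n)) (c ξ))
    rw [hg] at h2
    filter_upwards [h1, h2, Lp.coeFn_zero (EuclideanSpace ℂ (Fin d)) 2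
      (volume.restrict (Ω : Set (EuclideanSpace ℝ (Fin n))))] with x hx1 hx2 hx3
    rw [← Finset.sum_congr rfl hx1, ← Finset.sum_apply, ← hx2, hx3]
    rfl
  have hon : Set.EqOn (fun x => ∑ ξ ∈ s, g ξ • planeWave (ξ : EuclideanSpace ℝ (Fin n)) (c ξ) x)
      (fun _ => 0) Ω := by
    refine Measure.eqOn_open_of_ae_eq hae Ω.isOpen ?_ continuousOn_const
    exact continuousOn_finsetSum _ fun ξ _ =>
      (((contDiff_planeWave (ξ : EuclideanSpace ℝ (Fin n)) (c ξ)).continuous).const_smul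
        (g ξ)).continuousOn
  obtain ⟨k, hk⟩ : ∃ k, c ξ₀ k ≠ 0 := by
    by_contra! h
    exact hc ξ₀ (by ext k; simpa using h k)
  let f : EuclideanSpace ℝ (Fin n) → ℂ := fun x => ∑ ξ ∈ s, (g ξ * c ξ k) *
    Complex.exp (2 * Real.pi * Complex.I * (inner ℝ x (ξ : EuclideanSpace ℝ (Fin n)) : ℝ))
  have hf : ∀ x ∈ Ω, f x = 0 := by
    intro x hx
    have h := congrArg (fun v : EuclideanSpace ℂ (Fin d) => v k) (hon hx)
    simp only [planeWave, WithLp.ofLp_sum, Finset.sum_apply, PiLp.smul_apply, smul_eq_mul,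
      PiLp.zero_apply] at h
    rw [← h]
    exact Finset.sum_congr rfl fun ξ _ => by ring
  have hfa : AnalyticOnNhd ℝ f Set.univ := by
    intro x hx
    have := fun ξ : S => analyticOnNhd_wave (ξ : EuclideanSpace ℝ (Fin n)) x hx
    simp only [f]
    fun_prop
  obtain ⟨x₀, hx₀⟩ := hΩ
  have hzero := hfa.eqOn_zero_of_preconnected_of_eventuallyEq_zero isPreconnected_univ
    (Set.mem_univ x₀) (Filter.eventuallyEq_of_mem (Ω.isOpen.mem_nhds hx₀) hf)
  have hli := (linearIndependent_monoidHom (Multiplicative (EuclideanSpace ℝ (Fin n))) ℂ).comp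
    (fun ξ : S => waveChar (ξ : EuclideanSpace ℝ (Fin n)))
    (waveChar_injective.comp Subtype.val_injective)
  have h0 := linearIndependent_iff'.1 hli s (fun ξ => g ξ * c ξ k) (by
    funext x
    have := hzero (Set.mem_univ x.toAdd)
    simpa [f, waveChar] using this) ξ₀ hξ₀
  exact (mul_eq_zero.1 h0).resolve_right hk

theorem exists_waveLp_notMem (hΩ : (Ω : Set (EuclideanSpace ℝ (Fin n))).Nonempty)
    {S : Set (EuclideanSpace ℝ (Fin n))} (hS : S.Infinite) {c : S → EuclideanSpace ℂ (Fin d)}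
    (hc : ∀ ξ, c ξ ≠ 0) (X : Submodule ℂ (L2 Ω d)) [FiniteDimensional ℂ X] :
    ∃ ξ : S, waveLp Ω (ξ : EuclideanSpace ℝ (Fin n)) (c ξ) ∉ X := by
  by_contra! h
  have hli := linearIndependent_waveLp hΩ hc
  have hli' : LinearIndependent ℂ
      fun ξ : S => (⟨waveLp Ω (ξ : EuclideanSpace ℝ (Fin n)) (c ξ), h ξ⟩ : X) :=
    LinearIndependent.of_comp X.subtype hli
  have : Finite S := hli'.finite
  exact hS (Set.toFinite S)

end WaveIndependence

/-! ### Finite volume: boundedness of the low frequencies and the overconstrained problem -/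

section FiniteVolumeBounds

variable {n m l : ℕ} {B : Coeffs n m l} {Ω : Opens (EuclideanSpace ℝ (Fin n))}
  [IsFiniteMeasure (volume.restrict (Ω : Set (EuclideanSpace ℝ (Fin n))))]

/-- Normalised plane waves at frequencies of `lowSet` tending to infinity are weakly null with form
at most `b`, which Weyl's criterion forbids. -/
theorem isBounded_lowSet (hB : FormClosable (smoothOp B Ω))
    (hΩ : (Ω : Set (EuclideanSpace ℝ (Fin n))).Nonempty) {b : ℝ} (hb0 : 0 ≤ b)
    (hb : (b : EReal) < essBottom (neumannOp B Ω)) : Bornology.IsBounded (lowSet B b) := by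
  by_contra hunb
  have hvol : 0 < volume.real (Ω : Set (EuclideanSpace ℝ (Fin n))) := by
    have h1 : volume (Ω : Set (EuclideanSpace ℝ (Fin n))) ≠ ⊤ := by
      have := measure_ne_top (volume.restrict (Ω : Set (EuclideanSpace ℝ (Fin n)))) Set.univ
      rwa [Measure.restrict_apply_univ] at this
    exact ENNReal.toReal_pos (Ω.isOpen.measure_pos volume hΩ).ne' h1
  set V := volume.real (Ω : Set (EuclideanSpace ℝ (Fin n))) with hV
  have hex : ∀ j : ℕ, ∃ ξ ∈ lowSet B b, (j : ℝ) < ‖ξ‖ := by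
    intro j
    by_contra! h
    exact hunb (isBounded_iff_forall_norm_le.2 ⟨j, h⟩)
  choose ξ hξ hξj using hex
  choose c hc hcb using fun j => (mem_lowSet_iff_unit B b).1 (hξ j)
  have htend : Tendsto ξ atTop (cocompact _) := by
    rw [← Metric.cobounded_eq_cocompact, ← comap_norm_atTop, tendsto_comap_iff]
    exact tendsto_atTop_mono (fun j => (hξj j).le) tendsto_natCast_atTop_atTop
  let a : ℂ := (((Real.sqrt V)⁻¹ : ℝ) : ℂ)
  have ha : V * ‖a‖ ^ 2 = 1 := by
    rw [Complex.norm_real, norm_inv, inv_pow, Real.norm_eq_abs, sq_abs, Real.sq_sqrt hvol.le,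
      mul_inv_cancel₀ hvol.ne']
  refine not_tendsto_of_lt_essBottom (T := (smoothOp B Ω).closure)
    hB.isClosable.closure_isClosed (dense_neumann_domain hB) hb0 hb
    (u := fun j => waveLp Ω (ξ j) (a • c j))
    (w := fun j => waveLp Ω (ξ j) (symbol B (ξ j) (a • c j)))
    (fun j => waveLp_mem_graph _ _) (fun j => ?_) (fun g => ?_) (fun ε hε => ?_)
  · have h := norm_waveLp_sq (Ω := Ω) (ξ j) (a • c j)
    rw [norm_smul, hc, mul_one, ha] at h
    exact (pow_eq_one_iff_of_nonneg (norm_nonneg _) two_ne_zero).1 h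
  · exact tendsto_inner_waveLp htend (C := ‖a‖) (fun j => by rw [norm_smul, hc, mul_one]) g
  · refine Frequently.of_forall fun j => ?_
    rw [norm_waveLp_sq, map_smul, norm_smul, mul_pow, ← mul_assoc, ha, one_mul]
    linarith [hcb j]

/-- Testing the Neumann equation with plane waves gives `L(ξ)* L(ξ) û(ξ) = b û(ξ)` for every `ξ`,
where `û` is continuous because `Ω` has finite volume. Hence `û = 0`. -/
theorem eq_zero_of_dirichlet_of_neumann (hB : FormClosable (smoothOp B Ω)) (hn : 1 ≤ n) {b : ℝ}
    (hbd : Bornology.IsBounded (lowSet B b)) {u : L2 Ω m} {w : L2 Ω l}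
    (huw : (u, w) ∈ ((smoothOp B Ω).domRestrict (testFunctions Ω m)).closure.graph)
    (hu : u ∈ eigenspace (neumannOp B Ω) b) : u = 0 := by
  obtain ⟨w', hw', h⟩ := mem_formGraph_iff.1
    ((mem_eigenspace_formOperator (dense_neumann_domain hB)).1 hu)
  have hww : w' = w := LinearPMap.mem_graph_snd_inj _ hw'
    (LinearPMap.le_graph_of_le (dirichlet_le_neumann hB) huw) rfl
  subst hww
  refine eq_zero_of_ft_eq_zero (eq_zero_of_symbol_eigenvector hn hbd (continuous_ft u) fun ξ => ?_)
  refine ext_inner_left ℂ fun c => ?_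
  have h1 := h _ _ (waveLp_mem_graph (B := B) (Ω := Ω) ξ c)
  rw [inner_smul_right, inner_waveLp, inner_waveLp_dirichlet hB huw] at h1
  rw [ContinuousLinearMap.adjoint_inner_right, inner_smul_right, h1]

end FiniteVolumeBounds

section Cutoff

variable {n m l : ℕ} {F : Type*} [NormedAddCommGroup F] [NormedSpace ℂ F]

/-! ### Slowly truncated plane waves -/

/-- The truncated plane wave `φ(s x) exp (2πi⟨x, ξ⟩) c`. -/
def cutWave (φ : EuclideanSpace ℝ (Fin n) → ℂ) (s : ℝ) (ξ : EuclideanSpace ℝ (Fin n)) (c : F) :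
    EuclideanSpace ℝ (Fin n) → F :=
  fun x => φ (s • x) • planeWave ξ c x

theorem contDiff_cutWave {φ : EuclideanSpace ℝ (Fin n) → ℂ} (hφ : ContDiff ℝ ∞ φ) (s : ℝ)
    (ξ : EuclideanSpace ℝ (Fin n)) (c : F) : ContDiff ℝ ∞ (cutWave φ s ξ c) :=
  (hφ.comp (contDiff_id.const_smul s)).smul (contDiff_planeWave ξ c)

theorem norm_cutWave (φ : EuclideanSpace ℝ (Fin n) → ℂ) (s : ℝ) (ξ : EuclideanSpace ℝ (Fin n))
    (c : F) (x : EuclideanSpace ℝ (Fin n)) : ‖cutWave φ s ξ c x‖ = ‖φ (s • x)‖ * ‖c‖ := by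
  rw [cutWave, norm_smul, norm_planeWave]

theorem pderiv_cutWave {φ : EuclideanSpace ℝ (Fin n) → ℂ} (hφ : ContDiff ℝ ∞ φ) (s : ℝ)
    (ξ : EuclideanSpace ℝ (Fin n)) (c : F) (i : Fin n) :
    pderiv i (cutWave φ s ξ c)
      = freq ξ i • cutWave φ s ξ c + (s : ℂ) • cutWave (pderiv i φ) s ξ c := by
  funext x
  have h1 : HasFDerivAt (fun x => φ (s • x)) ((fderiv ℝ φ (s • x)).comp
      (s • ContinuousLinearMap.id ℝ (EuclideanSpace ℝ (Fin n)))) x :=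
    ((hφ.differentiable (by simp)) (s • x)).hasFDerivAt.comp x ((hasFDerivAt_id x).const_smul s)
  have h2 := ((contDiff_planeWave ξ c).differentiable (by simp) x).hasFDerivAt
  have h3 : fderiv ℝ (planeWave ξ c) x (EuclideanSpace.single i 1)
      = freq ξ i • planeWave ξ c x := by
    have := congrFun (pderiv_planeWave ξ c i) x
    rw [pderiv] at this
    rw [this, planeWave, planeWave, smul_comm]
  have h4 : fderiv ℝ (cutWave φ s ξ c) x = _ := (h1.smul h2).fderiv
  rw [pderiv, h4]
  simp only [_root_.add_apply, _root_.smul_apply, ContinuousLinearMap.smulRight_apply, h3,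
    ContinuousLinearMap.comp_apply, ContinuousLinearMap.id_apply, map_smul, Pi.add_apply,
    Pi.smul_apply, cutWave, pderiv]
  rw [smul_comm (φ (s • x)), ← Complex.coe_smul, smul_eq_mul, mul_smul]

theorem pderiv_add {f g : EuclideanSpace ℝ (Fin n) → F} (hf : ContDiff ℝ ∞ f)
    (hg : ContDiff ℝ ∞ g) (i : Fin n) : pderiv i (f + g) = pderiv i f + pderiv i g := by
  funext x
  simp [pderiv, fderiv_add (hf.differentiable (by simp) x) (hg.differentiable (by simp) x)]

theorem pderiv_smul (a : ℂ) {f : EuclideanSpace ℝ (Fin n) → F} (hf : ContDiff ℝ ∞ f) (i : Fin n) :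
    pderiv i (a • f) = a • pderiv i f := by
  funext x
  simp [pderiv, fderiv_const_smul (hf.differentiable (by simp) x)]

theorem contDiff_pderiv {f : EuclideanSpace ℝ (Fin n) → F} (hf : ContDiff ℝ ∞ f) (i : Fin n) :
    ContDiff ℝ ∞ (pderiv i f) :=
  (hf.fderiv_right (m := ∞) (by simp)).clm_apply contDiff_const

theorem IsTest.exists_bound {f : EuclideanSpace ℝ (Fin n) → F} (hf : IsTest f) :
    ∃ C, 0 ≤ C ∧ ∀ x, ‖f x‖ ≤ C := by
  obtain ⟨C, hC⟩ := hf.1.continuous.bounded_above_of_compact_support hf.2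
  exact ⟨max C 0, le_max_right _ _, fun x => (hC x).trans (le_max_left _ _)⟩

/-- Derivatives act on slowly truncated plane waves as on plane waves, up to a small error. -/
theorem multiDeriv_cutWave (α : Fin n →₀ ℕ) (ξ : EuclideanSpace ℝ (Fin n)) (c : F)
    {φ : EuclideanSpace ℝ (Fin n) → ℂ} (hφ : IsTest φ) :
    ∃ C, 0 ≤ C ∧ ∀ s : ℝ, 0 ≤ s → s ≤ 1 → ∀ x, ‖multiDeriv α (cutWave φ s ξ c) x
      - (∏ i, freq ξ i ^ α i) • cutWave φ s ξ c x‖ ≤ C * s := by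
  -- A derivative of a truncated wave is a sum of two truncated waves, one with cutoff `∂_i φ`. The
  -- induction therefore carries linearity of `D` and the bound for all cutoffs at once.
  have key := multiDeriv_induction (F := F) (q := freq ξ)
    (P := fun D z => (∀ f g, ContDiff ℝ ∞ f → ContDiff ℝ ∞ g → D (f + g) = D f + D g) ∧
      (∀ (a : ℂ) f, ContDiff ℝ ∞ f → D (a • f) = a • D f) ∧
      ∀ φ : EuclideanSpace ℝ (Fin n) → ℂ, IsTest φ → ∃ C, 0 ≤ C ∧
        ∀ s : ℝ, 0 ≤ s → s ≤ 1 → ∀ x, ‖D (cutWave φ s ξ c) x - z • cutWave φ s ξ c x‖ ≤ C * s)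
    ⟨fun _ _ _ _ => rfl, fun _ _ _ => rfl, fun φ _ => ⟨0, le_rfl, by simp⟩⟩ ?_ α
  · exact key.2.2 φ hφ
  rintro i D z ⟨hadd, hsmul, hbound⟩
  refine ⟨fun f g hf hg => ?_, fun a f hf => ?_, fun φ hφ => ?_⟩
  · simp only [pderiv_add hf hg, hadd _ _ (contDiff_pderiv hf i) (contDiff_pderiv hg i)]
  · simp only [pderiv_smul a hf, hsmul _ _ (contDiff_pderiv hf i)]
  obtain ⟨C, hC0, hC⟩ := hbound φ hφ
  obtain ⟨C', hC0', hC'⟩ := hbound _ (hφ.pderiv i)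
  obtain ⟨M, hM0, hM⟩ := (hφ.pderiv i).exists_bound
  refine ⟨‖freq ξ i‖ * C + (C' + ‖z‖ * (M * ‖c‖)), by positivity, fun s hs0 hs1 x => ?_⟩
  have hsm1 := contDiff_cutWave (n := n) hφ.1 s ξ c
  have hsm2 := contDiff_cutWave (n := n) (hφ.pderiv i).1 s ξ c
  simp only [pderiv_cutWave hφ.1]
  rw [hadd (freq ξ i • cutWave φ s ξ c) ((s : ℂ) • cutWave (pderiv i φ) s ξ c)
    (hsm1.const_smul _) (hsm2.const_smul _), hsmul _ _ hsm1, hsmul _ _ hsm2]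
  have e : (freq ξ i • D (cutWave φ s ξ c) + (s : ℂ) • D (cutWave (pderiv i φ) s ξ c)) x
      - (z * freq ξ i) • cutWave φ s ξ c x
      = freq ξ i • (D (cutWave φ s ξ c) x - z • cutWave φ s ξ c x)
        + (s : ℂ) • ((D (cutWave (pderiv i φ) s ξ c) x - z • cutWave (pderiv i φ) s ξ c x)
          + z • cutWave (pderiv i φ) s ξ c x) := by
    simp only [Pi.add_apply, Pi.smul_apply]
    module
  rw [e]
  have b1 : ‖z • cutWave (pderiv i φ) s ξ c x‖ ≤ ‖z‖ * (M * ‖c‖) := by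
    rw [norm_smul, norm_cutWave]
    gcongr
    exact hM _
  have b2 : C' * s ≤ C' := mul_le_of_le_one_right hC0' hs1
  calc _ ≤ ‖freq ξ i‖ * (C * s) + s * (C' * s + ‖z‖ * (M * ‖c‖)) := by
        refine (norm_add_le _ _).trans (add_le_add ?_ ?_)
        · rw [norm_smul]
          exact mul_le_mul_of_nonneg_left (hC s hs0 hs1 x) (norm_nonneg _)
        · rw [norm_smul, Complex.norm_real, Real.norm_of_nonneg hs0]
          exact mul_le_mul_of_nonneg_left
            ((norm_add_le _ _).trans (add_le_add (hC' s hs0 hs1 x) b1)) hs0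
    _ ≤ ‖freq ξ i‖ * (C * s) + s * (C' + ‖z‖ * (M * ‖c‖)) := by gcongr
    _ = _ := by ring

theorem applyOp_cutWave (B : Coeffs n m l) (ξ : EuclideanSpace ℝ (Fin n))
    (c : EuclideanSpace ℂ (Fin m)) {φ : EuclideanSpace ℝ (Fin n) → ℂ} (hφ : IsTest φ) :
    ∃ C, 0 ≤ C ∧ ∀ s : ℝ, 0 ≤ s → s ≤ 1 → ∀ x,
      ‖applyOp B (cutWave φ s ξ c) x - symbol B ξ (cutWave φ s ξ c x)‖ ≤ C * s := by
  choose C hC0 hC using fun α => multiDeriv_cutWave (n := n) α ξ c hφ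
  refine ⟨∑ α ∈ B.support, ‖(B α).toEuclideanLin.toContinuousLinearMap‖ * C α,
    Finset.sum_nonneg fun α _ => mul_nonneg (norm_nonneg _) (hC0 α), fun s hs0 hs1 x => ?_⟩
  rw [applyOp, symbol_apply, ← Finset.sum_sub_distrib, Finset.sum_mul]
  refine norm_sum_le_of_le _ fun α _ => ?_
  rw [← map_sub, mul_assoc]
  exact ((B α).toEuclideanLin.toContinuousLinearMap.le_opNorm _).trans
    (mul_le_mul_of_nonneg_left (hC α s hs0 hs1 x) (norm_nonneg _))

end Cutoff

/-- A sequence of polynomial growth is doubling infinitely often. -/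
theorem frequently_doubling {a : ℕ → ℝ} {κ q : ℝ} (hq : 0 < q) (ha : ∀ j, a j ≤ κ * q ^ j)
    (hpos : ∀ᶠ j in atTop, 0 < a j) : ∃ᶠ j in atTop, a (j + 1) ≤ 2 * q * a j := by
  rw [Filter.Frequently]
  intro h
  obtain ⟨N, hN⟩ := eventually_atTop.1 (h.and hpos)
  -- Without doubling beyond `N` the sequence grows at least like `(2q)^i`, against the bound `κ
  -- q^(N+i)`.
  have hgrow : ∀ i, (2 * q) ^ i * a N ≤ a (N + i) := by
    intro i
    induction i with
    | zero => simp
    | succ i ih =>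
      have h1 := (not_le.1 (hN (N + i) (by lia)).1).le
      calc _ = 2 * q * ((2 * q) ^ i * a N) := by ring
        _ ≤ 2 * q * a (N + i) := by gcongr
        _ ≤ _ := h1
  have hbd : ∀ i, (2 : ℝ) ^ i ≤ κ * q ^ N / a N := by
    intro i
    have haN := (hN N le_rfl).2
    rw [le_div_iff₀ haN]
    have h1 := (hgrow i).trans (ha (N + i))
    have hqi : 0 < q ^ i := pow_pos hq i
    rw [mul_pow, pow_add] at h1
    nlinarith
  obtain ⟨i, hi⟩ := pow_unbounded_of_one_lt (κ * q ^ N / a N) (one_lt_two : (1 : ℝ) < 2)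
  exact (hbd i).not_gt hi

theorem tendsto_inner_of_dense {H : Type*} [NormedAddCommGroup H] [InnerProductSpace ℂ H]
    {S : Set H} (hS : Dense S) {u : ℕ → H} (hu : ∀ j, ‖u j‖ = 1)
    (h : ∀ g ∈ S, Tendsto (fun j => inner ℂ g (u j)) atTop (𝓝 0)) (g : H) :
    Tendsto (fun j => inner ℂ g (u j)) atTop (𝓝 0) := by
  rw [Metric.tendsto_atTop]
  intro ε hε
  obtain ⟨g', hg', hd⟩ := hS.exists_dist_lt g (half_pos hε)
  obtain ⟨N, hN⟩ := Metric.tendsto_atTop.1 (h g' hg') (ε / 2) (half_pos hε)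
  refine ⟨N, fun j hj => ?_⟩
  have h1 := hN j hj
  rw [dist_zero_right] at h1 ⊢
  have h2 : ‖inner ℂ (g - g') (u j)‖ ≤ ‖g - g'‖ := by
    have := norm_inner_le_norm (𝕜 := ℂ) (g - g') (u j)
    rwa [hu j, mul_one] at this
  rw [dist_eq_norm] at hd
  have h3 : inner ℂ g (u j) = inner ℂ (g - g') (u j) + inner ℂ g' (u j) := by
    rw [inner_sub_left, sub_add_cancel]
  rw [h3]
  linarith [norm_add_le (inner ℂ (g - g') (u j)) (inner ℂ g' (u j))]

/-- Weyl's criterion for sequences that are not normalised. -/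
theorem false_of_tendsto_norm_atTop {H K : Type*} [NormedAddCommGroup H] [InnerProductSpace ℂ H]
    [CompleteSpace H] [NormedAddCommGroup K] [InnerProductSpace ℂ K] [CompleteSpace K]
    {T : H →ₗ.[ℂ] K} (hTc : T.IsClosed) (hT : Dense (T.domain : Set H)) {b : ℝ} (hb0 : 0 ≤ b)
    (hb : (b : EReal) < essBottom (formOperator T)) {v : ℕ → H} {w : ℕ → K}
    (hvw : ∀ j, (v j, w j) ∈ T.graph) (hlim : Tendsto (fun j => ‖v j‖) atTop atTop)
    {S : Set H} (hS : Dense S) (hbd : ∀ g ∈ S, ∃ M, ∀ j, ‖inner ℂ g (v j)‖ ≤ M)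
    (hle : ∀ ε > 0, ∃ᶠ j in atTop, ‖w j‖ ^ 2 ≤ (b + ε) * ‖v j‖ ^ 2) : False := by
  obtain ⟨N, hN⟩ := eventually_atTop.1 (hlim.eventually (eventually_gt_atTop 0))
  have hpos : ∀ j, 0 < ‖v (j + N)‖ := fun j => hN _ (by lia)
  have hnorm : ∀ j, ‖((‖v (j + N)‖⁻¹ : ℝ) : ℂ) • v (j + N)‖ = 1 := fun j => by
    rw [norm_smul, Complex.norm_real, norm_inv, norm_norm, inv_mul_cancel₀ (hpos j).ne']
  refine not_tendsto_of_lt_essBottom hTc hT hb0 hb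
    (u := fun j => ((‖v (j + N)‖⁻¹ : ℝ) : ℂ) • v (j + N))
    (w := fun j => ((‖v (j + N)‖⁻¹ : ℝ) : ℂ) • w (j + N))
    (fun j => Submodule.smul_mem _ _ (hvw _)) hnorm
    (tendsto_inner_of_dense hS hnorm fun g hg => ?_) fun ε hε => ?_
  -- The products with `g` stay bounded while the norms `‖v j‖` tend to infinity, so the normalised
  -- sequence is weakly null.
  · obtain ⟨M, hM⟩ := hbd g hg
    have h1 : Tendsto (fun j => ‖v (j + N)‖⁻¹ * M) atTop (𝓝 0) := by
      have := (tendsto_inv_atTop_zero.comp (hlim.comp (tendsto_add_atTop_nat N))).mul_const M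
      rwa [zero_mul] at this
    refine squeeze_zero_norm (fun j => ?_) h1
    rw [inner_smul_right, norm_mul, Complex.norm_real, norm_inv, norm_norm]
    exact mul_le_mul_of_nonneg_left (hM _) (inv_nonneg.2 (norm_nonneg _))
  · have hfreq := hle ε hε
    rw [frequently_atTop] at hfreq ⊢
    intro M
    obtain ⟨i, hi, hi'⟩ := hfreq (M + N)
    refine ⟨i - N, by lia, ?_⟩
    have hp := hpos (i - N)
    rw [Nat.sub_add_cancel (by lia : N ≤ i)] at hp ⊢
    rw [norm_smul, Complex.norm_real, norm_inv, norm_norm, mul_pow, inv_pow,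
      inv_mul_le_iff₀ (pow_pos hp 2), mul_comm]
    exact hi'

theorem norm_sq_toLp {E F : Type*} [MeasurableSpace E] {μ : Measure E}
    [NormedAddCommGroup F] [InnerProductSpace ℂ F] {f : E → F} (hf : MemLp f 2 μ) :
    ‖hf.toLp f‖ ^ 2 = ∫ x, ‖f x‖ ^ 2 ∂μ := by
  rw [(norm_sq_eq_integral _).2]
  refine integral_congr_ae ?_
  filter_upwards [hf.coeFn_toLp] with x hx
  rw [hx]

section InfiniteVolume

variable {n m l : ℕ} {B : Coeffs n m l} {Ω : Opens (EuclideanSpace ℝ (Fin n))}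

/-! ### Domains of infinite volume -/

theorem exists_cutoff (n : ℕ) : ∃ φ : EuclideanSpace ℝ (Fin n) → ℂ, IsTest φ ∧
    (∀ x, ‖φ x‖ ≤ 1) ∧ (∀ x, ‖x‖ ≤ 1 → φ x = 1) ∧ ∀ x, 2 < ‖x‖ → φ x = 0 := by
  let ψ : ContDiffBump (0 : EuclideanSpace ℝ (Fin n)) := ⟨1, 2, one_pos, one_lt_two⟩
  refine ⟨fun x => (ψ x : ℂ), ⟨Complex.ofRealCLM.contDiff.comp ψ.contDiff,
    ψ.hasCompactSupport.comp_left (g := Complex.ofReal) (by simp)⟩, fun x => ?_, fun x hx => ?_,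
    fun x hx => ?_⟩
  · rw [Complex.norm_real, Real.norm_of_nonneg ψ.nonneg]
    exact ψ.le_one
  · simp only
    rw [ψ.one_of_mem_closedBall (by simpa [ψ] using hx), Complex.ofReal_one]
  · simp only
    rw [ψ.zero_of_le_dist (by simpa [ψ] using hx.le), Complex.ofReal_zero]

theorem cutWave_eq_zero {φ : EuclideanSpace ℝ (Fin n) → ℂ} (h0 : ∀ x, 2 < ‖x‖ → φ x = 0) {s : ℝ}
    (hs : 0 < s) (ξ : EuclideanSpace ℝ (Fin n)) (c : EuclideanSpace ℂ (Fin m))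
    {x : EuclideanSpace ℝ (Fin n)} (hx : x ∉ Metric.closedBall 0 (2 / s)) :
    cutWave φ s ξ c x = 0 := by
  rw [mem_closedBall_zero_iff, not_le, div_lt_iff₀ hs] at hx
  rw [cutWave, h0, zero_smul]
  rwa [norm_smul, Real.norm_of_nonneg hs.le, mul_comm]

theorem isTest_cutWave {φ : EuclideanSpace ℝ (Fin n) → ℂ} (hφ : IsTest φ)
    (h0 : ∀ x, 2 < ‖x‖ → φ x = 0) {s : ℝ}
    (hs : 0 < s) (ξ : EuclideanSpace ℝ (Fin n)) (c : EuclideanSpace ℂ (Fin m)) :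
    IsTest (cutWave φ s ξ c) ∧ tsupport (cutWave φ s ξ c) ⊆ Metric.closedBall 0 (2 / s) :=
  ⟨⟨contDiff_cutWave hφ.1 s ξ c, HasCompactSupport.intro (isCompact_closedBall 0 (2 / s))
    fun _ hx => cutWave_eq_zero h0 hs ξ c hx⟩,
    closure_minimal (fun _ hx => by_contra fun h => hx (cutWave_eq_zero h0 hs ξ c h))
      Metric.isClosed_closedBall⟩

/-- The volume of the part of `Ω` in a ball. -/
def ballVolume (Ω : Opens (EuclideanSpace ℝ (Fin n))) (r : ℝ) : ℝ :=
  (volume.restrict (Ω : Set (EuclideanSpace ℝ (Fin n)))).real (Metric.closedBall 0 r)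

theorem restrict_closedBall_ne_top (r : ℝ) :
    volume.restrict (Ω : Set (EuclideanSpace ℝ (Fin n))) (Metric.closedBall 0 r) ≠ ⊤ :=
  ((Measure.restrict_apply_le _ _).trans_lt measure_closedBall_lt_top).ne

theorem ballVolume_two_pow_le (Ω : Opens (EuclideanSpace ℝ (Fin n))) (j : ℕ) :
    ballVolume Ω (2 ^ j) ≤
      volume.real (Metric.closedBall (0 : EuclideanSpace ℝ (Fin n)) 1) * (2 ^ n) ^ j := by
  have h1 : ballVolume Ω (2 ^ j) ≤
      volume.real (Metric.closedBall (0 : EuclideanSpace ℝ (Fin n)) (2 ^ j)) :=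
    ENNReal.toReal_mono measure_closedBall_lt_top.ne (Measure.restrict_apply_le _ _)
  refine h1.trans (le_of_eq ?_)
  rw [measureReal_def, Measure.addHaar_closedBall' _ _ (by positivity), ENNReal.toReal_mul,
    ENNReal.toReal_ofReal (by positivity), finrank_euclideanSpace_fin, ← pow_mul, ← pow_mul,
    mul_comm j n, mul_comm, measureReal_def]

theorem tendsto_ballVolume (hΩ : volume (Ω : Set (EuclideanSpace ℝ (Fin n))) = ⊤) :
    Tendsto (fun j : ℕ => ballVolume Ω (2 ^ j)) atTop atTop := by
  have hmono : Monotone fun j : ℕ => Metric.closedBall (0 : EuclideanSpace ℝ (Fin n)) (2 ^ j) :=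
    fun i j hij => Metric.closedBall_subset_closedBall (pow_le_pow_right₀ one_le_two hij)
  have h1 := tendsto_measure_iUnion_atTop
    (μ := volume.restrict (Ω : Set (EuclideanSpace ℝ (Fin n)))) hmono
  have hU : (⋃ j : ℕ, Metric.closedBall (0 : EuclideanSpace ℝ (Fin n)) (2 ^ j)) = Set.univ := by
    refine Set.eq_univ_of_forall fun x => Set.mem_iUnion.2 ?_
    obtain ⟨j, hj⟩ := pow_unbounded_of_one_lt ‖x‖ (one_lt_two : (1 : ℝ) < 2)
    exact ⟨j, by simpa using hj.le⟩
  rw [hU, Measure.restrict_apply_univ, hΩ] at h1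
  rw [tendsto_atTop]
  intro C
  filter_upwards [h1.eventually (lt_mem_nhds ENNReal.ofReal_lt_top (a := ENNReal.ofReal C))]
    with j hj
  exact (ENNReal.ofReal_le_iff_le_toReal (restrict_closedBall_ne_top _)).1 hj.le

variable {φ : EuclideanSpace ℝ (Fin n) → ℂ}

theorem ballVolume_le_norm_sq (hone : ∀ x, ‖x‖ ≤ 1 → φ x = 1) {s : ℝ} (hs : 0 < s)
    (ξ : EuclideanSpace ℝ (Fin n)) {c : EuclideanSpace ℂ (Fin m)} (hc : ‖c‖ = 1)
    (hf : MemLp (cutWave φ s ξ c) 2 (volume.restrict (Ω : Set (EuclideanSpace ℝ (Fin n))))) :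
    ballVolume Ω (1 / s) ≤ ‖hf.toLp _‖ ^ 2 := by
  rw [norm_sq_toLp, ballVolume, ← integral_indicator_one measurableSet_closedBall]
  refine integral_mono ((integrable_indicator_iff measurableSet_closedBall).2
    (integrableOn_const (restrict_closedBall_ne_top _)))
    ((memLp_two_iff_integrable_sq_norm hf.1).1 hf) fun x => ?_
  by_cases hx : x ∈ Metric.closedBall (0 : EuclideanSpace ℝ (Fin n)) (1 / s)
  · rw [Set.indicator_of_mem hx, norm_cutWave, hone, hc]
    · simp
    · rw [mem_closedBall_zero_iff, le_div_iff₀ hs] at hx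
      rwa [norm_smul, Real.norm_of_nonneg hs.le, mul_comm]
  · rw [Set.indicator_of_notMem hx]
    positivity

/-- Pointwise, `(‖p‖ + C s)² ≤ (1 + s) ‖p‖² + 2 C² s` for `0 ≤ s ≤ 1`. The error is integrated over
the ball of radius `2 / s` that supports the truncated wave. -/
theorem exists_norm_sq_applyOp_le (hφ : IsTest φ) (h0 : ∀ x, 2 < ‖x‖ → φ x = 0) {b : ℝ}
    (hb0 : 0 ≤ b) (ξ : EuclideanSpace ℝ (Fin n))
    {c : EuclideanSpace ℂ (Fin m)} (hb : ‖symbol B ξ c‖ ^ 2 ≤ b * ‖c‖ ^ 2) :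
    ∃ C, ∀ s : ℝ, 0 < s → s ≤ 1 →
      ∀ (hf : MemLp (cutWave φ s ξ c) 2 (volume.restrict (Ω : Set (EuclideanSpace ℝ (Fin n)))))
        (hLf : MemLp (applyOp B (cutWave φ s ξ c)) 2
          (volume.restrict (Ω : Set (EuclideanSpace ℝ (Fin n))))),
        ‖hLf.toLp _‖ ^ 2 ≤ (1 + s) * b * ‖hf.toLp _‖ ^ 2 + C * s * ballVolume Ω (2 / s) := by
  obtain ⟨C, hC0, hC⟩ := applyOp_cutWave B ξ c hφ
  refine ⟨2 * C ^ 2, fun s hs0 hs1 hf hLf => ?_⟩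
  rw [norm_sq_toLp, norm_sq_toLp, ballVolume, ← integral_indicator_one measurableSet_closedBall,
    ← integral_const_mul, ← integral_const_mul]
  have i1 := (memLp_two_iff_integrable_sq_norm hf.1).1 hf
  have i2 : Integrable ((Metric.closedBall (0 : EuclideanSpace ℝ (Fin n)) (2 / s)).indicator
      (1 : EuclideanSpace ℝ (Fin n) → ℝ)) (volume.restrict (Ω : Set (EuclideanSpace ℝ (Fin n)))) :=
    (integrable_indicator_iff measurableSet_closedBall).2
      (integrableOn_const (restrict_closedBall_ne_top _))
  rw [← integral_add (i1.const_mul _) (i2.const_mul _)]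
  refine integral_mono ((memLp_two_iff_integrable_sq_norm hLf.1).1 hLf)
    ((i1.const_mul _).add (i2.const_mul _)) fun x => ?_
  obtain ⟨ht, hsupp⟩ := isTest_cutWave hφ h0 hs0 ξ c
  by_cases hx : x ∈ Metric.closedBall (0 : EuclideanSpace ℝ (Fin n)) (2 / s)
  · simp only [Set.indicator_of_mem hx, Pi.one_apply, mul_one]
    have e1 := hC s hs0.le hs1 x
    set p := symbol B ξ (cutWave φ s ξ c x) with hp
    have e2 : ‖p‖ ^ 2 ≤ b * ‖cutWave φ s ξ c x‖ ^ 2 := by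
      rw [hp, norm_cutWave, cutWave, map_smul, planeWave, map_smul, norm_smul, norm_smul, mul_pow,
        mul_pow, mul_pow]
      -- `z` stands for the modulus of the exponential factor.
      have e : ∀ z : ℝ, z = 1 → ‖φ (s • x)‖ ^ 2 * (z ^ 2 * ‖symbol B ξ c‖ ^ 2)
          ≤ b * (‖φ (s • x)‖ ^ 2 * ‖c‖ ^ 2) := by
        rintro _ rfl
        nlinarith [mul_le_mul_of_nonneg_left hb (sq_nonneg ‖φ (s • x)‖)]
      refine e _ ?_
      have := norm_planeWave ξ (1 : ℂ) x
      rw [planeWave, norm_smul] at this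
      simpa using this
    have e3 : ‖applyOp B (cutWave φ s ξ c) x‖ ≤ ‖p‖ + C * s := by
      have := norm_add_le (applyOp B (cutWave φ s ξ c) x - p) p
      rw [sub_add_cancel] at this
      linarith
    have e4 : ‖applyOp B (cutWave φ s ξ c) x‖ ^ 2 ≤ (‖p‖ + C * s) ^ 2 :=
      pow_le_pow_left₀ (norm_nonneg _) e3 2
    have e5 : (‖p‖ + C * s) ^ 2 ≤ (1 + s) * ‖p‖ ^ 2 + 2 * C ^ 2 * s := by
      have h1 : 0 ≤ s * (‖p‖ - C) ^ 2 := by positivity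
      have h2 : 0 ≤ C ^ 2 * s * (1 - s) := mul_nonneg (by positivity) (by linarith)
      nlinarith
    have e6 : (1 + s) * ‖p‖ ^ 2 ≤ (1 + s) * (b * ‖cutWave φ s ξ c x‖ ^ 2) := by gcongr
    linarith
  · have hz : applyOp B (cutWave φ s ξ c) x = 0 :=
      image_eq_zero_of_notMem_tsupport fun h => hx (hsupp ((applyOp_test B ht).2.1 h))
    simp only [Set.indicator_of_notMem hx, hz]
    rw [mul_zero, add_zero, norm_zero, zero_pow two_ne_zero]
    positivity

theorem norm_inner_cutWave_le (hle : ∀ x, ‖φ x‖ ≤ 1) (s : ℝ) (ξ : EuclideanSpace ℝ (Fin n))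
    {c : EuclideanSpace ℂ (Fin m)} (hc : ‖c‖ = 1)
    (hf : MemLp (cutWave φ s ξ c) 2 (volume.restrict (Ω : Set (EuclideanSpace ℝ (Fin n)))))
    {g : L2 Ω m} (hg : Integrable g (volume.restrict (Ω : Set (EuclideanSpace ℝ (Fin n))))) :
    ‖inner ℂ g (hf.toLp _)‖ ≤
      ∫ x, ‖g x‖ ∂(volume.restrict (Ω : Set (EuclideanSpace ℝ (Fin n)))) := by
  rw [L2.inner_def]
  refine norm_integral_le_of_norm_le hg.norm ?_
  filter_upwards [hf.coeFn_toLp] with x hx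
  refine (norm_inner_le_norm _ _).trans (mul_le_of_le_one_right (norm_nonneg _) ?_)
  rw [hx, norm_cutWave, hc, mul_one]
  exact hle _

/-- In a domain of infinite volume all eigenvalues of `L(ξ)^* L(ξ)` lie above `b`, if `b` is below
the essential spectrum of the Neumann realization. -/
theorem lowSet_eq_empty_of_volume_eq_top (hB : FormClosable (smoothOp B Ω))
    (hΩ : volume (Ω : Set (EuclideanSpace ℝ (Fin n))) = ⊤) {b : ℝ} (hb0 : 0 ≤ b)
    (hb : (b : EReal) < essBottom (neumannOp B Ω)) : lowSet B b = ∅ := by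
  refine Set.eq_empty_of_forall_notMem fun ξ hξ => ?_
  obtain ⟨c, hc, hcb⟩ := (mem_lowSet_iff_unit B b).1 hξ
  obtain ⟨φ, hφ, hle, hone, h0⟩ := exists_cutoff n
  have hvol := tendsto_ballVolume hΩ
  have hpos := hvol.eventually (eventually_gt_atTop 0)
  let s : ℕ → ℝ := fun j => (1 / 2) ^ j
  have hs0 : ∀ j, 0 < s j := fun j => by positivity
  have hs1 : ∀ j, s j ≤ 1 := fun j => pow_le_one₀ (by norm_num) (by norm_num)
  have hsinv : ∀ j, 1 / s j = 2 ^ j := fun j => by simp [s]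
  have hsinv' : ∀ j, 2 / s j = 2 ^ (j + 1) := fun j => by
    rw [pow_succ, ← hsinv]; ring
  have hslim : Tendsto s atTop (𝓝 0) :=
    tendsto_pow_atTop_nhds_zero_of_lt_one (by norm_num) (by norm_num)
  have ht : ∀ j, IsTest (cutWave φ (s j) ξ c) := fun j => (isTest_cutWave hφ h0 (hs0 j) ξ c).1
  let hf : ∀ j, MemLp (cutWave φ (s j) ξ c) 2
    (volume.restrict (Ω : Set (EuclideanSpace ℝ (Fin n)))) := fun j => (ht j).memLp.restrict _
  let hLf : ∀ j, MemLp (applyOp B (cutWave φ (s j) ξ c)) 2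
    (volume.restrict (Ω : Set (EuclideanSpace ℝ (Fin n)))) :=
      fun j => (applyOp_test B (ht j)).1.memLp.restrict _
  obtain ⟨v, hv⟩ : ∃ v : ℕ → L2 Ω m, ∀ j, v j = (hf j).toLp _ := ⟨_, fun _ => rfl⟩
  obtain ⟨w, hw⟩ : ∃ w : ℕ → L2 Ω l, ∀ j, w j = (hLf j).toLp _ := ⟨_, fun _ => rfl⟩
  have hvw : ∀ j, (v j, w j) ∈ (smoothOp B Ω).closure.graph := fun j => by
    rw [hv, hw]
    exact LinearPMap.le_graph_of_le (LinearPMap.le_closure _)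
      (toLp_mem_graph_smoothOp (ht j).1 (hf j) (hLf j))
  have hvN : ∀ j, ballVolume Ω (2 ^ j) ≤ ‖v j‖ ^ 2 := fun j => by
    rw [← hsinv, hv]
    exact ballVolume_le_norm_sq hone (hs0 j) ξ hc (hf j)
  have hvlim : Tendsto (fun j => ‖v j‖) atTop atTop := by
    have h1 : Tendsto (fun j => ‖v j‖ ^ 2) atTop atTop :=
      tendsto_atTop_mono hvN hvol
    have h2 := Real.tendsto_sqrt_atTop.comp h1
    refine h2.congr fun j => ?_
    rw [Function.comp, Real.sqrt_sq (norm_nonneg _)]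
  obtain ⟨C, hC⟩ := exists_norm_sq_applyOp_le (B := B) (Ω := Ω) hφ h0 hb0 ξ (c := c) (b := b)
    (by rw [hc]; linarith)
  have hwb : ∀ j, ‖w j‖ ^ 2 ≤ (1 + s j) * b * ‖v j‖ ^ 2
      + C * s j * ballVolume Ω (2 ^ (j + 1)) := fun j => by
    rw [hw, hv, ← hsinv']
    exact hC (s j) (hs0 j) (hs1 j) (hf j) (hLf j)
  refine false_of_tendsto_norm_atTop hB.isClosable.closure_isClosed (dense_neumann_domain hB) hb0 hb
    hvw hvlim dense_testFunctions ?_ ?_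
  · intro g hg
    obtain ⟨f, hf1, hf2, -, hf4⟩ := mem_testFunctions.1 hg
    have hgi : Integrable g (volume.restrict (Ω : Set (EuclideanSpace ℝ (Fin n)))) :=
      (integrable_congr hf4).2 (IsTest.integrable ⟨hf1, hf2⟩).restrict
    refine ⟨∫ x, ‖g x‖ ∂(volume.restrict (Ω : Set (EuclideanSpace ℝ (Fin n)))), fun j => ?_⟩
    rw [hv]
    exact norm_inner_cutWave_le hle _ ξ hc (hf j) hgi
  · intro ε hε
    -- The error lives on the ball of radius `2^(j+1)`, while `‖v j‖²` is only known to dominate the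
    -- volume in the ball of radius `2^j`. The ratio of these volumes need not be bounded, but
    -- polynomial growth bounds it for infinitely many `j`.
    have hfreq := frequently_doubling (by positivity) (ballVolume_two_pow_le Ω) hpos
    have hsmall : ∀ᶠ j in atTop, s j * (b + |C| * (2 * 2 ^ n)) < ε := by
      have := hslim.mul_const (b + |C| * (2 * 2 ^ n))
      rw [zero_mul] at this
      exact this.eventually (gt_mem_nhds hε)
    refine (hfreq.and_eventually hsmall).mono ?_
    rintro j ⟨h1, h2⟩
    have h3 : ballVolume Ω (2 ^ (j + 1)) ≤ 2 * 2 ^ n * ‖v j‖ ^ 2 :=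
      h1.trans (mul_le_mul_of_nonneg_left (hvN j) (by positivity))
    have h4 : C * s j * ballVolume Ω (2 ^ (j + 1)) ≤ |C| * s j * (2 * 2 ^ n * ‖v j‖ ^ 2) :=
      mul_le_mul (mul_le_mul_of_nonneg_right (le_abs_self C) (hs0 j).le) h3
        ENNReal.toReal_nonneg (mul_nonneg (abs_nonneg C) (hs0 j).le)
    have h5 := mul_le_mul_of_nonneg_right h2.le (sq_nonneg ‖v j‖)
    linarith [hwb j]

end InfiniteVolume

/-! ### Linear algebra of the trial space -/

theorem exists_submodule_finrank_eq {H : Type*} [AddCommGroup H] [Module ℂ H] {V : Submodule ℂ H}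
    {k : ℕ} (hk : (k : ℕ∞) ≤ Cardinal.toENat (Module.rank ℂ V)) :
    ∃ F ≤ V, FiniteDimensional ℂ F ∧ Module.finrank ℂ F = k := by
  obtain ⟨f, hf⟩ := exists_linearIndependent_of_le_rank (Cardinal.natCast_le_toENat.1 hk)
  have hf' : LinearIndependent ℂ fun i => (f i : H) := hf.map' V.subtype V.ker_subtype
  refine ⟨Submodule.span ℂ (Set.range fun i => (f i : H)), Submodule.span_le.2 ?_,
    FiniteDimensional.span_of_finite ℂ (Set.finite_range _), ?_⟩
  · rintro _ ⟨i, rfl⟩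
    exact (f i).2
  · rw [finrank_span_eq_card hf', Fintype.card_fin]

theorem finrank_sup_span_singleton {H : Type*} [AddCommGroup H] [Module ℂ H] {F : Submodule ℂ H}
    [FiniteDimensional ℂ F] {v : H} (hv : v ∉ F) :
    Module.finrank ℂ ↥(F ⊔ Submodule.span ℂ {v}) = Module.finrank ℂ F + 1 := by
  have hv0 : v ≠ 0 := fun h => hv (h ▸ F.zero_mem)
  have hd : F ⊓ Submodule.span ℂ {v} = ⊥ :=
    ((Submodule.disjoint_span_singleton' hv0).2 hv).eq_bot
  have h := Submodule.finrank_sup_add_finrank_inf_eq F (Submodule.span ℂ {v})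
  rwa [hd, finrank_bot, add_zero, finrank_span_singleton hv0] at h

/-- If `(v, z)` is a generalised eigenvector relative to `(u, w)`, then adding a multiple of it
does not spoil the bound `‖w‖² ≤ b ‖u‖²`. -/
theorem norm_sq_add_smul_le {H K : Type*} [NormedAddCommGroup H] [InnerProductSpace ℂ H]
    [NormedAddCommGroup K] [InnerProductSpace ℂ K] {b : ℝ} {u v : H} {w z : K}
    (huw : ‖w‖ ^ 2 ≤ b * ‖u‖ ^ 2) (hvz : ‖z‖ ^ 2 = b * ‖v‖ ^ 2)
    (h : inner ℂ z w = (b : ℂ) * inner ℂ v u) (α : ℂ) :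
    ‖w + α • z‖ ^ 2 ≤ b * ‖u + α • v‖ ^ 2 := by
  have h' : inner ℂ w z = (b : ℂ) * inner ℂ u v := by
    rw [← inner_conj_symm, h, map_mul, inner_conj_symm, Complex.conj_ofReal]
  rw [norm_add_sq (𝕜 := ℂ), norm_add_sq (𝕜 := ℂ), inner_smul_right, inner_smul_right, h',
    norm_smul, norm_smul, mul_pow, mul_pow, hvz]
  have : RCLike.re (α * ((b : ℂ) * inner ℂ u v)) = b * RCLike.re (α * inner ℂ u v) := by
    rw [mul_left_comm]
    exact Complex.re_ofReal_mul _ _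
  rw [this]
  linarith

section Comparison

variable {n m l : ℕ} {B : Coeffs n m l} {Ω : Opens (EuclideanSpace ℝ (Fin n))}

/-! ### Comparison of the eigenvalues -/

theorem exists_dirichlet_graph_of_mem_iSup {b : ℝ} {u : L2 Ω m}
    (hu : u ∈ ⨆ r ∈ Set.Iic b, eigenspace (dirichletOp B Ω) r) :
    ∃ w, (u, w) ∈ ((smoothOp B Ω).domRestrict (testFunctions Ω m)).closure.graph ∧
      ‖w‖ ^ 2 ≤ b * ‖u‖ ^ 2 := by
  obtain ⟨f, -, hf, hle⟩ := exists_formGraph_of_mem_iSup_eigenspace (dense_dirichlet_domain B Ω)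
    (fun _ hr => hr) hu
  obtain ⟨w, hw, h⟩ := mem_formGraph_iff.1 hf
  refine ⟨w, hw, ?_⟩
  rwa [h u w hw, inner_self_eq_ofReal, Complex.ofReal_re] at hle

/-- The trial space is `F + ℂv` with `v` a plane wave satisfying `L*L v = b v`. The cross terms with
`F` are exactly `b` times the inner products, so the bound on `F` survives. -/
theorem finrank_succ_le_eigenvalueCount
    [IsFiniteMeasure (volume.restrict (Ω : Set (EuclideanSpace ℝ (Fin n))))] (hn : 1 ≤ n)
    (hB : FormClosable (smoothOp B Ω)) (hΩ : (Ω : Set (EuclideanSpace ℝ (Fin n))).Nonempty)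
    {b : ℝ} (hb0 : 0 ≤ b) (hb : (b : EReal) < essBottom (neumannOp B Ω))
    (hS : (lowSet B b \ strictLowSet B b).Infinite) {F : Submodule ℂ (L2 Ω m)}
    [FiniteDimensional ℂ F] (hF : F ≤ ⨆ r ∈ Set.Iic b, eigenspace (dirichletOp B Ω) r) :
    ((Module.finrank ℂ F + 1 : ℕ) : ℕ∞) ≤ eigenvalueCount (neumannOp B Ω) (Set.Iio b) := by
  have hTc := hB.isClosable.closure_isClosed
  have hT := dense_neumann_domain hB
  have hbd := isBounded_lowSet hB hΩ hb0 hb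
  have hE : FiniteDimensional ℂ (eigenspace (neumannOp B Ω) b) := by
    have : FiniteDimensional ℂ ↥(⨆ r ∈ Set.Iic b, eigenspace (neumannOp B Ω) r) :=
      finiteDimensional_iSup_eigenspace hTc hT hb0 hb
    exact Submodule.finiteDimensional_of_le
      (le_iSup₂_of_le (f := fun r (_ : r ∈ Set.Iic b) => eigenspace (neumannOp B Ω) r)
        b Set.self_mem_Iic le_rfl)
  choose c hc0 hc using fun ξ : ↥(lowSet B b \ strictLowSet B b) =>
    exists_eigenvector_of_mem_diff ξ.2
  -- Avoiding `F` raises the dimension by one; avoiding `F + ker (A_N - b)` keeps eigenvectors with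
  -- a nonzero `v`-component out of the trial space.
  obtain ⟨ξ, hξ⟩ := exists_waveLp_notMem hΩ hS hc0 (F ⊔ eigenspace (neumannOp B Ω) b)
  have hvz := waveLp_mem_graph (B := B) (Ω := Ω) ξ (c ξ)
  have hnorm : ‖waveLp Ω (ξ : EuclideanSpace ℝ (Fin n)) (symbol B ξ (c ξ))‖ ^ 2
      = b * ‖waveLp Ω (ξ : EuclideanSpace ℝ (Fin n)) (c ξ)‖ ^ 2 := by
    have h1 : ‖symbol B ξ (c ξ)‖ ^ 2 = b * ‖c ξ‖ ^ 2 := by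
      apply Complex.ofReal_injective
      rw [Complex.ofReal_mul, ← inner_self_eq_ofReal, ← inner_self_eq_ofReal,
        ← ContinuousLinearMap.adjoint_inner_left, hc, inner_smul_left, Complex.conj_ofReal]
    rw [norm_waveLp_sq, norm_waveLp_sq, h1]
    ring
  have hinner : ∀ u w, (u, w) ∈ ((smoothOp B Ω).domRestrict (testFunctions Ω m)).closure.graph →
      inner ℂ (waveLp Ω (ξ : EuclideanSpace ℝ (Fin n)) (symbol B ξ (c ξ))) w
        = (b : ℂ) * inner ℂ (waveLp Ω (ξ : EuclideanSpace ℝ (Fin n)) (c ξ)) u := fun u w huw => by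
    rw [inner_waveLp_dirichlet hB huw, ← ContinuousLinearMap.adjoint_inner_left, hc,
      inner_smul_left, Complex.conj_ofReal, inner_waveLp]
  generalize waveLp Ω (ξ : EuclideanSpace ℝ (Fin n)) (c ξ) = v at *
  generalize waveLp Ω (ξ : EuclideanSpace ℝ (Fin n)) (symbol B ξ (c ξ)) = z at *
  rw [← finrank_sup_span_singleton fun h => hξ (Submodule.mem_sup_left h)]
  refine finrank_le_of_form_le hTc hT hb0 hb (fun x hx => ?_) fun x hx hxE => ?_
  · obtain ⟨u, hu, _, hy, rfl⟩ := Submodule.mem_sup.1 hx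
    obtain ⟨α, rfl⟩ := Submodule.mem_span_singleton.1 hy
    obtain ⟨w, hw, hle⟩ := exists_dirichlet_graph_of_mem_iSup (hF hu)
    exact ⟨w + α • z, Submodule.add_mem _ (LinearPMap.le_graph_of_le (dirichlet_le_neumann hB) hw)
      (Submodule.smul_mem _ α hvz), norm_sq_add_smul_le hle hnorm (hinner u w hw) α⟩
  · obtain ⟨u, hu, _, hy, rfl⟩ := Submodule.mem_sup.1 hx
    obtain ⟨α, rfl⟩ := Submodule.mem_span_singleton.1 hy
    obtain ⟨w, hw, -⟩ := exists_dirichlet_graph_of_mem_iSup (hF hu)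
    have hα : α = 0 := by
      by_contra hα
      refine hξ ((Submodule.smul_mem_iff _ hα).1 ?_)
      have h1 := Submodule.sub_mem (F ⊔ eigenspace (neumannOp B Ω) b)
        (Submodule.mem_sup_right hxE) (Submodule.mem_sup_left hu)
      rwa [add_sub_cancel_left] at h1
    rw [hα, zero_smul, add_zero] at hxE ⊢
    exact eq_zero_of_dirichlet_of_neumann hB hn hbd hw hxE

/-- The frequency set `lowSet B b` is not negligible if the Dirichlet realization has an
eigenvalue `≤ b`. -/
theorem volume_lowSet_ne_zero (hB : FormClosable (smoothOp B Ω)) {b : ℝ} {u : L2 Ω m}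
    (hu : u ∈ ⨆ r ∈ Set.Iic b, eigenspace (dirichletOp B Ω) r) (hu0 : u ≠ 0) :
    volume (lowSet B b) ≠ 0 := by
  intro h0
  obtain ⟨w, hw, hle⟩ := exists_dirichlet_graph_of_mem_iSup hu
  refine hu0 (eq_zero_of_dirichlet_form_le hB ?_ hw hle)
  filter_upwards [measure_eq_zero_iff_ae_notMem.1 h0] with ξ hξ c hc
  exact not_le.1 fun h => hξ ⟨c, hc, h⟩

/-- If `strictLowSet` is empty the difference is all of `lowSet`, infinite because of its positive
measure; otherwise the frontier argument applies. -/
theorem infinite_lowSet_diff_of_volume_ne_zero (hn : 2 ≤ n) {b : ℝ}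
    (hbd : Bornology.IsBounded (lowSet B b)) (h0 : volume (lowSet B b) ≠ 0) :
    (lowSet B b \ strictLowSet B b).Infinite := by
  rcases (strictLowSet B b).eq_empty_or_nonempty with hU | hU
  · rw [hU, Set.sdiff_empty]
    intro hfin
    have : Nonempty (Fin n) := ⟨⟨0, by lia⟩⟩
    exact h0 (hfin.measure_zero _)
  · exact infinite_lowSet_diff hn hbd hU

end Comparison

end Payne

end

/-! ### The comparison theorem -/

theorem mainTheorem3 {n m l : ℕ} (hn : 2 ≤ n)
    (Ω : TopologicalSpace.Opens (EuclideanSpace ℝ (Fin n)))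
    (B : Payne.Coeffs n m l)
    (hB : Payne.FormClosable (Payne.smoothOp B Ω))
    (k : ℕ) (lamD : ℝ)
    (hk : Payne.IsNthEigenvalue (Payne.dirichletOp B Ω) k lamD)
    (hpos : 0 < lamD)
    (hlt : (lamD : EReal) < Payne.essBottom (Payne.neumannOp B Ω)) :
    ∃ lamN : ℝ, Payne.IsNthEigenvalue (Payne.neumannOp B Ω) (k + 1) lamN ∧
      lamN ≤ lamD ∧
      ((∃ u ∈ Payne.eigenspace (Payne.dirichletOp B Ω) lamD,
          u ∉ (Payne.neumannOp B Ω).domain) → lamN < lamD) := by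
  open Payne in
  have hT := dense_neumann_domain hB
  have hTc := hB.isClosable.closure_isClosed
  obtain ⟨F, hF, hFfin, hFk⟩ := exists_submodule_finrank_eq hk.2.2
  have hk0 : 0 < k := by
    have := pos_of_gt hk.2.1
    exact_mod_cast this
  obtain ⟨u, huF, hu0⟩ : ∃ u ∈ F, u ≠ 0 :=
    Submodule.exists_mem_ne_zero_of_ne_bot fun h => by
      rw [h, finrank_bot] at hFk
      lia
  have hvol := volume_lowSet_ne_zero hB (hF huF) hu0
  have hΩ : (Ω : Set (EuclideanSpace ℝ (Fin n))).Nonempty := by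
    rw [Set.nonempty_iff_ne_empty]
    intro h
    refine hu0 ((Lp.eq_zero_iff_ae_eq_zero).2 ?_)
    rw [Filter.EventuallyEq, ae_restrict_iff' Ω.isOpen.measurableSet]
    exact Eventually.of_forall fun x hx => absurd (h ▸ hx) (Set.notMem_empty x)
  -- Infinite volume would empty `lowSet`, contradicting its positive measure.
  have hΩtop : volume (Ω : Set (EuclideanSpace ℝ (Fin n))) ≠ ⊤ := fun h =>
    hvol (by rw [lowSet_eq_empty_of_volume_eq_top hB h hpos.le hlt, measure_empty])
  have : IsFiniteMeasure (volume.restrict (Ω : Set (EuclideanSpace ℝ (Fin n)))) :=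
    isFiniteMeasure_restrict.2 hΩtop
  have hS := infinite_lowSet_diff_of_volume_ne_zero hn (isBounded_lowSet hB hΩ hpos.le hlt) hvol
  have hcount := finrank_succ_le_eigenvalueCount (by lia) hB hΩ hpos.le hlt hS hF
  rw [hFk] at hcount
  -- The count concerns the open half-line below `lamD`, so the eigenvalue obtained is strictly
  -- smaller.
  obtain ⟨r, hr, hrk⟩ := exists_isNthEigenvalue hlt
    (finite_eigenvalues_and_lower_bound hTc hT hpos.le hlt).1 hcount
  exact ⟨r, hrk, hr.le, fun _ => hr⟩
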